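/- For $f:\mathbb F_2^n\to\{-1,1\}$ and $\gamma\in\mathbb F_2^n$ let $\hat f(\gamma)=2^{-n}\sum_{x}f(x)(-1)^{\langle\gamma,x\rangle}$. A set $\Gamma\subseteq\mathbb F_2^n$ is called $\varepsilon$-top with respect to $f$ if $|\hat f(\alpha)|\le|\hat f(\beta)|+\varepsilon$ for all $\alpha\in\mathbb F_2^n\setminus\Gamma$ and $\beta\in\Gamma$. Theorem. There exist a randomized algorithm $V$ (the verifier), whose only access to $f$ is a random example oracle returning independent pairs $(x,f(x))$ with $x$ uniform in $\mathbb F_2^n$, and a randomized algorithm $P^*$ (the honest prover) with membership query access to $f$, such that the following holds for all $n\ge 1$, $t\in\mathbb N$, $\varepsilon>0$, $0<\delta<1$ and $f:\mathbb F_2^n\to\{-1,1\}$. Both parties are given $n$, $t$ and the accuracy and confidence parameters (in the form $\lceil 1/\varepsilon\rceil$, $\lceil\log_2(1/\delta)\rceil$). The interaction consists of three messages, all bit strings: one from the prover, one from the verifier, one from the prover. At its end the verifier outputs $\Lambda$, which is either $\bot$ (reject) or a subset of $\mathbb F_2^n$ of size exactly $t$. Below, $\mathrm{poly}$ stands for polynomials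 that do not depend on $n,t,\varepsilon,\delta,f$ or the prover. 1. Resources. In every execution, with every prover, the verifier uses at most $\mathrm{poly}(t,1/\varepsilon,\log(1/\delta))$ random examples (independently of $n$), runs in time $\mathrm{poly}(n,t,1/\varepsilon,\log(1/\delta))$ and sends at most $n\cdot\mathrm{poly}(t,1/\varepsilon,\log(1/\delta))$ bits. In every execution with $P^*$, the total communication is at most $n\cdot\mathrm{poly}(t,1/\varepsilon,\log(1/\delta))$ bits and $P^*$ runs in time $\mathrm{poly}(n,t,1/\varepsilon,\log(1/\delta))$. 2. Completeness. The output $\Lambda$ of the interaction of $P^*$ with $V$ satisfies $$\Pr\left[\Lambda\ne\bot\ \wedge\ \Lambda\text{ is }\tfrac{\varepsilon}{3}\text{-top}\right]\ \ge\ 1-\delta-\frac{\mathrm{poly}(t,1/\varepsilon,1/\delta)}{2^n}.$$ 3. Soundness. For every (possibly computationally unbounded, randomized) prover $P$, the output $\Lambda$ of the interaction of $P$ with $V$ satisfies $$\Pr\left[\Lambda\ne\bot\ \wedge\ \Lambda\text{ is not }\varepsilon\text{-top}\right]\ \le\ \delta+\frac{\mathrm{poly}(t,1/\varepsilon,1/\delta)}{2^n}.$$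 In particular, for fixed $t,\varepsilon,\delta$ the additional error terms are $o(1)$ as $n\to\infty$. -/

import Mathlib

namespace FourierIP

noncomputable section

/-! ### Fourier analysis over `F₂ⁿ` -/

/-- The vector space `F₂ⁿ`. -/
abbrev Vec (n : ℕ) : Type := Fin n → ZMod 2

/-- The character `χ_γ(x) = (-1)^⟨γ, x⟩`. -/
def chi {n : ℕ} (γ x : Vec n) : ℝ := (-1) ^ (γ ⬝ᵥ x).val

/-- The Fourier coefficient `f^(γ) = E_x [f(x) χ_γ(x)]` of `f : F₂ⁿ → {1, -1}`. -/
def fourierCoefficient {n : ℕ} (f : Vec n → ℤˣ) (γ : Vec n) : ℝ :=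
  (∑ x : Vec n, (((f x : ℤˣ) : ℤ) : ℝ) * chi γ x) / 2 ^ n

/-- `Γ` is `ε`-top with respect to `f`. -/
def IsTop {n : ℕ} (f : Vec n → ℤˣ) (ε : ℝ) (Γ : Finset (Vec n)) : Prop :=
  ∀ α, α ∉ Γ → ∀ β ∈ Γ, |fourierCoefficient f α| ≤ |fourierCoefficient f β| + ε

/-! ### Randomized oracle programs with a step count

Programs are terms of a small typed language over finite data (bits, natural numbers, pairs,
lists). They can flip fair coins and call one oracle. A program is a single finite term, used for
all input sizes. -/

/-- Data types of the language. -/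
inductive Ty : Type
  | unit : Ty
  | bool : Ty
  | nat : Ty
  | prod : Ty → Ty → Ty
  | list : Ty → Ty

/-- The values of a data type. -/
@[reducible] def Ty.interp : Ty → Type
  | .unit => Unit
  | .bool => Bool
  | .nat => ℕ
  | .prod a b => a.interp × b.interp
  | .list a => List a.interp

/-- The arithmetic operations (`sub` is truncated, `div` rounds down). -/
inductive Arith : Type
  | add : Arith
  | sub : Arith
  | mul : Arith
  | div : Arith

def Arith.apply : Arith → ℕ → ℕ → ℕ
  | .add, m, k => m + k
  | .sub, m, k => m - k
  | .mul, m, k => m * k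
  | .div, m, k => m / k

/-- The bit cost of an operation on two natural numbers, by the schoolbook methods:
the product of their binary lengths (plus one each). -/
def arithCost (m k : ℕ) : ℕ := (m.size + 1) * (k.size + 1)

/-- `Code I O a b`: programs with input type `a` and output type `b`, with access to an oracle
that takes queries of type `I` and returns answers of type `O`. -/
inductive Code (I O : Ty) : Ty → Ty → Type
  | id {a : Ty} : Code I O a a
  | comp {a b c : Ty} : Code I O a b → Code I O b c → Code I O a c
  | unit {a : Ty} : Code I O a .unit
  | pair {a b c : Ty} : Code I O a b → Code I O a c → Code I O a (.prod b c)
  | fst {a b : Ty} : Code I O (.prod a b) a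
  | snd {a b : Ty} : Code I O (.prod a b) b
  | bit {a : Ty} (b : Bool) : Code I O a .bool
  | ite {a b : Ty} : Code I O a .bool → Code I O a b → Code I O a b → Code I O a b
  | num {a : Ty} (k : ℕ) : Code I O a .nat
  | arith (op : Arith) : Code I O (.prod .nat .nat) .nat
  | le : Code I O (.prod .nat .nat) .bool
  | nil {a b : Ty} : Code I O a (.list b)
  | cons {b : Ty} : Code I O (.prod b (.list b)) (.list b)
  /-- Case distinction on a list: the empty case, and the case of a head and a tail. -/
  | caseList {a b c : Ty} : Code I O a (.list b) → Code I O a c →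
      Code I O (.prod a (.prod b (.list b))) c → Code I O a c
  /-- `loop count init body`: evaluate `count` and `init`, then update the value of `init` by
  `body` (which also sees the input) as many times as `count` says. -/
  | loop {a b : Ty} : Code I O a .nat → Code I O a b → Code I O (.prod a b) b → Code I O a b
  /-- Flip a fair coin. -/
  | coin {a : Ty} : Code I O a .bool
  /-- Call the oracle. -/
  | call : Code I O I O

/-- The result of a computation: its value, the number of steps, the number of oracle calls. -/
structure Run (α : Type) : Type where
  val : α
  steps : ℕ
  calls : ℕ

/-- A computation that returns `v` after `k` steps without calling the oracle. -/
def ret {α : Type} (k : ℕ) (v : α) : PMF (Run α) := PMF.pure ⟨v, k, 0⟩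

/-- Sequential composition; steps and calls add up. -/
def andThen {α β : Type} (p : PMF (Run α)) (g : α → PMF (Run β)) : PMF (Run β) :=
  p.bind fun r => (g r.val).map fun r' => ⟨r'.val, r.steps + r'.steps, r.calls + r'.calls⟩

/-- One additional step. -/
def tick {α : Type} (p : PMF (Run α)) : PMF (Run α) :=
  p.map fun r => ⟨r.val, r.steps + 1, r.calls⟩

/-- Run `body` for `k` rounds, with one additional step for each round. -/
def iter {α : Type} (body : α → PMF (Run α)) : ℕ → α → PMF (Run α)
  | 0, s => ret 0 s
  | k + 1, s => tick (andThen (body s) (iter body k))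

/-- The semantics of programs, with respect to a (possibly randomized) oracle. Each constructor
costs one step when it is executed (values are shared, not copied, as in a pointer machine);
arithmetic and comparison cost in addition their bit cost. -/
def Code.eval {I O : Ty} (o : I.interp → PMF O.interp) :
    {a b : Ty} → Code I O a b → a.interp → PMF (Run b.interp)
  | _, _, .id, x => ret 1 x
  | _, _, .comp g h, x => tick (andThen (g.eval o x) fun y => h.eval o y)
  | _, _, .unit, _ => ret 1 ()
  | _, _, .pair g h, x =>
      tick (andThen (g.eval o x) fun y => andThen (h.eval o x) fun z => ret 0 (y, z))
  | _, _, .fst, x => ret 1 x.1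
  | _, _, .snd, x => ret 1 x.2
  | _, _, .bit b, _ => ret 1 b
  | _, _, .ite c g h, x =>
      tick (andThen (c.eval o x) fun b : Bool => if b then g.eval o x else h.eval o x)
  | _, _, .num k, _ => ret 1 k
  | _, _, .arith op, x => ret (1 + arithCost x.1 x.2) (op.apply x.1 x.2)
  | _, _, .le, x => ret (1 + arithCost x.1 x.2) (decide (x.1 ≤ x.2))
  | _, _, .nil, _ => ret 1 []
  | _, _, .cons, x => ret 1 (x.1 :: x.2)
  | _, _, .caseList l g h, x =>
      tick (andThen (l.eval o x) fun l =>
        match l with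
        | [] => g.eval o x
        | y :: ys => h.eval o (x, (y, ys)))
  | _, _, .loop c i g, x =>
      tick (andThen (c.eval o x) fun k => andThen (i.eval o x) fun s =>
        iter (fun s => g.eval o (x, s)) k s)
  | _, _, .coin, _ => (PMF.uniformOfFintype Bool).map fun b => ⟨b, 1, 0⟩
  | _, _, .call, x => (o x).map fun y => ⟨y, 1, 1⟩

/-! ### Oracles -/

/-- Bit strings. -/
abbrev Ty.bits : Ty := .list .bool

/-- A vector of `F₂ⁿ` as a list of `n` bits. -/
def encodeVec {n : ℕ} (x : Vec n) : List Bool := List.ofFn fun i => decide (x i = 1)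

/-- The vector that a list of bits stands for (only the first `n` bits count, missing bits
are zero). -/
def decodeVec (n : ℕ) (l : List Bool) : Vec n := fun i => if l.getD i false then 1 else 0

/-- The bit of a label: `1` is `false` and `-1` is `true`. -/
def encodeLabel (u : ℤˣ) : Bool := decide (u = -1)

/-- A labelled example. -/
abbrev Ty.example : Ty := .prod .bits .bool

/-- The random example oracle: a fresh `(x, f x)` with uniform `x`, at every call. -/
def exampleOracle {n : ℕ} (f : Vec n → ℤˣ) : Ty.unit.interp → PMF Ty.example.interp :=
  fun _ => (PMF.uniformOfFintype (Vec n)).map fun x => (encodeVec x, encodeLabel (f x))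

/-- The membership query oracle: `x ↦ f x`. -/
def queryOracle {n : ℕ} (f : Vec n → ℤˣ) : Ty.bits.interp → PMF Ty.bool.interp :=
  fun l => PMF.pure (encodeLabel (f (decodeVec n l)))

/-! ### Three-message interactive protocols -/

/-- The type of the explicit inputs. -/
abbrev Ty.params : Ty := .prod .nat (.prod .nat (.prod .nat .nat))

/-- The explicit inputs of both parties: `n`, `t`, and the accuracy and confidence parameters in
the finite form `⌈1/ε⌉` and `⌈log₂(1/δ)⌉`. -/
def params (n t : ℕ) (ε δ : ℝ) : Ty.params.interp :=
  (n, t, ⌈1 / ε⌉₊, ⌈Real.logb 2 (1 / δ)⌉₊)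

/-- A verifier: two randomized programs with random example access only. The first sees the
explicit inputs and the prover's first message, and returns the verifier's message together with
a private state. The second sees this state and the prover's second message, and returns an
acceptance bit and a list of vectors. -/
structure Verifier : Type where
  State : Ty
  challenge : Code .unit .example (.prod .params .bits) (.prod .bits State)
  conclude : Code .unit .example (.prod State .bits) (.prod .bool (.list .bits))

/-- An arbitrary, computationally unbounded, randomized prover: it sends a first message, keeps a
private state, and answers the verifier's message. The `steps` and `calls` in its moves are
meaningful only when they come from a program, and play no role otherwise. -/
structure Prover : Type 1 where
  State : Type
  first : PMF (Run (List Bool × State))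
  second : State → List Bool → PMF (Run (List Bool))

/-- A prover that consists of two randomized programs with membership query access. -/
structure ProverProgram : Type where
  State : Ty
  first : Code .bits .bool .params (.prod .bits State)
  second : Code .bits .bool (.prod State .bits) .bits

/-- The prover that executes the programs `P` on given explicit inputs, with queries to `f`. -/
def ProverProgram.toProver (P : ProverProgram) {n : ℕ} (f : Vec n → ℤˣ)
    (p : Ty.params.interp) : Prover where
  State := P.State.interp
  first := P.first.eval (queryOracle f) p
  second := fun s m => P.second.eval (queryOracle f) (s, m)

/-- What happened in an execution. In `output`, `none` stands for rejection. -/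
structure Outcome (n : ℕ) : Type where
  proverMsg₁ : List Bool
  verifierMsg : List Bool
  proverMsg₂ : List Bool
  output : Option (Finset (Vec n))
  samples : ℕ
  verifierSteps : ℕ
  proverSteps : ℕ

/-- The total number of communicated bits. -/
def Outcome.communication {n : ℕ} (ω : Outcome n) : ℕ :=
  ω.proverMsg₁.length + ω.verifierMsg.length + ω.proverMsg₂.length

/-- The verifier's answer: reject, or the set of the listed vectors. -/
def decodeOutput (n : ℕ) (r : Bool × List (List Bool)) : Option (Finset (Vec n)) :=
  if r.1 then some (r.2.map (decodeVec n)).toFinset else none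

/-- The interaction of `P` with `V` on explicit inputs `p`, where `V` has random example access
to `f`: prover's message, verifier's message, prover's message, output of the verifier. -/
def interact (P : Prover) (V : Verifier) {n : ℕ} (f : Vec n → ℤˣ) (p : Ty.params.interp) :
    PMF (Outcome n) :=
  P.first.bind fun a =>
  (V.challenge.eval (exampleOracle f) (p, a.val.1)).bind fun b =>
  (P.second a.val.2 b.val.1).bind fun c =>
  (V.conclude.eval (exampleOracle f) (b.val.2, c.val)).map fun d =>
    { proverMsg₁ := a.val.1
      verifierMsg := b.val.1
      proverMsg₂ := c.val
      output := decodeOutput n d.val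
      samples := b.calls + d.calls
      verifierSteps := b.steps + d.steps
      proverSteps := a.steps + c.steps }

/-- The probability of an event. -/
def prob {α : Type} (p : PMF α) (E : α → Prop) : ℝ := (p.toOuterMeasure {ω | E ω}).toReal

/-- The polynomial bound `C (1 + x)^k` (with `x` the sum of the parameters, every polynomial in
nonnegative parameters is bounded by one of this form). -/
def polyBound (C k : ℕ) (x : ℝ) : ℝ := C * (1 + x) ^ k

end

end FourierIP

/-!
Let `A = 9 ⌈1/ε⌉²`. Then `1/A ≤ (ε/3)²`, so that errors below `1/A` in the squares of the Fourier
coefficients are harmless (`isTop_of_fsq`).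

The honest prover finds all `γ` with `f^(γ)² > 1/(8A)` by queries, in a tree search in the style of
Goldreich and Levin: it keeps those suffixes for which the vectors that end in them have a total
squared coefficient of at least about `1/(8A)` (`suffix_mem_heavy`). It sends these candidates. The
verifier can estimate their coefficients from random examples alone. What it cannot see is whether a
large coefficient is missing from the list, and this is what the other two messages are for.

The verifier splits `F₂ⁿ` into buckets by a random linear map `γ ↦ (⟨γ, Z r⟩)_r` to `F₂ᵏ`, where `2ᵏ`
does not depend on `n`. The mass of a bucket `b`, the sum of `f^(γ)²` over its elements, equals
`E [f(x) f(x + ∑ c_r Z_r) (-1)^⟨b, c⟩]` for uniform `x` and `c` (`sum_corr`). With an example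
`(x, f x)` at hand, one further value of `f` gives a sample, and the verifier asks the prover for this
value. It mixes these points with points `x` of examples, for which it knows the answer. All points
that it sends are uniform and independent of which of them are tests (`choicesEquiv`), so a prover
with `r` wrong answers escapes detection only with probability `2^(-r)` (`freq_hidden_le`), and a few
wrong answers hardly affect the estimates. The verifier accepts if in every bucket the estimated mass
is explained by the candidates.

Soundness: a missing `γ` with `f^(γ)² > 1/A` makes the mass of its bucket exceed what the candidates
explain (`fsq_le_of_blockOK`). Completeness: if `f^(γ)² ≤ 1/(8A)` outside of the list, then the
unexplained mass `R` of a bucket satisfies `R² ≤ R/(8A) + (mass of the colliding pairs)`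
(`residual_le`). The last term is small with probability `1/2` over the map (`freq_collisions`), and
it is enough that one of several independent maps works. The output consists of the `t` vectors of
largest estimated coefficient among the candidates and `t` distinct padding vectors; the error term
with `2^(-n)` is needed only when there are no `t` vectors at all.

The programs are not written down as terms. `Eff D K` says that some program samples from the
distribution `D` in polynomial time with at most `K` oracle calls; it is closed under composition,
pairing, case distinction and bounded loops, and its deterministic case `PT` is proved by `fun_prop`.
Messages from the other party are of type `Raw` and have input size zero. This is why the verifier's
running time is bounded no matter what the prover sends.
-/

namespace FourierIP

/-! ### Data and polynomial bounds -/

/-- A bit string that arrived from outside (a message or the point of an example). Its length is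
unknown and does not count as input size, so that a program that reads only a prefix of it still
runs in time polynomial in the size of the remaining input. -/
structure Raw : Type where
  bits : List Bool

/-- Lean types whose elements are represented as data of the programming language. `sz` is the
input size in which running times are measured; natural numbers count in unary. -/
class Coded (α : Type) where
  ty : Ty
  enc : α → ty.interp
  sz : α → ℕ

open Coded

instance : Coded Unit := ⟨.unit, fun x => x, fun _ => 0⟩
instance : Coded Bool := ⟨.bool, fun x => x, fun _ => 0⟩
instance : Coded ℕ := ⟨.nat, fun x => x, fun x => x⟩
instance : Coded Raw := ⟨.bits, fun x => x.bits, fun _ => 0⟩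
instance {α β : Type} [Coded α] [Coded β] : Coded (α × β) :=
  ⟨.prod (ty α) (ty β), fun x => (enc x.1, enc x.2), fun x => sz x.1 + sz x.2⟩
instance {α : Type} [Coded α] : Coded (List α) :=
  ⟨.list (ty α), fun l => l.map enc, fun l => (l.map fun x => sz x + 1).sum⟩

section PolyBounds

variable {α : Type} [Coded α]

/-- `f` is bounded by a polynomial in the input size. -/
def PB (f : α → ℕ) : Prop := ∃ C : ℕ, ∀ x, f x ≤ (sz x + 2) ^ C

theorem PB.mono {f g : α → ℕ} (hg : PB g) (h : ∀ x, f x ≤ g x) : PB f :=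
  hg.imp fun _ hC x => (h x).trans (hC x)

theorem PB.size : PB (fun x : α => sz x) := ⟨1, fun x => by simp⟩

theorem PB.const (k : ℕ) : PB (fun _ : α => k) :=
  ⟨k, fun x => (Nat.lt_two_pow_self (n := k)).le.trans (Nat.pow_le_pow_left (by omega) k)⟩

theorem PB.mul {f g : α → ℕ} (hf : PB f) (hg : PB g) : PB (fun x => f x * g x) := by
  obtain ⟨C, hC⟩ := hf
  obtain ⟨D, hD⟩ := hg
  exact ⟨C + D, fun x => by rw [pow_add]; exact Nat.mul_le_mul (hC x) (hD x)⟩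

theorem PB.add {f g : α → ℕ} (hf : PB f) (hg : PB g) : PB (fun x => f x + g x) := by
  obtain ⟨C, hC⟩ := hf
  obtain ⟨D, hD⟩ := hg
  refine ⟨C + D + 1, fun x => ?_⟩
  have h1 : (sz x + 2) ^ C ≤ (sz x + 2) ^ (C + D) := Nat.pow_le_pow_right (by omega) (by omega)
  have h2 : (sz x + 2) ^ D ≤ (sz x + 2) ^ (C + D) := Nat.pow_le_pow_right (by omega) (by omega)
  have h3 : 2 * (sz x + 2) ^ (C + D) ≤ (sz x + 2) ^ (C + D + 1) := by
    rw [pow_succ, mul_comm]; exact Nat.mul_le_mul_left _ (by omega)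
  have := hC x
  have := hD x
  change f x + g x ≤ _
  omega

theorem PB.pow {f : α → ℕ} (hf : PB f) (k : ℕ) : PB (fun x => f x ^ k) := by
  induction k with
  | zero => simpa using PB.const 1
  | succ k ih => simpa only [pow_succ] using ih.mul hf

theorem PB.arithCost {f g : α → ℕ} (hf : PB f) (hg : PB g) :
    PB (fun x => arithCost (f x) (g x)) := by
  refine ((hf.add (PB.const 1)).mul (hg.add (PB.const 1))).mono fun x => ?_
  exact Nat.mul_le_mul (Nat.succ_le_succ (Nat.size_le.2 (Nat.lt_two_pow_self)))
    (Nat.succ_le_succ (Nat.size_le.2 (Nat.lt_two_pow_self)))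

/-- A polynomial of a polynomially bounded size. -/
theorem PB.comp {f : α → ℕ} (hf : PB f) (C : ℕ) : PB (fun x => (f x + 2) ^ C) :=
  (hf.add (PB.const 2)).pow C

end PolyBounds

/-! ### Randomized polynomial-time programs -/

section Programs

variable {I O : Ty} {α β γ σ : Type} [Coded α] [Coded β] [Coded γ] [Coded σ]

/-- The computation `p` samples from `q` (up to encoding) within `T` steps and `K` oracle calls,
and the samples have size at most `T`. -/
def Samples {a : Ty} (p : PMF (Run a.interp)) (q : PMF β) (e : β → a.interp) (T K : ℕ) : Prop :=
  p.map Run.val = q.map e ∧ (∀ r ∈ p.support, r.steps ≤ T ∧ r.calls ≤ K) ∧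
    ∀ y ∈ q.support, sz y ≤ T

theorem Samples.mono {a : Ty} {p : PMF (Run a.interp)} {q : PMF β} {e : β → a.interp}
    {T K T' K' : ℕ} (h : Samples p q e T K) (hT : T ≤ T') (hK : K ≤ K') : Samples p q e T' K' :=
  ⟨h.1, fun r hr => ⟨(h.2.1 r hr).1.trans hT, (h.2.1 r hr).2.trans hK⟩,
    fun y hy => (h.2.2 y hy).trans hT⟩

theorem Samples.ret {a : Ty} (k : ℕ) (y : β) (e : β → a.interp) :
    Samples (ret k (e y)) (PMF.pure y) e (k + sz y) 0 := by
  refine ⟨by simp [FourierIP.ret, PMF.pure_map], fun r hr => ?_, fun z hz => ?_⟩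
  · simp only [FourierIP.ret, PMF.support_pure, Set.mem_singleton_iff] at hr
    subst hr; simp
  · simp only [PMF.support_pure, Set.mem_singleton_iff] at hz
    subst hz; simp

theorem Samples.exists_val {a : Ty} {p : PMF (Run a.interp)} {q : PMF β} {e : β → a.interp}
    {T K : ℕ} (h : Samples p q e T K) {r : Run a.interp} (hr : r ∈ p.support) :
    ∃ y ∈ q.support, e y = r.val := by
  have : r.val ∈ (p.map Run.val).support := by
    rw [PMF.support_map]; exact ⟨r, hr, rfl⟩
  rw [h.1, PMF.support_map] at this
  exact this

theorem Samples.tick {a : Ty} {p : PMF (Run a.interp)} {q : PMF β} {e : β → a.interp}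
    {T K : ℕ} (h : Samples p q e T K) : Samples (tick p) q e (T + 1) K := by
  refine ⟨?_, fun r hr => ?_, fun y hy => (h.2.2 y hy).trans (Nat.le_succ _)⟩
  · rw [← h.1, FourierIP.tick, PMF.map_comp]; rfl
  · rw [FourierIP.tick, PMF.support_map] at hr
    obtain ⟨r', hr', rfl⟩ := hr
    exact ⟨Nat.succ_le_succ (h.2.1 r' hr').1, (h.2.1 r' hr').2⟩

theorem bind_congr_support {α β : Type*} (p : PMF α) {f g : α → PMF β}
    (h : ∀ a ∈ p.support, f a = g a) : p.bind f = p.bind g := by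
  ext b
  simp only [PMF.bind_apply]
  refine tsum_congr fun a => ?_
  by_cases ha : a ∈ p.support
  · rw [h a ha]
  · rw [PMF.mem_support_iff, not_not] at ha
    simp [ha]

theorem Samples.andThen {a b : Ty} {p : PMF (Run a.interp)} {q : PMF β} {e : β → a.interp}
    {T K T' K' : ℕ} {g : a.interp → PMF (Run b.interp)} {q' : β → PMF γ} {e' : γ → b.interp}
    (h : Samples p q e T K) (h' : ∀ y ∈ q.support, Samples (g (e y)) (q' y) e' T' K') :
    Samples (andThen p g) (q.bind q') e' (T + T') (K + K') := by
  refine ⟨?_, fun r hr => ?_, fun z hz => ?_⟩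
  · rw [FourierIP.andThen, PMF.map_bind, PMF.map_bind]
    have h1 : ∀ r : Run a.interp, ((g r.val).map fun r' : Run b.interp =>
        (⟨r'.val, r.steps + r'.steps, r.calls + r'.calls⟩ : Run b.interp)).map Run.val =
          (g r.val).map Run.val := fun r => by rw [PMF.map_comp]; rfl
    simp only [h1]
    have h2 : (p.bind fun r => (g r.val).map Run.val) =
        (p.map Run.val).bind fun v => (g v).map Run.val := by
      rw [PMF.bind_map]; rfl
    rw [h2, h.1, PMF.bind_map]
    exact bind_congr_support _ fun y hy => (h' y hy).1
  · simp only [FourierIP.andThen, PMF.mem_support_bind_iff, PMF.support_map] at hr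
    obtain ⟨r1, hr1, r2, hr2, rfl⟩ := hr
    obtain ⟨y, hy, hy'⟩ := h.exists_val hr1
    rw [← hy'] at hr2
    have := h.2.1 r1 hr1
    have := (h' y hy).2.1 r2 hr2
    simp only; omega
  · rw [PMF.mem_support_bind_iff] at hz
    obtain ⟨y, hy, hz⟩ := hz
    exact ((h' y hy).2.2 z hz).trans (Nat.le_add_left _ _)

variable (I O) in
/-- `D`, a distribution that depends on the oracle and the input, can be sampled by a program in
time polynomial in the input size, with at most `K x` oracle calls on input `x`. -/
def Eff (D : (I.interp → PMF O.interp) → α → PMF β) (K : α → ℕ) : Prop :=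
  ∃ (c : Code I O (ty α) (ty β)) (T : α → ℕ), PB T ∧
    ∀ o x, Samples (c.eval o (enc x)) (D o x) enc (T x) (K x)

variable (I O) in
/-- `F` is computable in polynomial time, without oracle and coins. -/
def PT (F : α → β) : Prop := Eff I O (fun _ x => PMF.pure (F x)) (fun _ => 0)

theorem Eff.mono {D : (I.interp → PMF O.interp) → α → PMF β} {K K' : α → ℕ} (h : Eff I O D K)
    (hK : ∀ x, K x ≤ K' x) : Eff I O D K' := by
  obtain ⟨c, T, hT, h⟩ := h
  exact ⟨c, T, hT, fun o x => (h o x).mono le_rfl (hK x)⟩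

theorem Eff.sz_le {D : (I.interp → PMF O.interp) → α → PMF β} {K : α → ℕ} (h : Eff I O D K) :
    ∃ T : α → ℕ, PB T ∧ ∀ o x, ∀ y ∈ (D o x).support, sz y ≤ T x := by
  obtain ⟨c, T, hT, h⟩ := h
  exact ⟨T, hT, fun o x y hy => (h o x).2.2 y hy⟩

theorem Ty.nonempty (a : Ty) : Nonempty a.interp := by
  induction a with
  | unit => exact ⟨()⟩
  | bool => exact ⟨true⟩
  | nat => exact ⟨(0 : ℕ)⟩
  | prod a b iha ihb => exact ⟨(iha.some, ihb.some)⟩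
  | list a => exact ⟨[]⟩

theorem PT.sz_le {F : α → β} (h : PT I O F) : PB (fun x => sz (F x)) := by
  obtain ⟨T, hT, h⟩ := Eff.sz_le h
  exact hT.mono fun x => h (fun _ => PMF.pure O.nonempty.some) x _ (by simp)

/-- A single instruction that computes `F`. -/
theorem PT.of_eval {F : α → β} (c : Code I O (ty α) (ty β)) (T : α → ℕ) (hT : PB T)
    (hF : PB fun x => sz (F x)) (h : ∀ o x, c.eval o (enc x) = ret (T x) (enc (F x))) :
    PT I O F :=
  ⟨c, _, hT.add hF, fun o x => by rw [h o x]; exact Samples.ret _ _ _⟩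

/-- Sequential composition. -/
theorem Eff.comp {D : (I.interp → PMF O.interp) → α → PMF β} {K : α → ℕ}
    {E : (I.interp → PMF O.interp) → β → PMF γ} {K' : β → ℕ} {J : α → ℕ}
    (hE : Eff I O E K') (hD : Eff I O D K)
    (hJ : ∀ o x, ∀ y ∈ (D o x).support, K x + K' y ≤ J x) :
    Eff I O (fun o x => (D o x).bind (E o)) J := by
  obtain ⟨c, T, hT, h⟩ := hD
  obtain ⟨d, T', ⟨C, hC⟩, h'⟩ := hE
  refine ⟨.comp c d, fun x => T x + (T x + 2) ^ C + 1, (hT.add (hT.comp C)).add (PB.const 1),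
    fun o x => ?_⟩
  have hJ0 : K x ≤ J x := by
    obtain ⟨y, hy⟩ := (D o x).support_nonempty
    exact (Nat.le_add_right _ _).trans (hJ o x y hy)
  have := (h o x).andThen (T' := (T x + 2) ^ C) (K' := J x - K x) (g := d.eval o)
    (e' := enc) (q' := E o) fun y hy => (h' o y).mono
      ((hC y).trans (Nat.pow_le_pow_left (Nat.add_le_add_right ((h o x).2.2 y hy) 2) C))
      (by have := hJ o x y hy; omega)
  exact (this.tick).mono le_rfl (by omega)

theorem PT.comp {G : β → γ} {F : α → β} (hG : PT I O G) (hF : PT I O F) :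
    PT I O (fun x => G (F x)) := by
  have := Eff.comp (J := fun _ => 0) hG hF (by simp)
  simp only [PMF.pure_bind] at this
  exact this

theorem Eff.comp_pt {E : (I.interp → PMF O.interp) → β → PMF γ} {K : β → ℕ} {F : α → β}
    (hE : Eff I O E K) (hF : PT I O F) : Eff I O (fun o x => E o (F x)) (fun x => K (F x)) := by
  have := Eff.comp (J := fun x => K (F x)) hE hF (by simp)
  simpa only [PMF.pure_bind] using this

theorem Eff.pair {D : (I.interp → PMF O.interp) → α → PMF β} {K : α → ℕ}
    {E : (I.interp → PMF O.interp) → α → PMF γ} {K' : α → ℕ}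
    (hD : Eff I O D K) (hE : Eff I O E K') :
    Eff I O (fun o x => (D o x).bind fun y => (E o x).bind fun z => PMF.pure (y, z))
      (fun x => K x + K' x) := by
  obtain ⟨c, T, hT, h⟩ := hD
  obtain ⟨d, T', hT', h'⟩ := hE
  refine ⟨.pair c d, fun x => T x + (T' x + (T x + T' x)) + 1,
    (hT.add (hT'.add (hT.add hT'))).add (PB.const 1), fun o x => ?_⟩
  refine Samples.tick (Samples.andThen (h o x) (K' := K' x) fun y hy => ?_)
  refine Samples.mono (K := K' x + 0) (T := T' x + (T x + T' x))
    (Samples.andThen (h' o x) fun z hz => ?_) le_rfl le_rfl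
  exact (Samples.ret (a := ty (β × γ)) 0 (y, z) enc).mono
    ((Nat.zero_add _).trans_le (Nat.add_le_add ((h o x).2.2 y hy) ((h' o x).2.2 z hz))) le_rfl

theorem PT.pair {F : α → β} {G : α → γ} (hF : PT I O F) (hG : PT I O G) :
    PT I O (fun x => (F x, G x)) := by
  have := Eff.pair hF hG
  simp only [PMF.pure_bind] at this
  exact this

theorem PT.id : PT I O (fun x : α => x) :=
  .of_eval .id (fun _ => 1) (PB.const 1) PB.size fun _ _ => rfl

theorem PT.fst' : PT I O (fun x : α × β => x.1) :=
  .of_eval .fst (fun _ => 1) (PB.const 1) (PB.size.mono fun _ => Nat.le_add_right _ _) fun _ _ => rfl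

theorem PT.snd' : PT I O (fun x : α × β => x.2) :=
  .of_eval .snd (fun _ => 1) (PB.const 1) (PB.size.mono fun _ => Nat.le_add_left _ _) fun _ _ => rfl

theorem PT.fst {F : α → β × γ} (hF : PT I O F) : PT I O (fun x => (F x).1) := PT.fst'.comp hF

theorem PT.snd {F : α → β × γ} (hF : PT I O F) : PT I O (fun x => (F x).2) := PT.snd'.comp hF

/-- Sampling that also sees the outcome of an earlier sampling step. -/
theorem Eff.bind {D : (I.interp → PMF O.interp) → α → PMF β} {K : α → ℕ}
    {E : (I.interp → PMF O.interp) → α × β → PMF γ} {K' : α × β → ℕ} {J : α → ℕ}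
    (hD : Eff I O D K) (hE : Eff I O E K')
    (hJ : ∀ o x, ∀ y ∈ (D o x).support, K x + K' (x, y) ≤ J x) :
    Eff I O (fun o x => (D o x).bind fun y => E o (x, y)) J := by
  have h1 := Eff.pair (I := I) (O := O) (PT.id (α := α)) hD
  have := Eff.comp (J := J) hE h1 (by
    intro o x y hy
    simp only [PMF.pure_bind, PMF.mem_support_bind_iff, PMF.support_pure,
      Set.mem_singleton_iff] at hy
    obtain ⟨z, hz, rfl⟩ := hy
    simpa using hJ o x z hz)
  simpa only [PMF.pure_bind, PMF.bind_bind] using this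

theorem Eff.ite {b : α → Bool} {D E : (I.interp → PMF O.interp) → α → PMF β} {K : α → ℕ}
    (hb : PT I O b) (hD : Eff I O D K) (hE : Eff I O E K) :
    Eff I O (fun o x => if b x then D o x else E o x) K := by
  obtain ⟨c, T, hT, h⟩ := hb
  obtain ⟨c1, T1, hT1, h1⟩ := hD
  obtain ⟨c2, T2, hT2, h2⟩ := hE
  refine ⟨.ite c c1 c2, fun x => T x + (T1 x + T2 x) + 1, (hT.add (hT1.add hT2)).add (PB.const 1),
    fun o x => ?_⟩
  have := (h o x).andThen (T' := T1 x + T2 x) (K' := K x)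
    (g := fun v : Bool => if v then c1.eval o (enc x) else c2.eval o (enc x))
    (e' := enc) (q' := fun v : Bool => if v then D o x else E o x) fun y _ => by
      cases y
      · exact (h2 o x).mono (Nat.le_add_left _ _) le_rfl
      · exact (h1 o x).mono (Nat.le_add_right _ _) le_rfl
  rw [PMF.pure_bind, Nat.zero_add] at this
  exact this.tick

theorem PT.ite {b : α → Bool} {F G : α → β} (hb : PT I O b) (hF : PT I O F) (hG : PT I O G) :
    PT I O (fun x => if b x then F x else G x) := by
  have := Eff.ite hb hF hG
  unfold PT
  convert this using 3
  dsimp only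
  split <;> rfl

/-- The distribution after `k` rounds. -/
noncomputable def iterD (body : σ → PMF σ) : ℕ → σ → PMF σ
  | 0, s => PMF.pure s
  | k + 1, s => (body s).bind (iterD body k)

theorem Samples.iter {a : Ty} {body : a.interp → PMF (Run a.interp)} {D : σ → PMF σ}
    {e : σ → a.interp} {T K S : ℕ} (Inv : ℕ → σ → Prop) (k : ℕ)
    (hbody : ∀ i s, i < k → Inv i s → Samples (body (e s)) (D s) e T K)
    (hInv : ∀ i s, i < k → Inv i s → ∀ s' ∈ (D s).support, Inv (i + 1) s')
    (hS : ∀ i s, i ≤ k → Inv i s → sz s ≤ S) (s : σ) (hs : Inv 0 s) :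
    Samples (iter body k (e s)) (iterD D k s) e (k * (T + 1) + S) (k * K) := by
  induction k generalizing Inv s with
  | zero =>
    exact (Samples.ret 0 s e).mono (by simpa using hS 0 s le_rfl hs) (Nat.zero_le _)
  | succ k ih =>
    have h1 := (hbody 0 s (Nat.succ_pos k) hs).andThen (g := FourierIP.iter body k) (e' := e)
      (q' := iterD D k) fun s' hs' => ih (fun i => Inv (i + 1))
        (fun i s hi => hbody (i + 1) s (by omega)) (fun i s hi => hInv (i + 1) s (by omega))
        (fun i s hi => hS (i + 1) s (by omega)) s' (hInv 0 s (Nat.succ_pos k) hs s' hs')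
    exact (h1.tick).mono (by ring_nf; omega) (by ring_nf; omega)

/-- Bounded loops, with an invariant that bounds the size of the state. -/
theorem Eff.loop {N : α → ℕ} {init : α → σ} {D : (I.interp → PMF O.interp) → α × σ → PMF σ}
    {K : α × σ → ℕ} (hN : PT I O N) (hi : PT I O init) (hD : Eff I O D K)
    (Inv : α → ℕ → σ → Prop) (h0 : ∀ x, Inv x 0 (init x))
    (hInv : ∀ o x i s, i < N x → Inv x i s → ∀ s' ∈ (D o (x, s)).support, Inv x (i + 1) s')
    {S : α → ℕ} (hS : PB S) (hsz : ∀ x i s, i ≤ N x → Inv x i s → sz s ≤ S x)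
    {κ : α → ℕ} (hκ : ∀ x i s, i < N x → Inv x i s → K (x, s) ≤ κ x) :
    Eff I O (fun o x => iterD (fun s => D o (x, s)) (N x) (init x)) (fun x => N x * κ x) := by
  have hNsz := hN.sz_le
  obtain ⟨c, T, hT, h⟩ := hN
  obtain ⟨c1, T1, hT1, h1⟩ := hi
  obtain ⟨c2, T2, ⟨C, hC⟩, h2⟩ := hD
  refine ⟨.loop c c1 c2, fun x => T x + (T1 x + (N x * ((sz x + S x + 2) ^ C + 1) + S x)) + 1,
    (hT.add (hT1.add ((PB.mul hNsz (((PB.size.add hS).comp C).add (PB.const 1))).add hS))).add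
      (PB.const 1), fun o x => ?_⟩
  have hb := Samples.iter (body := fun s => c2.eval o (enc x, s)) (e := (enc : σ → _))
    (D := fun s => D o (x, s)) (T := (sz x + S x + 2) ^ C) (K := κ x) (S := S x) (Inv x) (N x)
    (fun i s hi hs => (h2 o (x, s)).mono ((hC _).trans (Nat.pow_le_pow_left
      (Nat.add_le_add_right (Nat.add_le_add_left (hsz x i s hi.le hs) _) 2) C)) (hκ x i s hi hs))
    (hInv o x) (hsz x) (init x) (h0 x)
  have h3 := (h1 o x).andThen (g := FourierIP.iter (fun s => c2.eval o (enc x, s)) (N x))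
    (e' := enc) (q' := iterD (fun s => D o (x, s)) (N x)) (T' := _) (K' := _) fun y hy => by
      simp only [PMF.support_pure, Set.mem_singleton_iff] at hy
      subst hy
      exact hb
  have h4 := (h o x).andThen (e' := enc) (T' := _) (K' := _)
    (q' := fun k => iterD (fun s => D o (x, s)) k (init x))
    (g := fun k => FourierIP.andThen (c1.eval o (enc x)) fun s =>
        FourierIP.iter (fun s => c2.eval o (enc x, s)) k s) fun y hy => by
      simp only [PMF.support_pure, Set.mem_singleton_iff] at hy
      subst hy
      rw [PMF.pure_bind] at h3
      exact h3
  rw [PMF.pure_bind] at h4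
  exact h4.tick.mono le_rfl (by simp)

end Programs

end FourierIP

namespace FourierIP

open Coded

attribute [fun_prop] PT
attribute [fun_prop] PT.id PT.comp PT.pair PT.fst PT.snd PT.ite

variable {I O : Ty} {α β γ σ : Type} [Coded α] [Coded β] [Coded γ] [Coded σ]

/-! ### Arithmetic, Booleans, constants -/

theorem prod_sz (x : α × β) : sz x = sz x.1 + sz x.2 := rfl

@[simp] theorem nil_sz : sz ([] : List α) = 0 := rfl

@[simp] theorem cons_sz (x : α) (l : List α) : sz (x :: l) = sz x + 1 + sz l := rfl

theorem PT.arith (op : Arith) (h : ∀ m k, op.apply m k ≤ m * k + m + k) :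
    PT I O (fun x : ℕ × ℕ => op.apply x.1 x.2) := by
  have h1 : PB fun x : ℕ × ℕ => x.1 := PB.size.mono fun x => Nat.le_add_right x.1 x.2
  have h2 : PB fun x : ℕ × ℕ => x.2 := PB.size.mono fun x => Nat.le_add_left x.2 x.1
  exact .of_eval (.arith op) (fun x => 1 + arithCost x.1 x.2) ((PB.const 1).add (h1.arithCost h2))
    ((((h1.mul h2).add h1).add h2).mono fun x => h x.1 x.2) fun _ _ => rfl

@[fun_prop] theorem PT.add {F G : α → ℕ} (hF : PT I O F) (hG : PT I O G) :
    PT I O (fun x => F x + G x) :=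
  PT.comp (PT.arith .add fun m k => by simp only [Arith.apply]; omega) (hF.pair hG)

@[fun_prop] theorem PT.sub {F G : α → ℕ} (hF : PT I O F) (hG : PT I O G) :
    PT I O (fun x => F x - G x) :=
  PT.comp (PT.arith .sub fun m k => by simp only [Arith.apply]; omega) (hF.pair hG)

@[fun_prop] theorem PT.mul {F G : α → ℕ} (hF : PT I O F) (hG : PT I O G) :
    PT I O (fun x => F x * G x) :=
  PT.comp (PT.arith .mul fun m k => by simp only [Arith.apply]; omega) (hF.pair hG)

@[fun_prop] theorem PT.div {F G : α → ℕ} (hF : PT I O F) (hG : PT I O G) :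
    PT I O (fun x => F x / G x) :=
  PT.comp (PT.arith .div fun m k => by
    have := Nat.div_le_self m k
    simp only [Arith.apply]; omega) (hF.pair hG)

@[fun_prop] theorem PT.le {F G : α → ℕ} (hF : PT I O F) (hG : PT I O G) :
    PT I O (fun x => decide (F x ≤ G x)) := by
  have h1 : PB fun x : ℕ × ℕ => x.1 := PB.size.mono fun x => Nat.le_add_right x.1 x.2
  have h2 : PB fun x : ℕ × ℕ => x.2 := PB.size.mono fun x => Nat.le_add_left x.2 x.1
  exact PT.comp (G := fun x : ℕ × ℕ => decide (x.1 ≤ x.2)) (.of_eval .le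
    (fun x => 1 + arithCost x.1 x.2) ((PB.const 1).add (h1.arithCost h2)) (PB.const 0)
      fun _ _ => rfl) (hF.pair hG)

/-- Every fixed value is computed by a program in constant time. -/
theorem exists_code_const (a b : Ty) (v : b.interp) :
    ∃ (c : Code I O a b) (T : ℕ), ∀ o x, c.eval o x = ret T v := by
  induction b with
  | unit => exact ⟨.unit, 1, fun _ _ => rfl⟩
  | bool => exact ⟨.bit v, 1, fun _ _ => rfl⟩
  | nat => exact ⟨.num v, 1, fun _ _ => rfl⟩
  | prod b c ihb ihc =>
    obtain ⟨c1, T1, h1⟩ := ihb v.1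
    obtain ⟨c2, T2, h2⟩ := ihc v.2
    refine ⟨.pair c1 c2, T1 + (T2 + 0) + 1, fun o x => ?_⟩
    simp only [Code.eval, h1, h2, ret, andThen, tick, PMF.pure_bind, PMF.pure_map]
  | list b ih =>
    induction v with
    | nil => exact ⟨.nil, 1, fun _ _ => rfl⟩
    | cons y l ihl =>
      obtain ⟨c1, T1, h1⟩ := ih y
      obtain ⟨c2, T2, h2⟩ := ihl
      refine ⟨.comp (.pair c1 c2) .cons, T1 + (T2 + 0) + 1 + 1 + 1, fun o x => ?_⟩
      simp only [Code.eval, h1, h2, ret, andThen, tick, PMF.pure_bind, PMF.pure_map]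

@[fun_prop] theorem PT.const (b : β) : PT I O (fun _ : α => b) := by
  obtain ⟨c, T, h⟩ := exists_code_const (I := I) (O := O) (ty α) (ty β) (enc b)
  exact .of_eval c (fun _ => T) (PB.const T) (PB.const _) fun o x => h o _

@[fun_prop] theorem PT.and {F G : α → Bool} (hF : PT I O F) (hG : PT I O G) :
    PT I O (fun x => F x && G x) := by
  have : PT I O (fun x => if F x then G x else false) := by fun_prop
  convert this using 2 with x
  cases F x <;> rfl

@[fun_prop] theorem PT.not {F : α → Bool} (hF : PT I O F) : PT I O (fun x => !F x) := by
  have : PT I O (fun x => if F x then false else true) := by fun_prop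
  convert this using 2 with x
  cases F x <;> rfl

@[fun_prop] theorem PT.or {F G : α → Bool} (hF : PT I O F) (hG : PT I O G) :
    PT I O (fun x => F x || G x) := by
  have : PT I O (fun x => if F x then true else G x) := by fun_prop
  convert this using 2 with x
  cases F x <;> rfl

@[fun_prop] theorem PT.xor {F G : α → Bool} (hF : PT I O F) (hG : PT I O G) :
    PT I O (fun x => F x ^^ G x) := by
  have : PT I O (fun x => if F x then !G x else G x) := by fun_prop
  convert this using 2 with x
  cases F x <;> cases G x <;> rfl

@[fun_prop] theorem PT.lt {F G : α → ℕ} (hF : PT I O F) (hG : PT I O G) :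
    PT I O (fun x => decide (F x < G x)) := by
  have : PT I O (fun x => decide (F x + 1 ≤ G x)) := by fun_prop
  exact this

@[fun_prop] theorem PT.eq {F G : α → ℕ} (hF : PT I O F) (hG : PT I O G) :
    PT I O (fun x => decide (F x = G x)) := by
  have : PT I O (fun x => decide (F x ≤ G x) && decide (G x ≤ F x)) := by fun_prop
  convert this using 2 with x
  rw [← Bool.decide_and, decide_eq_decide]
  exact le_antisymm_iff

@[fun_prop] theorem PT.mod {F G : α → ℕ} (hF : PT I O F) (hG : PT I O G) :
    PT I O (fun x => F x % G x) := by
  have : PT I O (fun x => F x - G x * (F x / G x)) := by fun_prop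
  convert this using 2 with x
  exact Nat.mod_eq_sub_mul_div

@[fun_prop] theorem PT.pow {F : α → ℕ} (hF : PT I O F) (k : ℕ) :
    PT I O (fun x => F x ^ k) := by
  induction k with
  | zero => simpa using PT.const 1
  | succ k ih => simp only [pow_succ]; fun_prop

/-! ### Bounded recursion -/

omit [Coded σ] in
theorem iterD_pure (g : σ → σ) (k : ℕ) (s : σ) :
    iterD (fun s => PMF.pure (g s)) k s = PMF.pure (g^[k] s) := by
  induction k generalizing s with
  | zero => rfl
  | succ k ih => simp only [iterD, PMF.pure_bind, ih, Function.iterate_succ_apply]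

/-- Recursion of polynomial length is in polynomial time if all intermediate values are of
polynomial size. -/
theorem PT.natRec {N : α → ℕ} {init : α → σ} {step : α → ℕ → σ → σ} (hN : PT I O N)
    (hi : PT I O init) (hs : PT I O (fun p : α × ℕ × σ => step p.1 p.2.1 p.2.2))
    {S : α → ℕ} (hS : PB S)
    (hsz : ∀ x i, i ≤ N x → sz (Nat.rec (init x) (step x) i : σ) ≤ S x) :
    PT I O (fun x => (Nat.rec (init x) (step x) (N x) : σ)) := by
  have hb : PT I O (fun p : α × ℕ × σ => (p.2.1 + 1, step p.1 p.2.1 p.2.2)) := by fun_prop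
  have := Eff.loop (init := fun x => (0, init x)) hN (by fun_prop) hb
    (fun x i s => s = (i, Nat.rec (init x) (step x) i)) (fun _ => rfl)
    (by
      intro o x i s _ hs s' hs'
      simp only [PMF.support_pure, Set.mem_singleton_iff] at hs'
      subst hs
      exact hs') (S := fun x => N x + S x) (hN.sz_le.add hS)
    (by
      intro x i s hi hs
      subst hs
      exact Nat.add_le_add hi (hsz x i hi))
    (κ := fun _ => 0) (fun _ _ _ _ _ => le_rfl)
  have h2 : PT I O (fun x => (fun s : ℕ × σ => (s.1 + 1, step x s.1 s.2))^[N x] (0, init x)) := by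
    unfold PT
    simpa only [iterD_pure, mul_zero] using this
  have h3 : ∀ x k, (fun s : ℕ × σ => (s.1 + 1, step x s.1 s.2))^[k] (0, init x) =
      (k, Nat.rec (init x) (step x) k) := by
    intro x k
    induction k with
    | zero => rfl
    | succ k ih => rw [Function.iterate_succ_apply', ih]
  simp only [h3] at h2
  exact h2.snd

@[fun_prop] theorem PT.sumRange {N : α → ℕ} {f : α → ℕ → ℕ} (hN : PT I O N)
    (hf : PT I O (fun p : α × ℕ => f p.1 p.2)) :
    PT I O (fun x => ∑ i ∈ Finset.range (N x), f x i) := by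
  have h1 : ∀ x k, (Nat.rec 0 (fun i acc => acc + f x i) k : ℕ) = ∑ i ∈ Finset.range k, f x i := by
    intro x k
    induction k with
    | zero => rfl
    | succ k ih => rw [Finset.sum_range_succ, ← ih]
  obtain ⟨C, hC⟩ := hf.sz_le
  have hs : PT I O (fun p : α × ℕ × ℕ => p.2.2 + f p.1 p.2.1) :=
    PT.add (by fun_prop) (hf.comp (F := fun p : α × ℕ × ℕ => (p.1, p.2.1)) (by fun_prop))
  have := PT.natRec (init := fun _ => 0) (step := fun x i acc => acc + f x i) hN (PT.const 0) hs
    (S := fun x => N x * ((sz x + N x) + 2) ^ C) (PB.mul hN.sz_le ((PB.size.add hN.sz_le).comp C))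
    (by
      intro x i hi
      rw [h1]
      refine (Finset.sum_le_card_nsmul _ _ (((sz x + N x) + 2) ^ C) fun j hj => ?_).trans ?_
      · refine (hC (x, j)).trans (Nat.pow_le_pow_left ?_ C)
        rw [Finset.mem_range] at hj
        change sz x + j + 2 ≤ _
        omega
      · rw [Finset.card_range, smul_eq_mul]
        exact Nat.mul_le_mul_right _ hi)
  simpa only [h1] using this

@[fun_prop] theorem PT.allRange {N : α → ℕ} {f : α → ℕ → Bool} (hN : PT I O N)
    (hf : PT I O (fun p : α × ℕ => f p.1 p.2)) :
    PT I O (fun x => (List.range (N x)).all (f x)) := by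
  have : PT I O (fun x => decide (∑ i ∈ Finset.range (N x), (if f x i then 0 else 1) = 0)) := by
    fun_prop
  convert this using 2 with x
  rw [Bool.eq_iff_iff]
  simp

@[fun_prop] theorem PT.anyRange {N : α → ℕ} {f : α → ℕ → Bool} (hN : PT I O N)
    (hf : PT I O (fun p : α × ℕ => f p.1 p.2)) :
    PT I O (fun x => (List.range (N x)).any (f x)) := by
  have : PT I O (fun x => !(List.range (N x)).all fun i => !f x i) := by fun_prop
  convert this using 2 with x
  exact List.any_eq_not_all_not

/-! ### Lists -/

@[fun_prop] theorem PT.cons {F : α → β} {G : α → List β} (hF : PT I O F) (hG : PT I O G) :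
    PT I O (fun x => F x :: G x) :=
  PT.comp (G := fun p : β × List β => p.1 :: p.2) (.of_eval .cons (fun _ => 1) (PB.const 1)
    ((PB.size.add (PB.const 1)).mono fun p => by
      rw [cons_sz, prod_sz]; omega) fun _ _ => rfl) (hF.pair hG)

theorem PT.listCases {l : α → List β} {F : α → γ} {G : α → β → List β → γ} (hl : PT I O l)
    (hF : PT I O F) (hG : PT I O (fun p : α × β × List β => G p.1 p.2.1 p.2.2)) :
    PT I O (fun x => (List.casesOn (l x) (F x) (G x) : γ)) := by
  have hlsz := hl.sz_le
  obtain ⟨c, T, hT, h⟩ := hl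
  obtain ⟨c1, T1, hT1, h1⟩ := hF
  obtain ⟨c2, T2, ⟨C, hC⟩, h2⟩ := hG
  refine ⟨.caseList c c1 c2, fun x => T x + (T1 x + (sz x + sz (l x) + 2) ^ C) + 1,
    (hT.add (hT1.add ((PB.size.add hlsz).comp C))).add (PB.const 1), fun o x => ?_⟩
  have := (h o x).andThen (T' := T1 x + (sz x + sz (l x) + 2) ^ C) (K' := 0)
    (g := fun v : List (ty β).interp => match v with
        | [] => c1.eval o (enc x)
        | y :: ys => c2.eval o (enc x, (y, ys)))
    (e' := enc) (q' := fun v : List β => PMF.pure (List.casesOn v (F x) (G x) : γ)) fun v hv => by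
      simp only [PMF.support_pure, Set.mem_singleton_iff] at hv
      subst hv
      rcases hlx : l x with _ | ⟨y, ys⟩
      · exact (h1 o x).mono (Nat.le_add_right _ _) le_rfl
      · refine (h2 o (x, y, ys)).mono (((hC _).trans (Nat.pow_le_pow_left ?_ C)).trans
          (Nat.le_add_left _ _)) le_rfl
        rw [prod_sz, prod_sz, cons_sz]
        dsimp only
        omega
  rw [PMF.pure_bind] at this
  have he : Code.eval o (Code.caseList c c1 c2) (enc x) = FourierIP.tick (FourierIP.andThen
      (c.eval o (enc x)) fun v : List (ty β).interp => match v with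
        | [] => c1.eval o (enc x)
        | y :: ys => c2.eval o (enc x, (y, ys))) := by
    rw [Code.eval]
    congr 2
    funext v
    cases v <;> rfl
  rw [he]
  exact this.tick

@[fun_prop] theorem PT.tail {l : α → List β} (hl : PT I O l) : PT I O (fun x => (l x).tail) := by
  have := PT.listCases (F := fun _ => []) (G := fun _ _ bs => bs) hl (by fun_prop) (by fun_prop)
  convert this using 2 with x
  cases l x <;> rfl

theorem tail_sz_le (l : List α) : sz l.tail ≤ sz l := by
  cases l with
  | nil => exact le_rfl
  | cons x l => simp

theorem drop_sz_le (l : List α) (i : ℕ) : sz (l.drop i) ≤ sz l := by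
  induction i with
  | zero => exact le_rfl
  | succ i ih => rw [← List.tail_drop]; exact (tail_sz_le _).trans ih

@[fun_prop] theorem PT.drop {l : α → List β} {N : α → ℕ} (hN : PT I O N) (hl : PT I O l) :
    PT I O (fun x => (l x).drop (N x)) := by
  have h1 : ∀ x k, (Nat.rec (l x) (fun _ acc => acc.tail) k : List β) = (l x).drop k := by
    intro x k
    induction k with
    | zero => rfl
    | succ k ih => rw [← List.tail_drop, ← ih]
  have := PT.natRec (init := l) (step := fun _ _ acc => acc.tail) hN hl (by fun_prop) hl.sz_le
    (fun x i _ => by rw [h1]; exact drop_sz_le _ _)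
  simpa only [h1] using this

@[fun_prop] theorem PT.getD {l : α → List β} {N : α → ℕ} (hl : PT I O l) (hN : PT I O N) (d : β) :
    PT I O (fun x => (l x).getD (N x) d) := by
  have := PT.listCases (l := fun x => (l x).drop (N x)) (F := fun _ => d) (G := fun _ b _ => b)
    (by fun_prop) (by fun_prop) (by fun_prop)
  convert this using 2 with x
  rw [List.getD_eq_getElem?_getD, ← List.head?_drop]
  cases (l x).drop (N x) <;> rfl

@[fun_prop] theorem PT.lt_length {l : α → List β} {N : α → ℕ} (hl : PT I O l) (hN : PT I O N) :
    PT I O (fun x => decide (N x < (l x).length)) := by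
  have := PT.listCases (l := fun x => (l x).drop (N x)) (F := fun _ => false)
    (G := fun _ _ _ => true) (by fun_prop) (by fun_prop) (by fun_prop)
  convert this using 2 with x
  rcases h : (l x).drop (N x) with _ | ⟨y, ys⟩
  · simpa [List.drop_eq_nil_iff] using h
  · have : ¬ (l x).length ≤ N x := fun hle => by simp [List.drop_eq_nil_of_le hle] at h
    simpa using this

/-- The `v i` with `p i`, for `i < N`, in decreasing order of `i`. -/
def collect {β : Type} (p : ℕ → Bool) (v : ℕ → β) : ℕ → List β
  | 0 => []
  | N + 1 => if p N then v N :: collect p v N else collect p v N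

@[fun_prop] theorem PT.collect {N : α → ℕ} {p : α → ℕ → Bool} {v : α → ℕ → β} (hN : PT I O N)
    (hp : PT I O (fun q : α × ℕ => p q.1 q.2)) (hv : PT I O (fun q : α × ℕ => v q.1 q.2)) :
    PT I O (fun x => collect (p x) (v x) (N x)) := by
  have h1 : ∀ x k, (Nat.rec [] (fun i acc => if p x i then v x i :: acc else acc) k : List β) =
      FourierIP.collect (p x) (v x) k := by
    intro x k
    induction k with
    | zero => rfl
    | succ k ih => rw [FourierIP.collect, ← ih]
  obtain ⟨C, hC⟩ := hv.sz_le
  have hp' : PT I O (fun q : α × ℕ × List β => p q.1 q.2.1) :=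
    hp.comp (F := fun q : α × ℕ × List β => (q.1, q.2.1)) (by fun_prop)
  have hv' : PT I O (fun q : α × ℕ × List β => v q.1 q.2.1) :=
    hv.comp (F := fun q : α × ℕ × List β => (q.1, q.2.1)) (by fun_prop)
  have := PT.natRec (init := fun _ => [])
    (step := fun x i acc => if p x i then v x i :: acc else acc) hN (PT.const []) (by fun_prop)
    (S := fun x => N x * (((sz x + N x) + 2) ^ C + 1))
    (PB.mul hN.sz_le (((PB.size.add hN.sz_le).comp C).add (PB.const 1)))
    (by
      intro x i hi
      refine le_trans ?_ (Nat.mul_le_mul_right _ hi)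
      rw [h1]
      induction i with
      | zero => simp [FourierIP.collect]
      | succ i ih =>
        have ih := ih (by omega)
        have h2 : sz (v x i) ≤ (sz x + N x + 2) ^ C := by
          refine (hC (x, i)).trans (Nat.pow_le_pow_left ?_ C)
          change sz x + i + 2 ≤ _
          omega
        rw [FourierIP.collect, Nat.succ_mul]
        split
        · rw [cons_sz]; omega
        · omega)
  simpa only [h1] using this

/-! ### Bit strings from outside -/

/-- The bit at a position; positions beyond the end count as `false`. -/
def Raw.get (r : Raw) (i : ℕ) : Bool := r.bits.getD i false

@[fun_prop] theorem PT.rawMk {F : α → List Bool} (hF : PT I O F) : PT I O (fun x => Raw.mk (F x)) := by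
  refine PT.comp (G := Raw.mk) (.of_eval .id (fun _ => 1) (PB.const 1) (PB.const 0) fun _ l => ?_) hF
  have : (enc l : List Bool) = l := List.map_id _
  change ret 1 _ = ret 1 l
  rw [this]

/-- A step that looks at the first bit of a message takes constant time, whatever its length. -/
theorem PT.rawCases {G : Bool → Raw → γ} {d : γ}
    (hG : PT I O (fun p : Bool × Raw => G p.1 p.2)) :
    PT I O (fun r : Raw => (List.casesOn r.bits d (fun b l => G b ⟨l⟩) : γ)) := by
  obtain ⟨c, T, ⟨C, hC⟩, h⟩ := hG
  obtain ⟨c0, T0, h0⟩ := exists_code_const (I := I) (O := O) .bits (ty γ) (enc d)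
  refine ⟨.caseList .id c0 (.comp .snd c), fun _ => 1 + (2 ^ C + T0 + sz d + 2) + 1, PB.const _,
    fun o r => ?_⟩
  have he : Code.eval o (Code.caseList .id c0 (.comp .snd c)) (enc r) = FourierIP.tick
      (FourierIP.andThen (ret (α := List Bool) 1 r.bits) fun v : List Bool => match v with
        | [] => c0.eval o r.bits
        | y :: ys => FourierIP.tick (FourierIP.andThen (ret (α := Bool × List Bool) 1 (y, ys))
            fun z => c.eval o z)) := by
    rw [Code.eval]
    congr 2
    funext v
    cases v <;> rfl
  rw [he]
  have := (Samples.ret (a := ty Raw) 1 r enc).andThen (T' := 2 ^ C + T0 + sz d + 2) (K' := 0)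
    (g := fun v : List Bool => match v with
        | [] => c0.eval o r.bits
        | y :: ys => FourierIP.tick (FourierIP.andThen (ret (α := Bool × List Bool) 1 (y, ys))
            fun z => c.eval o z))
    (e' := enc) (q' := fun r : Raw => PMF.pure (List.casesOn r.bits d (fun b l => G b ⟨l⟩) : γ))
      fun v hv => by
      simp only [PMF.support_pure, Set.mem_singleton_iff] at hv
      subst hv
      rcases v with ⟨_ | ⟨y, ys⟩⟩
      · have := Samples.ret T0 d (enc : γ → _)
        rw [← h0 o []] at this
        refine this.mono ?_ le_rfl
        have := Nat.zero_le (2 ^ C)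
        omega
      · have h2 := (h o (y, ⟨ys⟩)).mono (hC _) le_rfl
        have h3 := Samples.andThen (Samples.ret (a := ty (Bool × Raw)) 1 (y, ⟨ys⟩) enc)
          (q' := fun p : Bool × Raw => PMF.pure (G p.1 p.2)) (g := c.eval o) (e' := enc)
          (T' := 2 ^ C) (K' := 0) fun p hp => by
            simp only [PMF.support_pure, Set.mem_singleton_iff] at hp
            subst hp
            exact h2
        rw [PMF.pure_bind] at h3
        refine (h3.tick).mono ?_ le_rfl
        change 1 + 0 + 2 ^ C + 1 ≤ _
        omega
  rw [PMF.pure_bind] at this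
  exact this.tick.mono le_rfl le_rfl

@[fun_prop] theorem PT.rawGet {r : α → Raw} {N : α → ℕ} (hr : PT I O r) (hN : PT I O N) :
    PT I O (fun x => (r x).get (N x)) := by
  have ht : PT I O (fun r : Raw => Raw.mk r.bits.tail) := by
    have := PT.rawCases (I := I) (O := O) (G := fun _ r => r) (d := ⟨[]⟩) (by fun_prop)
    convert this using 2 with x
    rcases x with ⟨_ | _⟩ <;> rfl
  have hh : PT I O (fun r : Raw => r.bits.headD false) := by
    have := PT.rawCases (I := I) (O := O) (G := fun b _ => b) (d := false) (by fun_prop)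
    convert this using 2 with x
    rcases x with ⟨_ | _⟩ <;> rfl
  have h1 : ∀ x k, (Nat.rec (r x) (fun _ acc => Raw.mk acc.bits.tail) k : Raw) =
      ⟨(r x).bits.drop k⟩ := by
    intro x k
    induction k with
    | zero => rfl
    | succ k ih =>
      rw [← List.tail_drop]
      change Raw.mk (Raw.bits (Nat.rec (r x) (fun _ acc => Raw.mk acc.bits.tail) k)).tail = _
      rw [ih]
  have := PT.natRec (init := r) (step := fun _ _ acc => Raw.mk acc.bits.tail) hN hr
    (ht.comp (F := fun p : α × ℕ × Raw => p.2.2) (by fun_prop)) (PB.const 0)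
    (fun x i _ => le_rfl)
  simp only [h1] at this
  have := hh.comp this
  convert this using 2 with x
  rw [Raw.get, List.getD_eq_getElem?_getD, ← List.head?_drop]
  cases List.drop (N x) (r x).bits <;> rfl

/-! ### Randomized programs: repeated sampling, coins, oracle calls -/

/-- Independent samples from `D i` for `i < N`, listed in front of `acc`. -/
noncomputable def tabD (D : ℕ → PMF β) : ℕ → List β → PMF (List β)
  | 0, acc => PMF.pure acc
  | N + 1, acc => (D N).bind fun y => tabD D N (y :: acc)

/-- A table of polynomially many independent samples. -/
theorem Eff.tab {N : α → ℕ} {D : (I.interp → PMF O.interp) → α × ℕ → PMF β} {K : α × ℕ → ℕ}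
    {κ : α → ℕ} (hN : PT I O N) (hD : Eff I O D K) (hκ : ∀ x i, i < N x → K (x, i) ≤ κ x) :
    Eff I O (fun o x => tabD (fun i => D o (x, i)) (N x) []) (fun x => N x * κ x) := by
  obtain ⟨T, ⟨C, hC⟩, hT⟩ := hD.sz_le
  have h1 := hD.comp_pt (F := fun p : α × ℕ × List β => (p.1, p.2.1 - 1)) (by fun_prop)
  have h2 := Eff.bind (J := fun p : α × ℕ × List β => K (p.1, p.2.1 - 1)) h1
    (show PT I O (fun q : (α × ℕ × List β) × β => (q.1.2.1 - 1, q.2 :: q.1.2.2)) by fun_prop)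
    (fun _ _ _ _ => le_rfl)
  have h3 := Eff.loop (init := fun x => (N x, [])) (κ := κ) hN (by fun_prop) h2
    (fun x i s => s.1 = N x - i ∧ sz s.2 ≤ i * ((sz x + N x + 2) ^ C + 1))
    (fun x => ⟨rfl, by simp⟩)
    (by
      rintro o x i ⟨c, acc⟩ hi ⟨rfl, hacc⟩ s' hs'
      simp only [PMF.mem_support_bind_iff, PMF.support_pure, Set.mem_singleton_iff] at hs'
      obtain ⟨y, hy, rfl⟩ := hs'
      refine ⟨by simp only; omega, ?_⟩
      have h4 : sz y ≤ (sz x + N x + 2) ^ C := by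
        refine ((hT o _ y hy).trans (hC _)).trans (Nat.pow_le_pow_left ?_ C)
        change sz x + (N x - i - 1) + 2 ≤ _
        omega
      rw [cons_sz, Nat.succ_mul]
      simp only at hacc ⊢
      omega)
    (S := fun x => N x + N x * ((sz x + N x + 2) ^ C + 1))
    (hN.sz_le.add (PB.mul hN.sz_le (((PB.size.add hN.sz_le).comp C).add (PB.const 1))))
    (by
      rintro x i ⟨c, acc⟩ hi ⟨rfl, hacc⟩
      refine Nat.add_le_add (Nat.sub_le _ _) (hacc.trans (Nat.mul_le_mul_right _ hi)))
    (by
      rintro x i ⟨c, acc⟩ hi ⟨rfl, hacc⟩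
      exact hκ x _ (by simp only; omega))
  have h4 := Eff.comp (J := fun x => N x * κ x) (PT.snd' (I := I) (O := O) (α := ℕ)
    (β := List β)) h3 (fun _ _ _ _ => le_rfl)
  convert h4 using 3 with o x
  have h5 : ∀ k acc, (iterD (fun s : ℕ × List β => (D o (x, s.1 - 1)).bind fun y =>
      PMF.pure (s.1 - 1, y :: s.2)) k (k, acc)).bind (fun s => PMF.pure s.2) =
        tabD (fun i => D o (x, i)) k acc := by
    intro k
    induction k with
    | zero => intro acc; simp [iterD, tabD]
    | succ k ih => intro acc; simp [iterD, tabD, ih]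
  exact (h5 _ _).symm

omit [Coded β] in
theorem tabD_pure (f : ℕ → β) (N : ℕ) (acc : List β) :
    tabD (fun i => PMF.pure (f i)) N acc = PMF.pure ((List.range N).map f ++ acc) := by
  induction N generalizing acc with
  | zero => rfl
  | succ N ih => simp [tabD, ih, List.range_succ]

@[fun_prop] theorem PT.mapRange {N : α → ℕ} {f : α → ℕ → β} (hN : PT I O N)
    (hf : PT I O (fun p : α × ℕ => f p.1 p.2)) :
    PT I O (fun x => (List.range (N x)).map (f x)) := by
  have := Eff.tab (κ := fun _ => 0) hN hf (fun _ _ _ => le_rfl)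
  simp only [tabD_pure, List.append_nil, mul_zero] at this
  exact this

/-- A fair coin. -/
theorem Eff.coin : Eff I O (fun _ (_ : α) => PMF.uniformOfFintype Bool) (fun _ => 0) := by
  refine ⟨.coin, fun _ => 1, PB.const 1, fun o x => ⟨?_, fun r hr => ?_, fun y _ => Nat.zero_le 1⟩⟩
  · change ((PMF.uniformOfFintype Bool).map fun b => (⟨b, 1, 0⟩ : Run Bool)).map Run.val = _
    rw [PMF.map_comp]; rfl
  · change r ∈ ((PMF.uniformOfFintype Bool).map fun b => (⟨b, 1, 0⟩ : Run Bool)).support at hr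
    rw [PMF.support_map] at hr
    obtain ⟨b, _, rfl⟩ := hr
    exact ⟨le_rfl, le_rfl⟩

/-- A call of the random example oracle. -/
theorem Eff.example : Eff (β := Raw × Bool) .unit .example
    (fun o (_ : α) => (o ()).map fun y => (Raw.mk y.1, y.2)) (fun _ => 1) := by
  have h : Eff (α := Unit) (β := Raw × Bool) .unit .example
      (fun o _ => (o ()).map fun y => (Raw.mk y.1, y.2)) (fun _ => 1) := by
    refine ⟨.call, fun _ => 1, PB.const 1, fun o x => ⟨?_, fun r hr => ?_, fun y _ => ?_⟩⟩
    · change ((o ()).map fun b => (⟨b, 1, 1⟩ : Run (List Bool × Bool))).map Run.val = _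
      rw [PMF.map_comp, PMF.map_comp]; rfl
    · change r ∈ ((o ()).map fun b => (⟨b, 1, 1⟩ : Run (List Bool × Bool))).support at hr
      rw [PMF.support_map] at hr
      obtain ⟨b, _, rfl⟩ := hr
      exact ⟨le_rfl, le_rfl⟩
    · change 0 + 0 ≤ 1
      omega
  exact h.comp_pt (PT.const ())

/-- A membership query. -/
theorem Eff.query : Eff .bits .bool (fun o (q : Raw) => o q.bits) (fun _ => 1) := by
  refine ⟨.call, fun _ => 1, PB.const 1, fun o x => ⟨?_, fun r hr => ?_, fun y _ => Nat.zero_le _⟩⟩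
  · change ((o x.bits).map fun b => (⟨b, 1, 1⟩ : Run Bool)).map Run.val = _
    rw [PMF.map_comp]; rfl
  · change r ∈ ((o x.bits).map fun b => (⟨b, 1, 1⟩ : Run Bool)).support at hr
    rw [PMF.support_map] at hr
    obtain ⟨b, _, rfl⟩ := hr
    exact ⟨le_rfl, le_rfl⟩

end FourierIP

namespace FourierIP

open Coded

variable {I O : Ty} {α β γ σ : Type} [Coded α] [Coded β] [Coded γ] [Coded σ]

/-! ### Elementary number-theoretic programs -/

@[fun_prop] theorem PT.divPow {F N : α → ℕ} (hF : PT I O F) (hN : PT I O N) :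
    PT I O (fun x => F x / 2 ^ N x) := by
  have h1 : ∀ x k, (Nat.rec (F x) (fun _ acc => acc / 2) k : ℕ) = F x / 2 ^ k := by
    intro x k
    induction k with
    | zero => simp
    | succ k ih => rw [pow_succ, ← Nat.div_div_eq_div_mul, ← ih]
  have := PT.natRec (init := F) (step := fun _ _ acc => acc / 2) hN hF (by fun_prop) hF.sz_le
    (fun x i _ => by rw [h1]; exact Nat.div_le_self _ _)
  simpa only [h1] using this

@[fun_prop] theorem PT.testBit {F N : α → ℕ} (hF : PT I O F) (hN : PT I O N) :
    PT I O (fun x => (F x).testBit (N x)) := by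
  simp only [Nat.testBit_eq_decide_div_mod_eq]
  fun_prop

@[fun_prop] theorem PT.log {F : α → ℕ} (hF : PT I O F) : PT I O (fun x => Nat.log 2 (F x)) := by
  have : PT I O (fun x => ∑ i ∈ Finset.range (F x),
      if decide (F x / 2 ^ (i + 1) = 0) then 0 else 1) := by fun_prop
  convert this using 2 with x
  rcases Nat.eq_zero_or_pos (F x) with h0 | h0
  · simp [h0]
  · have : ∀ i, (if decide (F x / 2 ^ (i + 1) = 0) then 0 else 1) =
        if i < Nat.log 2 (F x) then 1 else 0 := by
      intro i
      have h1 : F x / 2 ^ (i + 1) = 0 ↔ ¬ i < Nat.log 2 (F x) := by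
        rw [Nat.div_eq_zero_iff_lt (by positivity), ← Nat.log_lt_iff_lt_pow (by norm_num) h0.ne']
        omega
      simp only [h1, decide_eq_true_eq]
      split <;> simp_all
    simp only [this]
    rw [← Finset.sum_filter, Finset.sum_const, smul_eq_mul, mul_one]
    have h2 : (Finset.range (F x)).filter (fun i => i < Nat.log 2 (F x)) =
        Finset.range (Nat.log 2 (F x)) := by
      ext i
      have := Nat.log_le_self 2 (F x)
      simp only [Finset.mem_filter, Finset.mem_range]
      omega
    rw [h2, Finset.card_range]

/-- The parity of the number of `i < N` with `g i`. -/
def parity (g : ℕ → Bool) (N : ℕ) : Bool :=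
  decide ((∑ i ∈ Finset.range N, if g i then 1 else 0) % 2 = 1)

@[fun_prop] theorem PT.parity {N : α → ℕ} {g : α → ℕ → Bool} (hN : PT I O N)
    (hg : PT I O (fun p : α × ℕ => g p.1 p.2)) : PT I O (fun x => parity (g x) (N x)) := by
  unfold FourierIP.parity
  fun_prop

/-! ### Parameters of the protocol -/

/-- The explicit inputs `(n, t, ⌈1/ε⌉, ⌈log₂(1/δ)⌉)`. -/
abbrev Params : Type := ℕ × ℕ × ℕ × ℕ

/-- The inverse of the accuracy for squared coefficients: `1 / accInv ⌈1/ε⌉ ≤ (ε / 3)²`. -/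
def accInv (a : ℕ) : ℕ := 9 * a ^ 2

/-- The number of candidates that the prover sends. The honest prover's candidates have squared
coefficients of at least `1 / (16 * accInv a)`, and the sum of all squared coefficients is `1`. -/
def numCand (a : ℕ) : ℕ := 16 * accInv a

/-- An upper bound on the number of buckets of a hash function. With more than half as many buckets,
the expected mass of the colliding pairs is at most `1 / (128 * accInv a ^ 2)`. -/
def numBuckets (a : ℕ) : ℕ := 256 * accInv a ^ 2

/-- The number of output bits of a hash function. -/
def hashBits (a : ℕ) : ℕ := Nat.log 2 (numBuckets a)

/-- The number of hash functions that the verifier tries. Each of them has few collisions with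
probability at least `1 / 2`. -/
def numBlocks (l : ℕ) : ℕ := l + 4

/-- The tolerance of the verifier's test, which corresponds to an unexplained mass of
`1 / (2 * accInv a)`; see `numItems`. -/
def tol (a l : ℕ) : ℕ :=
  131072 * accInv a ^ 3 * (l + numBlocks l + numCand a + numBuckets a + 8)

/-- The number of samples for each of the verifier's estimates. By the Hoeffding inequality, it
allows an accuracy of `1 / (128 * accInv a ^ 2)` with an error probability that survives a union
bound over all blocks, buckets and candidates. It does not depend on `n`. -/
def numItems (a l : ℕ) : ℕ := 2 * accInv a * tol a l

/-- The number of samples for each of the honest prover's estimates, for an accuracy of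
`1 / (32 * accInv a)` and a union bound over the `2 ^ (n + 1)` suffixes. -/
def numProver (n a l : ℕ) : ℕ := 16384 * accInv a ^ 2 * (n + l + 8)

@[fun_prop] theorem PT.accInv {F : α → ℕ} (hF : PT I O F) : PT I O (fun x => accInv (F x)) := by
  unfold FourierIP.accInv; fun_prop

@[fun_prop] theorem PT.numCand {F : α → ℕ} (hF : PT I O F) : PT I O (fun x => numCand (F x)) := by
  unfold FourierIP.numCand; fun_prop

@[fun_prop] theorem PT.numBuckets {F : α → ℕ} (hF : PT I O F) :
    PT I O (fun x => numBuckets (F x)) := by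
  unfold FourierIP.numBuckets; fun_prop

@[fun_prop] theorem PT.hashBits {F : α → ℕ} (hF : PT I O F) :
    PT I O (fun x => hashBits (F x)) := by
  unfold FourierIP.hashBits; fun_prop

@[fun_prop] theorem PT.numBlocks {F : α → ℕ} (hF : PT I O F) :
    PT I O (fun x => numBlocks (F x)) := by
  unfold FourierIP.numBlocks; fun_prop

@[fun_prop] theorem PT.tol {F G : α → ℕ} (hF : PT I O F) (hG : PT I O G) :
    PT I O (fun x => tol (F x) (G x)) := by
  unfold FourierIP.tol; fun_prop

@[fun_prop] theorem PT.numItems {F G : α → ℕ} (hF : PT I O F) (hG : PT I O G) :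
    PT I O (fun x => numItems (F x) (G x)) := by
  unfold FourierIP.numItems; fun_prop

@[fun_prop] theorem PT.numProver {F G H : α → ℕ} (hF : PT I O F) (hG : PT I O G)
    (hH : PT I O H) : PT I O (fun x => numProver (F x) (G x) (H x)) := by
  unfold FourierIP.numProver; fun_prop

section Irreducible

attribute [local irreducible] accInv numCand numBuckets hashBits numBlocks tol numItems parity

/-! ### The verifier's programs -/

/-- One item of the verifier's private data: an example, the bit that says whether its point is
sent unchanged in order to test the prover, and coefficients of the shift otherwise. -/
abbrev Item : Type := (Raw × Bool) × Bool × List Bool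

/-- A hash function (a list of vectors) and the items that are used with it. -/
abbrev Block : Type := List (List Bool) × List Item

/-- The item number `j`. -/
def getItem (m : ℕ) (B : List Block) (j : ℕ) : Item :=
  (B.getD (j / m) ([], [])).2.getD (j % m) ((⟨[]⟩, false), false, [])

/-- Coordinate `c` of the point that is sent for item `j`: the point of the example, shifted by a
combination of the vectors of the hash function if the item is not a test. -/
def pointBit (k m : ℕ) (B : List Block) (j c : ℕ) : Bool :=
  (getItem m B j).1.1.get c ^^ (!(getItem m B j).2.1 &&
    parity (fun r => (getItem m B j).2.2.getD r false &&
      (((B.getD (j / m) ([], [])).1.getD r []).getD c false)) k)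

/-- The verifier's message. -/
def challengeMsg (n k m L : ℕ) (B : List Block) : Raw :=
  ⟨(List.range (L * m * n)).map fun q => pointBit k m B (q / n) (q % n)⟩

@[fun_prop] theorem PT.getItem {m j : α → ℕ} {B : α → List Block} (hm : PT I O m) (hB : PT I O B)
    (hj : PT I O j) : PT I O (fun x => getItem (m x) (B x) (j x)) := by
  unfold FourierIP.getItem; fun_prop

@[fun_prop] theorem PT.pointBit {k m j c : α → ℕ} {B : α → List Block} (hk : PT I O k)
    (hm : PT I O m) (hB : PT I O B) (hj : PT I O j) (hc : PT I O c) :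
    PT I O (fun x => pointBit (k x) (m x) (B x) (j x) (c x)) := by
  unfold FourierIP.pointBit; fun_prop

@[fun_prop] theorem PT.challengeMsg {n k m L : α → ℕ} {B : α → List Block} (hn : PT I O n)
    (hk : PT I O k) (hm : PT I O m) (hL : PT I O L) (hB : PT I O B) :
    PT I O (fun x => challengeMsg (n x) (k x) (m x) (L x) (B x)) := by
  unfold FourierIP.challengeMsg; fun_prop

/-- The `i`-th vector of `n` bits in a message. -/
def rawVec (n : ℕ) (r : Raw) (i : ℕ) : List Bool := (List.range n).map fun c => r.get (i * n + c)

/-- The vector of the `n` lowest binary digits. -/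
def natVec (n : ℕ) (i : ℕ) : List Bool := (List.range n).map fun c => i.testBit c

/-- The inner product of two vectors of `n` bits. -/
def dotB (n : ℕ) (u v : List Bool) : Bool :=
  parity (fun c => u.getD c false && v.getD c false) n

/-- Equality of two vectors of `n` bits. -/
def eqB (n : ℕ) (u v : List Bool) : Bool :=
  (List.range n).all fun c => !(u.getD c false ^^ v.getD c false)

/-- The inner product of a vector with the point of an example. -/
def dotRaw (n : ℕ) (u : List Bool) (x : Raw) : Bool := parity (fun c => u.getD c false && x.get c) n

@[fun_prop] theorem PT.rawVec {n i : α → ℕ} {r : α → Raw} (hn : PT I O n) (hr : PT I O r)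
    (hi : PT I O i) : PT I O (fun x => rawVec (n x) (r x) (i x)) := by
  unfold FourierIP.rawVec; fun_prop

@[fun_prop] theorem PT.natVec {n i : α → ℕ} (hn : PT I O n) (hi : PT I O i) :
    PT I O (fun x => natVec (n x) (i x)) := by
  unfold FourierIP.natVec; fun_prop

@[fun_prop] theorem PT.dotB {n : α → ℕ} {u v : α → List Bool} (hn : PT I O n) (hu : PT I O u)
    (hv : PT I O v) : PT I O (fun x => dotB (n x) (u x) (v x)) := by
  unfold FourierIP.dotB; fun_prop

@[fun_prop] theorem PT.eqB {n : α → ℕ} {u v : α → List Bool} (hn : PT I O n) (hu : PT I O u)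
    (hv : PT I O v) : PT I O (fun x => eqB (n x) (u x) (v x)) := by
  unfold FourierIP.eqB; fun_prop

@[fun_prop] theorem PT.dotRaw {n : α → ℕ} {u : α → List Bool} {v : α → Raw} (hn : PT I O n)
    (hu : PT I O u) (hv : PT I O v) : PT I O (fun x => dotRaw (n x) (u x) (v x)) := by
  unfold FourierIP.dotRaw; fun_prop

/-- Two examples. -/
abbrev ExPair : Type := (Raw × Bool) × (Raw × Bool)

/-- The estimate of `N` times the square of the Fourier coefficient at `u`, from `N` pairs of
examples. -/
def estimate (n N : ℕ) (E : List ExPair) (u : List Bool) : ℕ :=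
  2 * (∑ j ∈ Finset.range N,
    if !((E.getD j ((⟨[]⟩, false), (⟨[]⟩, false))).1.2 ^^
      (E.getD j ((⟨[]⟩, false), (⟨[]⟩, false))).2.2 ^^
      dotRaw n u (E.getD j ((⟨[]⟩, false), (⟨[]⟩, false))).1.1 ^^
      dotRaw n u (E.getD j ((⟨[]⟩, false), (⟨[]⟩, false))).2.1) then 1 else 0) - N

@[fun_prop] theorem PT.estimate {n N : α → ℕ} {E : α → List ExPair} {u : α → List Bool}
    (hn : PT I O n) (hN : PT I O N) (hE : PT I O E) (hu : PT I O u) :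
    PT I O (fun x => estimate (n x) (N x) (E x) (u x)) := by
  unfold FourierIP.estimate; fun_prop

/-- Everything that the verifier knows at the end: the parameters, the prover's first message, the
private data, the prover's second message and fresh examples. -/
abbrev View : Type := ((Params × Raw × List Block) × Raw) × List ExPair

namespace View

/-- The dimension `n`. -/
def dim (w : View) : ℕ := w.1.1.1.1

/-- The parameter `t`. -/
def size (w : View) : ℕ := w.1.1.1.2.1

/-- The parameter `⌈1/ε⌉`. -/
def acc (w : View) : ℕ := w.1.1.1.2.2.1

/-- The parameter `⌈log₂(1/δ)⌉`. -/
def conf (w : View) : ℕ := w.1.1.1.2.2.2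

/-- The vectors that are eligible for the output: the prover's candidates, followed by `t` distinct
vectors that serve as padding. -/
def vec (w : View) (i : ℕ) : List Bool :=
  if decide (i < numCand w.acc) then rawVec w.dim w.1.1.2.1 i
  else natVec w.dim (i - numCand w.acc)

/-- The estimated squared coefficients of the eligible vectors; padding counts as `0`. -/
def weight (w : View) (i : ℕ) : ℕ :=
  if decide (i < numCand w.acc) then estimate w.dim (numItems w.acc w.conf) w.2 (w.vec i) else 0

/-- Whether `i` is the first occurrence of its vector. -/
def isFirst (w : View) (i : ℕ) : Bool := (List.range i).all fun j => !eqB w.dim (w.vec j) (w.vec i)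

/-- Whether `j` precedes `i` in the order by decreasing weight. -/
def beats (w : View) (j i : ℕ) : Bool :=
  decide (w.weight i < w.weight j) || (decide (w.weight i = w.weight j) && decide (j < i))

/-- The number of eligible vectors. -/
def num (w : View) : ℕ := numCand w.acc + w.size

/-- The number of vectors that precede number `i`. -/
def rank (w : View) (i : ℕ) : ℕ :=
  ∑ j ∈ Finset.range w.num, if w.isFirst j && w.beats j i then 1 else 0

/-- Whether vector number `i` is in the output. -/
def selected (w : View) (i : ℕ) : Bool := w.isFirst i && decide (w.rank i < w.size)

/-- The number of vectors in the output. -/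
def count (w : View) : ℕ := ∑ i ∈ Finset.range w.num, if w.selected i then 1 else 0

/-- The prover's answer for item `j`. -/
def answer (w : View) (j : ℕ) : Bool := w.1.2.get j

/-- The verifier's data for item `j`. -/
def item (w : View) (j : ℕ) : Item := getItem (numItems w.acc w.conf) w.1.1.2.2 j

/-- Whether the prover's answers are right at the points where the verifier knows `f`. -/
def testsOK (w : View) : Bool :=
  (List.range (numBlocks w.conf * numItems w.acc w.conf)).all fun j =>
    !((w.item j).2.1 && (w.answer j ^^ (w.item j).1.2))

/-- Whether the summand of item `j` in the estimate of the mass of bucket `b` is `-1`. -/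
def neg (w : View) (b j : ℕ) : Bool :=
  (w.item j).1.2 ^^ w.answer j ^^
    parity (fun r => (w.item j).2.2.getD r false && b.testBit r) (hashBits w.acc)

/-- The estimate (up to normalization) of the mass of bucket `b` for hash function `ℓ`. -/
def mass (w : View) (ℓ b : ℕ) : ℕ :=
  (∑ i ∈ Finset.range (numItems w.acc w.conf),
    if !(w.item (ℓ * numItems w.acc w.conf + i)).2.1 &&
      !w.neg b (ℓ * numItems w.acc w.conf + i) then 1 else 0) -
  ∑ i ∈ Finset.range (numItems w.acc w.conf),
    if !(w.item (ℓ * numItems w.acc w.conf + i)).2.1 &&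
      w.neg b (ℓ * numItems w.acc w.conf + i) then 1 else 0

/-- The vector number `r` of hash function `ℓ`. -/
def hashVec (w : View) (ℓ r : ℕ) : List Bool := (w.1.1.2.2.getD ℓ ([], [])).1.getD r []

/-- Whether the `i`-th eligible vector falls into bucket `b` of hash function `ℓ`. -/
def inBucket (w : View) (ℓ b i : ℕ) : Bool :=
  (List.range (hashBits w.acc)).all fun r =>
    !(dotB w.dim (w.vec i) (w.hashVec ℓ r) ^^ b.testBit r)

/-- The weight of the `i`-th eligible vector, if it falls into bucket `b`; repetitions of a vector
do not count. -/
def weightIn (w : View) (ℓ b i : ℕ) : ℕ :=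
  if w.isFirst i && w.inBucket ℓ b i then w.weight i else 0

/-- Whether no bucket of hash function `ℓ` has much more mass than the candidates explain. -/
def blockOK (w : View) (ℓ : ℕ) : Bool :=
  (List.range (numBuckets w.acc)).all fun b =>
    decide (2 * w.mass ℓ b ≤
      (∑ i ∈ Finset.range (numCand w.acc), w.weightIn ℓ b i) + tol w.acc w.conf)

/-- The verifier's decision. -/
def accepts (w : View) : Bool :=
  w.testsOK && ((List.range (numBlocks w.conf)).any w.blockOK && decide (w.count = w.size))

/-- The verifier's output. -/
def verdict (w : View) : Bool × List Raw :=
  (w.accepts, collect w.selected (fun i => ⟨w.vec i⟩) w.num)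

end View

section

variable {w : α → View} {i j b : α → ℕ}

@[fun_prop] theorem PT.dim (hw : PT I O w) : PT I O (fun x => (w x).dim) := by
  unfold View.dim; fun_prop

@[fun_prop] theorem PT.size (hw : PT I O w) : PT I O (fun x => (w x).size) := by
  unfold View.size; fun_prop

@[fun_prop] theorem PT.acc (hw : PT I O w) : PT I O (fun x => (w x).acc) := by
  unfold View.acc; fun_prop

@[fun_prop] theorem PT.conf (hw : PT I O w) : PT I O (fun x => (w x).conf) := by
  unfold View.conf; fun_prop

@[fun_prop] theorem PT.vec (hw : PT I O w) (hi : PT I O i) :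
    PT I O (fun x => (w x).vec (i x)) := by
  unfold View.vec; fun_prop

@[fun_prop] theorem PT.weight (hw : PT I O w) (hi : PT I O i) :
    PT I O (fun x => (w x).weight (i x)) := by
  unfold View.weight; fun_prop

@[fun_prop] theorem PT.isFirst (hw : PT I O w) (hi : PT I O i) :
    PT I O (fun x => (w x).isFirst (i x)) := by
  unfold View.isFirst; fun_prop

@[fun_prop] theorem PT.beats (hw : PT I O w) (hi : PT I O i) (hj : PT I O j) :
    PT I O (fun x => (w x).beats (j x) (i x)) := by
  unfold View.beats; fun_prop

@[fun_prop] theorem PT.num (hw : PT I O w) : PT I O (fun x => (w x).num) := by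
  unfold View.num; fun_prop

@[fun_prop] theorem PT.rank (hw : PT I O w) (hi : PT I O i) :
    PT I O (fun x => (w x).rank (i x)) := by
  unfold View.rank; fun_prop

@[fun_prop] theorem PT.selected (hw : PT I O w) (hi : PT I O i) :
    PT I O (fun x => (w x).selected (i x)) := by
  unfold View.selected; fun_prop

@[fun_prop] theorem PT.count (hw : PT I O w) : PT I O (fun x => (w x).count) := by
  unfold View.count; fun_prop

@[fun_prop] theorem PT.answer (hw : PT I O w) (hj : PT I O j) :
    PT I O (fun x => (w x).answer (j x)) := by
  unfold View.answer; fun_prop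

@[fun_prop] theorem PT.item (hw : PT I O w) (hj : PT I O j) :
    PT I O (fun x => (w x).item (j x)) := by
  unfold View.item; fun_prop

@[fun_prop] theorem PT.testsOK (hw : PT I O w) : PT I O (fun x => (w x).testsOK) := by
  unfold View.testsOK; fun_prop

@[fun_prop] theorem PT.neg (hw : PT I O w) (hb : PT I O b) (hj : PT I O j) :
    PT I O (fun x => (w x).neg (b x) (j x)) := by
  unfold View.neg; fun_prop

@[fun_prop] theorem PT.mass (hw : PT I O w) (hi : PT I O i) (hb : PT I O b) :
    PT I O (fun x => (w x).mass (i x) (b x)) := by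
  unfold View.mass; fun_prop

@[fun_prop] theorem PT.hashVec (hw : PT I O w) (hj : PT I O j) (hi : PT I O i) :
    PT I O (fun x => (w x).hashVec (j x) (i x)) := by
  unfold View.hashVec; fun_prop

@[fun_prop] theorem PT.inBucket (hw : PT I O w) (hj : PT I O j) (hb : PT I O b) (hi : PT I O i) :
    PT I O (fun x => (w x).inBucket (j x) (b x) (i x)) := by
  unfold View.inBucket; fun_prop

@[fun_prop] theorem PT.weightIn (hw : PT I O w) (hj : PT I O j) (hb : PT I O b) (hi : PT I O i) :
    PT I O (fun x => (w x).weightIn (j x) (b x) (i x)) := by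
  unfold View.weightIn; fun_prop

@[fun_prop] theorem PT.blockOK (hw : PT I O w) (hj : PT I O j) :
    PT I O (fun x => (w x).blockOK (j x)) := by
  unfold View.blockOK; fun_prop

@[fun_prop] theorem PT.accepts (hw : PT I O w) : PT I O (fun x => (w x).accepts) := by
  unfold View.accepts; fun_prop

@[fun_prop] theorem PT.verdict (hw : PT I O w) : PT I O (fun x => (w x).verdict) := by
  unfold View.verdict; fun_prop

end

end Irreducible

end FourierIP

namespace FourierIP

open Coded

section Irreducible

attribute [local irreducible] accInv numCand numBuckets hashBits numBlocks tol numItems parity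
  numProver

variable {I O : Ty} {α β γ σ : Type} [Coded α] [Coded β] [Coded γ] [Coded σ]

/-- `n` fair coins. -/
noncomputable def bitsD (n : ℕ) : PMF (List Bool) :=
  tabD (fun _ => PMF.uniformOfFintype Bool) n []

theorem Eff.bits {N : α → ℕ} (hN : PT I O N) :
    Eff I O (fun _ (x : α) => bitsD (N x)) (fun _ => 0) :=
  (Eff.tab (κ := fun _ => 0) hN (Eff.coin (α := α × ℕ)) fun _ _ _ => le_rfl).mono (by simp)

/-- A call of the example oracle. -/
noncomputable def exD (o : Unit → PMF (List Bool × Bool)) : PMF (Raw × Bool) :=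
  (o ()).map fun y => (Raw.mk y.1, y.2)

/-- Two independent samples. -/
noncomputable def pairD {β γ : Type} (p : PMF β) (q : PMF γ) : PMF (β × γ) :=
  p.bind fun y => q.bind fun z => PMF.pure (y, z)

/-- The distribution of an item. -/
noncomputable def itemD (o : Unit → PMF (List Bool × Bool)) (k : ℕ) : PMF Item :=
  pairD (exD o) (pairD (PMF.uniformOfFintype Bool) (bitsD k))

/-- The distribution of a block. -/
noncomputable def blockD (o : Unit → PMF (List Bool × Bool)) (n k m : ℕ) : PMF Block :=
  pairD (tabD (fun _ => bitsD n) k []) (tabD (fun _ => itemD o k) m [])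

/-- The distribution of the verifier's message and state. -/
noncomputable def challengeD (o : Unit → PMF (List Bool × Bool)) (x : Params × Raw) :
    PMF (Raw × (Params × Raw × List Block)) :=
  (tabD (fun _ => blockD o x.1.1 (hashBits x.1.2.2.1) (numItems x.1.2.2.1 x.1.2.2.2))
    (numBlocks x.1.2.2.2) []).bind fun B =>
      PMF.pure (challengeMsg x.1.1 (hashBits x.1.2.2.1) (numItems x.1.2.2.1 x.1.2.2.2)
        (numBlocks x.1.2.2.2) B, x.1, x.2, B)

theorem Eff.challenge : Eff .unit .example challengeD
    (fun x => numBlocks x.1.2.2.2 * numItems x.1.2.2.1 x.1.2.2.2) := by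
  have h1 : Eff (α := (((Params × Raw) × ℕ) × ℕ)) .unit .example
      (fun o x => itemD o (hashBits x.1.1.1.2.2.1)) (fun _ => 1) :=
    (Eff.pair Eff.example (Eff.pair Eff.coin (Eff.bits (by fun_prop)))).mono (by simp)
  have h2 : Eff (α := (((Params × Raw) × ℕ) × ℕ)) .unit .example
      (fun _ x => bitsD x.1.1.1.1) (fun _ => 0) := Eff.bits (by fun_prop)
  have h3 : Eff (α := (Params × Raw) × ℕ) .unit .example
      (fun o x => blockD o x.1.1.1 (hashBits x.1.1.2.2.1) (numItems x.1.1.2.2.1 x.1.1.2.2.2))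
      (fun x => numItems x.1.1.2.2.1 x.1.1.2.2.2) :=
    Eff.mono (Eff.pair (Eff.tab (α := (Params × Raw) × ℕ) (N := fun x => hashBits x.1.1.2.2.1)
      (κ := fun _ => 0) (by fun_prop) h2 fun _ _ _ => le_rfl)
      (Eff.tab (α := (Params × Raw) × ℕ) (N := fun x => numItems x.1.1.2.2.1 x.1.1.2.2.2)
        (κ := fun _ => 1) (by fun_prop) h1 fun _ _ _ => le_rfl)) fun x => by simp
  have h4 := Eff.tab (α := Params × Raw) (N := fun x => numBlocks x.1.2.2.2)
    (κ := fun x => numItems x.1.2.2.1 x.1.2.2.2) (by fun_prop) h3 fun _ _ _ => le_rfl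
  refine Eff.bind (E := fun _ (y : (Params × Raw) × List Block) =>
    PMF.pure (challengeMsg y.1.1.1 (hashBits y.1.1.2.2.1) (numItems y.1.1.2.2.1 y.1.1.2.2.2)
        (numBlocks y.1.1.2.2.2) y.2, y.1.1, y.1.2, y.2)) h4 (K' := fun _ => 0) ?_
        fun _ _ _ _ => le_rfl
  have : PT .unit .example (fun y : (Params × Raw) × List Block =>
    (challengeMsg y.1.1.1 (hashBits y.1.1.2.2.1) (numItems y.1.1.2.2.1 y.1.1.2.2.2)
        (numBlocks y.1.1.2.2.2) y.2, y.1.1, y.1.2, y.2)) := by fun_prop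
  exact this

/-- The distribution of the verifier's decision and output. -/
noncomputable def concludeD (o : Unit → PMF (List Bool × Bool))
    (x : (Params × Raw × List Block) × Raw) : PMF (Bool × List Raw) :=
  (tabD (fun _ => pairD (exD o) (exD o)) (numItems x.1.1.2.2.1 x.1.1.2.2.2) []).bind fun E =>
    PMF.pure (View.verdict (x, E))

theorem Eff.conclude : Eff .unit .example concludeD
    (fun x => 2 * numItems x.1.1.2.2.1 x.1.1.2.2.2) := by
  have h1 : Eff (α := (((Params × Raw × List Block) × Raw) × ℕ)) .unit .example
      (fun o _ => pairD (exD o) (exD o)) (fun _ => 2) :=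
    Eff.pair Eff.example Eff.example
  have h2 := Eff.tab (α := (Params × Raw × List Block) × Raw)
    (N := fun x => numItems x.1.1.2.2.1 x.1.1.2.2.2) (κ := fun _ => 2) (by fun_prop) h1
    fun _ _ _ => le_rfl
  have h3 : PT .unit .example (fun w : View => w.verdict) := by fun_prop
  exact (Eff.bind h2 h3 fun _ _ _ _ => le_rfl).mono fun x => by rw [mul_comm, Nat.add_zero]

/-! ### The honest prover's programs -/

/-- The points of the queries: `u` with its last `i` coordinates replaced by those of `v`, for each
pair `(u, v)` and each `i ≤ n`. -/
def queryPoint (n : ℕ) (U : List (List Bool × List Bool)) (q : ℕ) : Raw :=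
  ⟨(List.range n).map fun c => if decide (c + q % (n + 1) < n) then
    (U.getD (q / (n + 1)) ([], [])).1.getD c false
    else (U.getD (q / (n + 1)) ([], [])).2.getD c false⟩

/-- Whether the summand of sample `j` in the estimate of the mass of the vectors with the suffix `w`
of length `i` is `1`. -/
def agrees (n : ℕ) (U : List (List Bool × List Bool)) (ans : List Bool) (i : ℕ) (w : List Bool)
    (j : ℕ) : Bool :=
  !(ans.getD (j * (n + 1)) false ^^ ans.getD (j * (n + 1) + i) false ^^
    parity (fun r => w.getD r false && ((U.getD j ([], [])).1.getD (n - i + r) false ^^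
      (U.getD j ([], [])).2.getD (n - i + r) false)) i)

/-- Whether the estimated mass of the vectors with suffix `w` is large. -/
def isHeavy (n a N : ℕ) (U : List (List Bool × List Bool)) (ans : List Bool) (i : ℕ)
    (w : List Bool) : Bool :=
  decide (3 * N ≤ 32 * accInv a *
    (2 * (∑ j ∈ Finset.range N, if agrees n U ans i w j then 1 else 0) - N))

/-- The two extensions of each of the suffixes in the list `W`. -/
def extension (W : List (List Bool)) (j : ℕ) : List Bool :=
  decide (j % 2 = 1) :: W.getD (j / 2) []

/-- One level of the search: the heavy extensions of the suffixes in the list `W`. -/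
def extend (n a N : ℕ) (U : List (List Bool × List Bool)) (ans : List Bool) (i : ℕ)
    (W : List (List Bool)) : List (List Bool) :=
  collect (fun j => decide (j / 2 < W.length) && isHeavy n a N U ans (i + 1) (extension W j))
    (extension W) (2 * numCand a)

/-- The heavy suffixes of length `i`. -/
def heavy (n a N : ℕ) (U : List (List Bool × List Bool)) (ans : List Bool) (i : ℕ) :
    List (List Bool) := Nat.rec [[]] (extend n a N U ans) i

@[fun_prop] theorem PT.queryPoint {n q : α → ℕ} {U : α → List (List Bool × List Bool)}
    (hn : PT I O n) (hU : PT I O U) (hq : PT I O q) :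
    PT I O (fun x => queryPoint (n x) (U x) (q x)) := by
  unfold FourierIP.queryPoint; fun_prop

@[fun_prop] theorem PT.agrees {n i j : α → ℕ} {U : α → List (List Bool × List Bool)}
    {ans w : α → List Bool} (hn : PT I O n) (hU : PT I O U) (hans : PT I O ans) (hi : PT I O i)
    (hw : PT I O w) (hj : PT I O j) :
    PT I O (fun x => agrees (n x) (U x) (ans x) (i x) (w x) (j x)) := by
  unfold FourierIP.agrees; fun_prop

@[fun_prop] theorem PT.isHeavy {n a N i : α → ℕ} {U : α → List (List Bool × List Bool)}
    {ans w : α → List Bool} (hn : PT I O n) (ha : PT I O a) (hN : PT I O N) (hU : PT I O U)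
    (hans : PT I O ans) (hi : PT I O i) (hw : PT I O w) :
    PT I O (fun x => isHeavy (n x) (a x) (N x) (U x) (ans x) (i x) (w x)) := by
  unfold FourierIP.isHeavy; fun_prop

@[fun_prop] theorem PT.extension {W : α → List (List Bool)} {j : α → ℕ} (hW : PT I O W)
    (hj : PT I O j) : PT I O (fun x => extension (W x) (j x)) := by
  unfold FourierIP.extension; fun_prop

@[fun_prop] theorem PT.extend {n a N i : α → ℕ} {U : α → List (List Bool × List Bool)}
    {ans : α → List Bool} {W : α → List (List Bool)} (hn : PT I O n) (ha : PT I O a)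
    (hN : PT I O N) (hU : PT I O U) (hans : PT I O ans) (hi : PT I O i) (hW : PT I O W) :
    PT I O (fun x => extend (n x) (a x) (N x) (U x) (ans x) (i x) (W x)) := by
  unfold FourierIP.extend; fun_prop

theorem mem_collect {β : Type} {p : ℕ → Bool} {v : ℕ → β} {N : ℕ} {y : β} :
    y ∈ collect p v N ↔ ∃ i < N, p i ∧ v i = y := by
  induction N with
  | zero => simp [collect]
  | succ N ih =>
    rw [collect]
    constructor
    · intro h
      by_cases hp : p N
      · rw [if_pos hp, List.mem_cons] at h
        rcases h with h | h
        · exact ⟨N, by omega, hp, h.symm⟩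
        · obtain ⟨i, hi, h⟩ := ih.1 h
          exact ⟨i, by omega, h⟩
      · rw [if_neg hp] at h
        obtain ⟨i, hi, h⟩ := ih.1 h
        exact ⟨i, by omega, h⟩
    · rintro ⟨i, hi, hp, rfl⟩
      rcases Nat.lt_succ_iff_lt_or_eq.1 hi with hi | rfl
      · have := ih.2 ⟨i, hi, hp, rfl⟩
        split
        · exact List.mem_cons_of_mem _ this
        · exact this
      · rw [if_pos hp]
        exact List.mem_cons_self

theorem length_collect_le {β : Type} (p : ℕ → Bool) (v : ℕ → β) (N : ℕ) :
    (collect p v N).length ≤ N := by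
  induction N with
  | zero => simp [collect]
  | succ N ih =>
    rw [collect]
    split
    · simpa using ih
    · omega

theorem length_of_mem_heavy {n a N : ℕ} {U : List (List Bool × List Bool)} {ans : List Bool}
    {i : ℕ} {w : List Bool} (hw : w ∈ heavy n a N U ans i) : w.length = i := by
  induction i generalizing w with
  | zero => simpa [heavy] using hw
  | succ i ih =>
    obtain ⟨j, hj, hp, rfl⟩ := mem_collect.1 (show w ∈ extend n a N U ans i (heavy n a N U ans i)
      from hw)
    simp only [Bool.and_eq_true, decide_eq_true_eq] at hp
    rw [extension, List.length_cons, List.getD_eq_getElem _ _ hp.1,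
      ih (List.getElem_mem hp.1)]

theorem length_heavy_le (n a N : ℕ) (U : List (List Bool × List Bool)) (ans : List Bool) (i : ℕ) :
    (heavy n a N U ans i).length ≤ 2 * numCand a + 1 := by
  cases i with
  | zero => simp [heavy]
  | succ i => exact (length_collect_le _ _ _).trans (Nat.le_succ _)

theorem bits_sz (l : List Bool) : sz l = l.length := by
  induction l with
  | nil => rfl
  | cons b l ih => rw [cons_sz, ih, List.length_cons]; change 0 + 1 + _ = _; omega

theorem list_sz_le (l : List β) (M : ℕ) (h : ∀ x ∈ l, sz x ≤ M) : sz l ≤ l.length * (M + 1) := by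
  induction l with
  | nil => simp
  | cons y l ih =>
    have := ih fun x hx => h x (List.mem_cons_of_mem _ hx)
    have := h y List.mem_cons_self
    rw [cons_sz, List.length_cons, Nat.succ_mul]
    omega

@[fun_prop] theorem PT.heavy {n a N i : α → ℕ} {U : α → List (List Bool × List Bool)}
    {ans : α → List Bool} (hn : PT I O n) (ha : PT I O a)
    (hN : PT I O N) (hU : PT I O U) (hans : PT I O ans) (hi : PT I O i) :
    PT I O (fun x => heavy (n x) (a x) (N x) (U x) (ans x) (i x)) := by
  have h1 : PT I O (fun x => (2 * FourierIP.numCand (a x) + 1) * (i x + 1)) := by fun_prop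
  refine PT.natRec (init := fun _ => [[]])
    (step := fun x => FourierIP.extend (n x) (a x) (N x) (U x) (ans x)) hi
    (PT.const _) (by fun_prop) h1.sz_le fun x j hj => ?_
  refine (list_sz_le (FourierIP.heavy (n x) (a x) (N x) (U x) (ans x) j) (i x)
    fun w hw => ?_).trans (Nat.mul_le_mul_right _ (length_heavy_le _ _ _ _ _ _))
  rw [bits_sz, length_of_mem_heavy hw]
  exact hj

/-- The prover's first message: the heavy vectors. -/
def firstMsg (p : Params) (U : List (List Bool × List Bool)) (ans : List Bool) : Raw :=
  ⟨(List.range (numCand p.2.2.1 * p.1)).map fun q =>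
    ((heavy p.1 p.2.2.1 (numProver p.1 p.2.2.1 p.2.2.2) U ans p.1).getD (q / p.1) []).getD
      (q % p.1) false⟩

@[fun_prop] theorem PT.firstMsg {p : α → Params} {U : α → List (List Bool × List Bool)}
    {ans : α → List Bool} (hp : PT I O p) (hU : PT I O U) (hans : PT I O ans) :
    PT I O (fun x => firstMsg (p x) (U x) (ans x)) := by
  unfold FourierIP.firstMsg; fun_prop

/-- The distribution of the prover's first message. -/
noncomputable def proverFirstD (o : List Bool → PMF Bool) (p : Params) : PMF (Raw × Params) :=
  (tabD (fun _ => pairD (bitsD p.1) (bitsD p.1)) (numProver p.1 p.2.2.1 p.2.2.2) []).bind fun U =>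
    (tabD (fun q => o (queryPoint p.1 U q).bits)
      (numProver p.1 p.2.2.1 p.2.2.2 * (p.1 + 1)) []).bind fun ans =>
        PMF.pure (firstMsg p U ans, p)

theorem Eff.proverFirst : ∃ K, Eff .bits .bool proverFirstD K := by
  have h1 : Eff (α := Params × ℕ) .bits .bool (fun _ x => pairD (bitsD x.1.1) (bitsD x.1.1))
      (fun _ => 0) := Eff.pair (Eff.bits (by fun_prop)) (Eff.bits (by fun_prop))
  have h2 := Eff.tab (N := fun p : Params => numProver p.1 p.2.2.1 p.2.2.2) (κ := fun _ => 0)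
    (by fun_prop) h1 fun _ _ _ => le_rfl
  have h3 := Eff.query.comp_pt
    (F := fun x : (Params × List (List Bool × List Bool)) × ℕ => queryPoint x.1.1.1 x.1.2 x.2)
    (by fun_prop)
  have h4 := Eff.tab (N := fun x : Params × List (List Bool × List Bool) =>
    numProver x.1.1 x.1.2.2.1 x.1.2.2.2 * (x.1.1 + 1)) (κ := fun _ => 1)
    (by fun_prop) h3 fun _ _ _ => le_rfl
  have h5 : PT .bits .bool (fun y : (Params × List (List Bool × List Bool)) × List Bool =>
    (firstMsg y.1.1 y.1.2 y.2, y.1.1)) := by fun_prop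
  have h6 := Eff.bind (J := fun x => numProver x.1.1 x.1.2.2.1 x.1.2.2.2 * (x.1.1 + 1)) h4 h5
    (by simp)
  exact ⟨_, Eff.bind (J := fun p => numProver p.1 p.2.2.1 p.2.2.2 * (p.1 + 1)) h2 h6 (by simp)⟩

/-- The distribution of the prover's second message. -/
noncomputable def proverSecondD (o : List Bool → PMF Bool) (x : Params × Raw) : PMF Raw :=
  (tabD (fun q => o (Raw.mk (rawVec x.1.1 x.2 q)).bits)
    (numBlocks x.1.2.2.2 * numItems x.1.2.2.1 x.1.2.2.2) []).bind fun ans => PMF.pure (Raw.mk ans)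

theorem Eff.proverSecond : ∃ K, Eff .bits .bool proverSecondD K := by
  have h1 := Eff.query.comp_pt
    (F := fun x : (Params × Raw) × ℕ => Raw.mk (rawVec x.1.1.1 x.1.2 x.2)) (by fun_prop)
  have h2 := Eff.tab (N := fun x : Params × Raw =>
    numBlocks x.1.2.2.2 * numItems x.1.2.2.1 x.1.2.2.2) (κ := fun _ => 1) (by fun_prop) h1
    fun _ _ _ => le_rfl
  have h3 : PT .bits .bool (fun ans : List Bool => Raw.mk ans) := by fun_prop
  exact ⟨_, Eff.comp (J := fun x => numBlocks x.1.2.2.2 * numItems x.1.2.2.1 x.1.2.2.2) h3 h2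
    (by simp)⟩

end Irreducible

end FourierIP

namespace FourierIP

open scoped ENNReal

/-! ### Relative frequencies -/

section Freq

open Classical in
/-- The probability of an event under the uniform distribution. -/
noncomputable def freq {Ω : Type*} [Fintype Ω] (E : Ω → Prop) : ℝ :=
  (Finset.univ.filter E).card / Fintype.card Ω

variable {Ω Ω' : Type*} [Fintype Ω] [Fintype Ω']

theorem freq_eq (E : Ω → Prop) [DecidablePred E] :
    freq E = (Finset.univ.filter E).card / Fintype.card Ω := by
  unfold freq
  congr!

theorem freq_nonneg (E : Ω → Prop) : 0 ≤ freq E := by unfold freq; positivity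

theorem freq_mono {E E' : Ω → Prop} (h : ∀ w, E w → E' w) : freq E ≤ freq E' := by
  classical
  unfold freq
  gcongr
  exact fun hw => h _ hw

theorem freq_or_le (E E' : Ω → Prop) : freq (fun w => E w ∨ E' w) ≤ freq E + freq E' := by
  classical
  rw [freq_eq, freq_eq, freq_eq, ← add_div]
  gcongr
  rw [Finset.filter_or]
  exact_mod_cast Finset.card_union_le _ _

theorem freq_exists_le {ι : Type*} (s : Finset ι) (E : ι → Ω → Prop) :
    freq (fun w => ∃ i ∈ s, E i w) ≤ ∑ i ∈ s, freq (E i) := by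
  classical
  induction s using Finset.induction_on with
  | empty => simp [freq]
  | insert i s hi ih =>
    rw [Finset.sum_insert hi]
    refine le_trans (freq_mono fun w hw => ?_) ((freq_or_le (E i) (fun w => ∃ i ∈ s, E i w)).trans
      (by gcongr))
    simpa using hw

theorem freq_exists_le_of_le {ι : Type*} (s : Finset ι) (E : ι → Ω → Prop) (c : ℝ)
    (h : ∀ i ∈ s, freq (E i) ≤ c) : freq (fun w => ∃ i ∈ s, E i w) ≤ s.card * c :=
  (freq_exists_le s E).trans ((Finset.sum_le_card_nsmul s _ c h).trans (by simp))

theorem freq_equiv (e : Ω ≃ Ω') (E : Ω' → Prop) : freq (fun w => E (e w)) = freq E := by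
  classical
  unfold freq
  rw [Fintype.card_congr e]
  congr 2
  exact Finset.card_bij (fun w _ => e w) (by simp) (by simp)
    (fun b hb => ⟨e.symm b, by simpa using hb, by simp⟩)

theorem freq_prod_le {E : Ω × Ω' → Prop} {c : ℝ} (hc : 0 ≤ c)
    (h : ∀ a, freq (fun b => E (a, b)) ≤ c) : freq E ≤ c := by
  classical
  rcases isEmpty_or_nonempty Ω' with h0 | h0
  · simp [freq, hc]
  rcases isEmpty_or_nonempty Ω with h1 | h1
  · simp [freq, hc]
  have hΩ' : (0 : ℝ) < Fintype.card Ω' := by exact_mod_cast Fintype.card_pos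
  have hΩ : (0 : ℝ) < Fintype.card Ω := by exact_mod_cast Fintype.card_pos
  have h2 : ∀ a, ((Finset.univ.filter fun b => E (a, b)).card : ℝ) ≤ c * Fintype.card Ω' :=
    fun a => (div_le_iff₀ hΩ').1 (h a)
  have h3 : (Finset.univ.filter E).card =
      ∑ a, (Finset.univ.filter fun b => E (a, b)).card := by
    simp only [Finset.card_filter]
    rw [Fintype.sum_prod_type]
  unfold freq
  rw [div_le_iff₀ (by rw [Fintype.card_prod]; push_cast; positivity), h3]
  push_cast
  refine (Finset.sum_le_sum fun a _ => h2 a).trans ?_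
  rw [Finset.sum_const, Fintype.card_prod, nsmul_eq_mul, Finset.card_univ]
  push_cast
  exact le_of_eq (by ring)

theorem freq_snd_le (E : Ω' → Prop) : freq (fun w : Ω × Ω' => E w.2) ≤ freq E :=
  freq_prod_le (freq_nonneg _) fun _ => le_rfl

theorem freq_fst_le (E : Ω → Prop) : freq (fun w : Ω × Ω' => E w.1) ≤ freq E :=
  (freq_equiv (Equiv.prodComm Ω' Ω) fun w : Ω × Ω' => E w.1).symm.trans_le (freq_snd_le E)

theorem freq_eval_le {ι : Type*} [Fintype ι] [DecidableEq ι] (i : ι) (E : Ω → Prop) :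
    freq (fun w : ι → Ω => E (w i)) ≤ freq E :=
  (freq_equiv (Equiv.funSplitAt i Ω) fun w => E w.1).trans_le (freq_fst_le E)

/-- Independent events in distinct coordinates. -/
theorem freq_forall_mem {ι : Type*} [Fintype ι] [DecidableEq ι] [Nonempty Ω] (B : Finset ι)
    (E : Ω → Prop) : freq (fun w : ι → Ω => ∀ i ∈ B, E (w i)) = freq E ^ B.card := by
  classical
  have h1 : (Finset.univ.filter fun w : ι → Ω => ∀ i ∈ B, E (w i)) =
      Fintype.piFinset fun i => if i ∈ B then Finset.univ.filter E else Finset.univ := by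
    ext w
    simp only [Finset.mem_filter, Finset.mem_univ, true_and, Fintype.mem_piFinset]
    refine forall_congr' fun i => ?_
    split_ifs with h <;> simp [h]
  have hΩ : (0 : ℝ) < Fintype.card Ω := by exact_mod_cast Fintype.card_pos
  rw [freq_eq, freq_eq, h1, Fintype.card_piFinset]
  have h2 : ∀ i : ι, (if i ∈ B then Finset.univ.filter E else Finset.univ : Finset Ω).card =
      if i ∈ B then (Finset.univ.filter E).card else Fintype.card Ω := by
    intro i
    split_ifs <;> simp
  simp only [h2]
  rw [Finset.prod_ite, Finset.prod_const, Finset.prod_const, Fintype.card_fun, div_pow]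
  have h3 : (Finset.univ.filter fun i => i ∈ B) = B := by ext; simp
  have h4 : (Finset.univ.filter fun i => i ∉ B).card + B.card = Fintype.card ι := by
    have := Finset.card_filter_add_card_filter_not (s := Finset.univ) (fun i => i ∈ B)
    rw [h3] at this
    rw [← Finset.card_univ (α := ι)]
    omega
  rw [h3, ← h4, pow_add]
  push_cast
  field_simp

theorem sum_exp_le (Y : Ω → ℝ) (c : ℝ) (hY : ∀ w, |Y w| ≤ 1) (hc : ∀ w, Y w ^ 2 ≤ c)
    (hμ : ∑ w, Y w = 0) : (∑ w, Real.exp (Y w)) ≤ Fintype.card Ω * Real.exp c := by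
  have h1 : ∀ w, Real.exp (Y w) ≤ 1 + Y w + c := by
    intro w
    have h2 := (abs_le.1 (Real.abs_exp_sub_one_sub_id_le (hY w))).2
    have h3 := hc w
    linarith
  refine (Finset.sum_le_sum fun w _ => h1 w).trans ?_
  simp only [Finset.sum_add_distrib, hμ, Finset.sum_const, nsmul_eq_mul, Finset.card_univ]
  have h2 := Real.add_one_le_exp c
  have h3 : (0 : ℝ) ≤ Fintype.card Ω := by positivity
  nlinarith

theorem exp_neg_le_half_pow (r : ℕ) : Real.exp (-(r : ℝ)) ≤ (1 / 2) ^ r := by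
  have h1 : Real.exp (-(r : ℝ)) = Real.exp (-1) ^ r := by
    rw [← Real.exp_nat_mul]
    congr 1
    ring
  rw [h1]
  refine pow_le_pow_left₀ (Real.exp_pos _).le ?_ r
  rw [Real.exp_neg, one_div]
  refine inv_anti₀ (by norm_num) ?_
  have := Real.add_one_le_exp (1 : ℝ)
  linarith

/-- A one-sided Hoeffding inequality for independent variables with values in `[-1, 1]`. -/
theorem freq_sum_ge [Nonempty Ω] (M : ℕ) (Y : Ω → ℝ) (μ τ : ℝ) (r : ℕ) (hY : ∀ w, |Y w| ≤ 1)
    (hμ : ∑ w, Y w = Fintype.card Ω * μ) (hτ : 0 ≤ τ) (hτ1 : τ ≤ 1) (hr : 16 * r ≤ M * τ ^ 2) :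
    freq (fun w : Fin M → Ω => M * (μ + τ) ≤ ∑ j, Y (w j)) ≤ (1 / 2) ^ r := by
  classical
  have hΩ : (0 : ℝ) < Fintype.card Ω := by exact_mod_cast Fintype.card_pos
  have hμ1 : |μ| ≤ 1 := by
    have h1 : |∑ w, Y w| ≤ Fintype.card Ω * 1 := by
      refine (Finset.abs_sum_le_sum_abs _ _).trans ((Finset.sum_le_sum fun w _ => hY w).trans ?_)
      simp
    rw [hμ, abs_mul, abs_of_pos hΩ] at h1
    exact le_of_mul_le_mul_left h1 hΩ
  have hd : ∀ w, |Y w - μ| ≤ 2 := fun w => (abs_sub _ _).trans (by linarith [hY w])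
  have hX := sum_exp_le (fun w => τ / 8 * (Y w - μ)) (τ ^ 2 / 16)
    (fun w => by
      rw [abs_mul, abs_of_nonneg (by positivity)]
      nlinarith [hd w, abs_nonneg (Y w - μ)])
    (fun w => by
      have h1 : (Y w - μ) ^ 2 ≤ 4 := by
        rw [← sq_abs]
        nlinarith [hd w, abs_nonneg (Y w - μ)]
      calc (τ / 8 * (Y w - μ)) ^ 2 = τ ^ 2 / 64 * (Y w - μ) ^ 2 := by ring
        _ ≤ τ ^ 2 / 64 * 4 := by gcongr
        _ = _ := by ring)
    (by
      rw [← Finset.mul_sum, Finset.sum_sub_distrib, hμ]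
      simp)
  have h1 : ((Finset.univ.filter fun w : Fin M → Ω => M * (μ + τ) ≤ ∑ j, Y (w j)).card : ℝ) *
      Real.exp (M * (τ ^ 2 / 8)) ≤ (Fintype.card Ω * Real.exp (τ ^ 2 / 16)) ^ M := by
    calc _ = ∑ w ∈ Finset.univ.filter (fun w : Fin M → Ω => M * (μ + τ) ≤ ∑ j, Y (w j)),
          Real.exp (M * (τ ^ 2 / 8)) := by rw [Finset.sum_const, nsmul_eq_mul]
      _ ≤ ∑ w ∈ Finset.univ.filter (fun w : Fin M → Ω => M * (μ + τ) ≤ ∑ j, Y (w j)),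
          ∏ j, Real.exp (τ / 8 * (Y (w j) - μ)) := by
        refine Finset.sum_le_sum fun w hw => ?_
        rw [← Real.exp_sum]
        refine Real.exp_le_exp.2 ?_
        have h2 := (Finset.mem_filter.1 hw).2
        rw [← Finset.mul_sum, Finset.sum_sub_distrib]
        simp only [Finset.sum_const, Finset.card_univ, Fintype.card_fin, nsmul_eq_mul]
        nlinarith
      _ ≤ ∑ w : Fin M → Ω, ∏ j, Real.exp (τ / 8 * (Y (w j) - μ)) :=
        Finset.sum_le_sum_of_subset_of_nonneg (Finset.subset_univ _)
          fun _ _ _ => Finset.prod_nonneg fun _ _ => (Real.exp_pos _).le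
      _ = (∑ w, Real.exp (τ / 8 * (Y w - μ))) ^ M := by
        rw [Fintype.sum_pow]
      _ ≤ _ := by
        gcongr
  rw [freq_eq, Fintype.card_fun, Fintype.card_fin]
  push_cast
  rw [div_le_iff₀ (by positivity)]
  rw [mul_pow, ← Real.exp_nat_mul] at h1
  have h2 : ((Finset.univ.filter fun w : Fin M → Ω => M * (μ + τ) ≤ ∑ j, Y (w j)).card : ℝ) ≤
      (Fintype.card Ω : ℝ) ^ M * Real.exp (M * (τ ^ 2 / 16) - M * (τ ^ 2 / 8)) := by
    rw [Real.exp_sub, ← mul_div_assoc, le_div_iff₀ (Real.exp_pos _)]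
    exact h1
  refine h2.trans ?_
  rw [mul_comm]
  refine mul_le_mul_of_nonneg_right (le_trans (Real.exp_le_exp.2 ?_) (exp_neg_le_half_pow r))
    (by positivity)
  linarith

/-- A two-sided Hoeffding inequality for independent variables with values in `[-1, 1]`. -/
theorem freq_abs_sum_ge [Nonempty Ω] (M : ℕ) (Y : Ω → ℝ) (μ τ : ℝ) (r : ℕ) (hY : ∀ w, |Y w| ≤ 1)
    (hμ : ∑ w, Y w = Fintype.card Ω * μ) (hτ : 0 ≤ τ) (hτ1 : τ ≤ 1) (hr : 16 * r ≤ M * τ ^ 2) :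
    freq (fun w : Fin M → Ω => M * τ ≤ |∑ j, Y (w j) - M * μ|) ≤ 2 * (1 / 2) ^ r := by
  have h1 := freq_sum_ge M Y μ τ r hY hμ hτ hτ1 hr
  have h2 := freq_sum_ge M (fun w => - Y w) (-μ) τ r (fun w => by simpa using hY w)
    (by simp [hμ]) hτ hτ1 hr
  refine (freq_mono fun w hw => ?_).trans ((freq_or_le _ _).trans
    ((add_le_add h1 h2).trans (by linarith)))
  rcases le_abs.1 hw with h | h
  · left; linarith
  · right
    rw [Finset.sum_neg_distrib]
    linarith

end Freq

/-! ### Probabilities of events -/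

section Prob

variable {α β γ : Type*}

/-- The probability of an event, as an extended nonnegative real. -/
noncomputable def pr (p : PMF α) (E : α → Prop) : ℝ≥0∞ := p.toOuterMeasure {w | E w}

theorem pr_mono (p : PMF α) {E E' : α → Prop} (h : ∀ w ∈ p.support, E w → E' w) :
    pr p E ≤ pr p E' := p.toOuterMeasure_mono fun w hw => h w hw.2 hw.1

theorem pr_or_le (p : PMF α) (E E' : α → Prop) : pr p (fun w => E w ∨ E' w) ≤ pr p E + pr p E' :=
  MeasureTheory.measure_union_le (μ := p.toOuterMeasure) {w | E w} {w | E' w}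

theorem pr_map (p : PMF α) (g : α → β) (E : β → Prop) :
    pr (p.map g) E = pr p fun w => E (g w) := PMF.toOuterMeasure_map_apply g p _

theorem pr_bind_le (p : PMF α) (g : α → PMF β) (E : β → Prop) (c : ℝ≥0∞)
    (h : ∀ a ∈ p.support, pr (g a) E ≤ c) : pr (p.bind g) E ≤ c := by
  unfold pr at *
  rw [PMF.toOuterMeasure_bind_apply]
  calc ∑' a, p a * (g a).toOuterMeasure {w | E w} ≤ ∑' a, p a * c := by
        refine ENNReal.tsum_le_tsum fun a => ?_
        by_cases ha : a ∈ p.support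
        · exact mul_le_mul_right (h a ha) _
        · rw [PMF.mem_support_iff, not_not] at ha
          simp [ha]
    _ = c := by rw [ENNReal.tsum_mul_right, p.tsum_coe, one_mul]

theorem pr_le_one (p : PMF α) (E : α → Prop) : pr p E ≤ 1 := by
  unfold pr
  rw [PMF.toOuterMeasure_apply, ← p.tsum_coe]
  exact ENNReal.tsum_le_tsum fun a => Set.indicator_le_self _ _ _

theorem one_le_pr_add (p : PMF α) (E : α → Prop) : 1 ≤ pr p E + pr p fun w => ¬ E w := by
  have h1 : pr p (fun _ => True) = 1 := by
    unfold pr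
    rw [PMF.toOuterMeasure_apply_eq_one_iff]
    exact fun _ _ => trivial
  rw [← h1]
  exact (pr_mono p fun w _ _ => em (E w)).trans (pr_or_le p _ _)

theorem prob_eq {α : Type} (p : PMF α) (E : α → Prop) : prob p E = (pr p E).toReal := rfl

theorem prob_le_of_pr_le {α : Type} (p : PMF α) (E : α → Prop) {c : ℝ} (hc : 0 ≤ c)
    (h : pr p E ≤ ENNReal.ofReal c) : prob p E ≤ c := by
  rw [prob_eq]
  exact ENNReal.toReal_le_of_le_ofReal hc h

theorem pr_uniform {Ω : Type*} [Fintype Ω] [Nonempty Ω] (E : Ω → Prop) :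
    pr (PMF.uniformOfFintype Ω) E = ENNReal.ofReal (freq E) := by
  classical
  unfold pr
  rw [PMF.toOuterMeasure_uniformOfFintype_apply, freq_eq,
    ENNReal.ofReal_div_of_pos (by exact_mod_cast Fintype.card_pos), ENNReal.ofReal_natCast,
    ENNReal.ofReal_natCast]
  congr 2
  exact Fintype.card_subtype E

theorem uniform_map_equiv {Ω Ω' : Type*} [Fintype Ω] [Nonempty Ω] [Fintype Ω'] [Nonempty Ω']
    (e : Ω ≃ Ω') : (PMF.uniformOfFintype Ω).map e = PMF.uniformOfFintype Ω' := by
  ext y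
  rw [PMF.map_apply, tsum_eq_single (e.symm y)]
  · simp [Fintype.card_congr e]
  · intro x hx
    rw [if_neg]
    rintro rfl
    simp at hx

theorem uniform_prod {Ω Ω' : Type*} [Fintype Ω] [Nonempty Ω] [Fintype Ω'] [Nonempty Ω'] :
    ((PMF.uniformOfFintype Ω).bind fun x => (PMF.uniformOfFintype Ω').bind fun y =>
      PMF.pure (x, y)) = PMF.uniformOfFintype (Ω × Ω') := by
  ext ⟨a, b⟩
  rw [PMF.bind_apply, tsum_eq_single a]
  · rw [PMF.bind_apply, tsum_eq_single b]
    · simp [PMF.pure_apply, ENNReal.mul_inv]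
    · intro b' hb'
      simp [PMF.pure_apply, Ne.symm hb']
  · intro a' ha'
    simp [PMF.pure_apply, Ne.symm ha']

theorem pairD_uniform {Ω Ω' β γ : Type} [Fintype Ω] [Nonempty Ω] [Fintype Ω'] [Nonempty Ω']
    (e : Ω → β) (g : Ω' → γ) :
    pairD ((PMF.uniformOfFintype Ω).map e) ((PMF.uniformOfFintype Ω').map g) =
      (PMF.uniformOfFintype (Ω × Ω')).map fun w => (e w.1, g w.2) := by
  rw [← uniform_prod]
  simp only [pairD, PMF.bind_map, PMF.map_bind, PMF.pure_map, Function.comp_def]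

theorem tabD_uniform {Ω β : Type} [Fintype Ω] [Nonempty Ω] (e : Ω → β) (N : ℕ) (acc : List β) :
    tabD (fun _ => (PMF.uniformOfFintype Ω).map e) N acc =
      (PMF.uniformOfFintype (Fin N → Ω)).map fun w => List.ofFn (fun i => e (w i)) ++ acc := by
  induction N generalizing acc with
  | zero =>
    rw [tabD, ← PMF.bind_pure_comp]
    simp only [List.ofFn_zero, List.nil_append, Function.comp_def, PMF.bind_const]
  | succ N ih =>
    rw [tabD]
    simp only [ih, PMF.bind_map]
    have h1 := uniform_map_equiv (Fin.snocEquiv fun _ : Fin (N + 1) => Ω)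
    rw [← h1, ← uniform_prod]
    simp only [PMF.map_bind, PMF.pure_map, Function.comp_def]
    congr 1
    funext y
    rw [← PMF.bind_pure_comp]
    congr 1
    funext w
    simp only [Function.comp_def, List.ofFn_succ_last, List.append_assoc, List.singleton_append]
    simp [Fin.snocEquiv]

end Prob

/-! ### The distributions of the private data -/

section Data

open Classical in
theorem bitsD_eq (n : ℕ) : bitsD n = (PMF.uniformOfFintype (Vec n)).map encodeVec := by
  let e : ZMod 2 ≃ Bool :=
    { toFun := fun x => decide (x = 1)
      invFun := fun b => if b then 1 else 0
      left_inv := by decide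
      right_inv := by decide }
  have h := tabD_uniform (e : ZMod 2 → Bool) n []
  rw [uniform_map_equiv] at h
  rw [bitsD, h]
  congr 1
  funext w
  simp [encodeVec, e]

variable {n : ℕ} (f : Vec n → ℤˣ)

/-- An example in the representation that the verifier uses. -/
def encEx (x : Vec n) : Raw × Bool := (⟨encodeVec x⟩, encodeLabel (f x))

theorem exD_eq : exD (exampleOracle f) = (PMF.uniformOfFintype (Vec n)).map (encEx f) := by
  rw [exD, exampleOracle, PMF.map_comp]
  rfl

/-- The outcomes of the verifier's random choices in one item: the point of the example, the test
bit, and the coefficients of the shift. -/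
abbrev ItemΩ (n k : ℕ) : Type := Vec n × Bool × Vec k

/-- The outcomes of the verifier's random choices in one block. -/
abbrev BlockΩ (n k m : ℕ) : Type := (Fin k → Vec n) × (Fin m → ItemΩ n k)

/-- The data of an item. -/
def encItem {k : ℕ} (w : ItemΩ n k) : Item := (encEx f w.1, w.2.1, encodeVec w.2.2)

/-- The data of a block. -/
def encBlock {k m : ℕ} (w : BlockΩ n k m) : Block :=
  (List.ofFn fun r => encodeVec (w.1 r), List.ofFn fun i => encItem f (w.2 i))

theorem itemD_eq (k : ℕ) :
    itemD (exampleOracle f) k = (PMF.uniformOfFintype (ItemΩ n k)).map (encItem f) := by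
  have h := pairD_uniform (id : Bool → Bool) (encodeVec (n := k))
  rw [PMF.map_id] at h
  rw [itemD, bitsD_eq, exD_eq, h, pairD_uniform]
  rfl

theorem blockD_eq (k m : ℕ) :
    blockD (exampleOracle f) n k m = (PMF.uniformOfFintype (BlockΩ n k m)).map (encBlock f) := by
  rw [blockD, bitsD_eq, itemD_eq, tabD_uniform, tabD_uniform, pairD_uniform]
  simp only [List.append_nil]
  rfl

theorem blocksD_eq (k m L : ℕ) :
    tabD (fun _ => blockD (exampleOracle f) n k m) L [] =
      (PMF.uniformOfFintype (Fin L → BlockΩ n k m)).map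
        fun w => List.ofFn fun i => encBlock f (w i) := by
  rw [blockD_eq, tabD_uniform]
  simp only [List.append_nil]

theorem exPairsD_eq (N : ℕ) :
    tabD (fun _ => pairD (exD (exampleOracle f)) (exD (exampleOracle f))) N [] =
      (PMF.uniformOfFintype (Fin N → Vec n × Vec n)).map
        fun w => List.ofFn fun i => (encEx f (w i).1, encEx f (w i).2) := by
  rw [exD_eq, pairD_uniform, tabD_uniform]
  simp only [List.append_nil]

theorem vecPairsD_eq (N : ℕ) :
    tabD (fun _ => pairD (bitsD n) (bitsD n)) N [] =
      (PMF.uniformOfFintype (Fin N → Vec n × Vec n)).map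
        fun w => List.ofFn fun i => (encodeVec (w i).1, encodeVec (w i).2) := by
  rw [bitsD_eq, pairD_uniform, tabD_uniform]
  simp only [List.append_nil]

end Data

end FourierIP

namespace FourierIP

/-! ### Fourier analysis -/

section Fourier

variable {n k : ℕ}

/-- The sign `-1` of `1`, and `1` of `0`. -/
noncomputable def sgn (x : ZMod 2) : ℝ := (-1) ^ x.val

theorem sgn_add (x y : ZMod 2) : sgn (x + y) = sgn x * sgn y := by
  revert x y
  have : ∀ x y : ZMod 2, (x + y).val % 2 = (x.val + y.val) % 2 := by decide
  intro x y
  rw [sgn, sgn, sgn, ← pow_add, neg_one_pow_eq_pow_mod_two, this, ← neg_one_pow_eq_pow_mod_two]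

theorem sgn_zero : sgn 0 = 1 := by simp [sgn]

theorem sgn_one : sgn 1 = -1 := by
  have : (1 : ZMod 2).val = 1 := rfl
  simp [sgn, this]

theorem abs_sgn (x : ZMod 2) : |sgn x| = 1 := by
  rw [sgn, abs_pow]
  simp

theorem chi_eq_sgn (γ x : Vec n) : chi γ x = sgn (γ ⬝ᵥ x) := rfl

theorem chi_comm (γ x : Vec n) : chi γ x = chi x γ := by
  rw [chi_eq_sgn, chi_eq_sgn, dotProduct_comm]

theorem chi_add_right (γ x y : Vec n) : chi γ (x + y) = chi γ x * chi γ y := by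
  simp only [chi_eq_sgn, dotProduct_add, sgn_add]

theorem chi_add_left (γ γ' x : Vec n) : chi (γ + γ') x = chi γ x * chi γ' x := by
  simp only [chi_eq_sgn, add_dotProduct, sgn_add]

theorem abs_chi (γ x : Vec n) : |chi γ x| = 1 := abs_sgn _

theorem vec_add_eq_zero {v w : Vec n} : v + w = 0 ↔ v = w := by
  simp only [funext_iff, Pi.add_apply, Pi.zero_apply, CharTwo.add_eq_zero]

theorem vec_add_self (v : Vec n) : v + v = 0 := vec_add_eq_zero.2 rfl

theorem card_vec : Fintype.card (Vec n) = 2 ^ n := by simp [ZMod.card]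

theorem sum_chi (γ : Vec n) : ∑ x, chi γ x = if γ = 0 then (2 : ℝ) ^ n else 0 := by
  split_ifs with h
  · subst h
    simp [chi_eq_sgn, sgn_zero, ZMod.card]
  · obtain ⟨i, hi⟩ := Function.ne_iff.1 h
    have hi : γ i = 1 := by
      have : ∀ a : ZMod 2, a ≠ 0 → a = 1 := by decide
      exact this _ hi
    have h1 : ∑ x, chi γ (x + Pi.single i 1) = ∑ x, chi γ x :=
      Fintype.sum_equiv (Equiv.addRight (Pi.single i 1)) _ _ fun x => rfl
    have h2 : chi γ (Pi.single i 1) = -1 := by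
      rw [chi_eq_sgn, dotProduct_single, hi, mul_one, sgn_one]
    simp only [chi_add_right, h2, ← Finset.sum_mul] at h1
    linarith

variable (f : Vec n → ℤˣ)

/-- The values of `f` as real numbers. -/
def val (x : Vec n) : ℝ := ((f x : ℤ) : ℝ)

theorem abs_val (x : Vec n) : |val f x| = 1 := by
  rcases Int.units_eq_one_or (f x) with h | h <;> simp [val, h]

theorem val_mul_self (x : Vec n) : val f x * val f x = 1 := by
  rcases Int.units_eq_one_or (f x) with h | h <;> simp [val, h]

/-- The squared Fourier coefficients. -/
noncomputable def fsq (γ : Vec n) : ℝ := fourierCoefficient f γ ^ 2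

theorem fsq_nonneg (γ : Vec n) : 0 ≤ fsq f γ := sq_nonneg _

/-- A squared coefficient as the expectation over two independent examples. -/
theorem sum_pair_chi (γ : Vec n) :
    ∑ w : Vec n × Vec n, val f w.1 * val f w.2 * (chi γ w.1 * chi γ w.2) =
      Fintype.card (Vec n × Vec n) * fsq f γ := by
  have h1 : fourierCoefficient f γ = (∑ x, val f x * chi γ x) / 2 ^ n := rfl
  rw [fsq, h1, Fintype.card_prod, card_vec, div_pow, pow_two (∑ x, _), Finset.sum_mul_sum,
    Fintype.sum_prod_type]
  push_cast
  field_simp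
  exact Finset.sum_congr rfl fun x _ => Finset.sum_congr rfl fun y _ => by ring

/-- The autocorrelation of `f` in terms of its Fourier coefficients. -/
theorem sum_val_mul_val_add (h : Vec n) :
    ∑ x, val f x * val f (x + h) = 2 ^ n * ∑ γ, fsq f γ * chi γ h := by
  have h1 : ∀ γ, fsq f γ * (Fintype.card (Vec n × Vec n) : ℝ) =
      ∑ w : Vec n × Vec n, val f w.1 * val f w.2 * (chi γ w.1 * chi γ w.2) := fun γ => by
    rw [sum_pair_chi, mul_comm]
  have h2 : (Fintype.card (Vec n × Vec n) : ℝ) * ∑ γ, fsq f γ * chi γ h =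
      2 ^ n * ∑ x, val f x * val f (x + h) := by
    calc _ = ∑ γ, ∑ w : Vec n × Vec n,
          val f w.1 * val f w.2 * (chi γ w.1 * chi γ w.2) * chi γ h := by
          rw [Finset.mul_sum]
          refine Finset.sum_congr rfl fun γ _ => ?_
          rw [← Finset.sum_mul, ← h1]
          ring
      _ = ∑ w : Vec n × Vec n, val f w.1 * val f w.2 * ∑ γ, chi (w.1 + w.2 + h) γ := by
          rw [Finset.sum_comm]
          refine Finset.sum_congr rfl fun w _ => ?_
          rw [Finset.mul_sum]
          refine Finset.sum_congr rfl fun γ _ => ?_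
          rw [chi_comm (w.1 + w.2 + h), chi_add_right, chi_add_right]
          ring
      _ = ∑ x, val f x * val f (x + h) * 2 ^ n := by
          rw [Fintype.sum_prod_type]
          refine Finset.sum_congr rfl fun x _ => ?_
          rw [Finset.sum_eq_single (x + h)]
          · rw [sum_chi, if_pos]
            rw [add_right_comm]
            exact vec_add_self _
          · intro y _ hy
            rw [sum_chi, if_neg, mul_zero]
            intro h0
            apply hy
            have h3 : x + y + h = (x + h) + y := by ring
            rw [h3, vec_add_eq_zero] at h0
            exact h0.symm
          · simp
      _ = _ := by rw [← Finset.sum_mul, mul_comm]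
  rw [Fintype.card_prod, card_vec] at h2
  push_cast at h2
  have h3 : (2 : ℝ) ^ n ≠ 0 := by positivity
  rw [mul_assoc] at h2
  exact (mul_left_cancel₀ h3 h2).symm

/-- Parseval's identity. -/
theorem sum_fsq : ∑ γ, fsq f γ = 1 := by
  have h := sum_val_mul_val_add f 0
  simp only [add_zero, val_mul_self, chi_comm _ (0 : Vec n)] at h
  simp only [chi_eq_sgn, zero_dotProduct, sgn_zero, mul_one, Finset.sum_const, Finset.card_univ,
    card_vec, nsmul_eq_mul] at h
  push_cast at h
  have h3 : (2 : ℝ) ^ n ≠ 0 := by positivity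
  exact (mul_left_cancel₀ h3 (by linarith)).symm

/-- The combination of the vectors of `Z` with coefficients `c`. -/
def shift (Z : Fin k → Vec n) (c : Vec k) : Vec n := ∑ r, c r • Z r

/-- The hash value of `γ`. -/
def hash (Z : Fin k → Vec n) (γ : Vec n) : Vec k := fun r => γ ⬝ᵥ Z r

theorem chi_shift (Z : Fin k → Vec n) (γ : Vec n) (c : Vec k) :
    chi γ (shift Z c) = chi (hash Z γ) c := by
  have : γ ⬝ᵥ shift Z c = hash Z γ ⬝ᵥ c := by
    rw [shift, dotProduct_sum]
    refine Finset.sum_congr rfl fun r _ => ?_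
    rw [dotProduct_smul, smul_eq_mul, mul_comm]
    rfl
  rw [chi_eq_sgn, this]
  rfl

theorem hash_add (Z : Fin k → Vec n) (γ γ' : Vec n) : hash Z (γ + γ') = hash Z γ + hash Z γ' := by
  funext r
  simp [hash, add_dotProduct]

open Classical in
/-- The sum of the squared Fourier coefficients in a bucket. -/
noncomputable def bucketMass (Z : Fin k → Vec n) (b : Vec k) : ℝ :=
  ∑ γ, if hash Z γ = b then fsq f γ else 0

/-- The mass of a bucket as a correlation. -/
theorem sum_corr (Z : Fin k → Vec n) (b : Vec k) :
    ∑ x, ∑ c, val f x * val f (x + shift Z c) * chi b c = 2 ^ n * 2 ^ k * bucketMass f Z b := by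
  rw [Finset.sum_comm]
  calc _ = ∑ c, (∑ x, val f x * val f (x + shift Z c)) * chi b c := by
        simp only [Finset.sum_mul]
    _ = ∑ c, ∑ γ, 2 ^ n * (fsq f γ * chi (hash Z γ + b) c) := by
        refine Finset.sum_congr rfl fun c _ => ?_
        rw [sum_val_mul_val_add, Finset.mul_sum, Finset.sum_mul]
        refine Finset.sum_congr rfl fun γ _ => ?_
        rw [chi_shift, chi_add_left]
        ring
    _ = ∑ γ, 2 ^ n * 2 ^ k * (if hash Z γ = b then fsq f γ else 0) := by
        rw [Finset.sum_comm]
        refine Finset.sum_congr rfl fun γ _ => ?_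
        rw [← Finset.mul_sum, ← Finset.mul_sum, sum_chi]
        simp only [vec_add_eq_zero]
        split_ifs <;> ring
    _ = _ := by rw [bucketMass, Finset.mul_sum]

/-- A uniform vector is orthogonal to a nonzero vector with probability `1/2`. -/
theorem freq_dotProduct_eq_zero {v : Vec n} (hv : v ≠ 0) :
    freq (fun z : Vec n => v ⬝ᵥ z = 0) = 1 / 2 := by
  classical
  have h1 : ∑ x, chi v x = 0 := by rw [sum_chi, if_neg hv]
  have h2 : ∀ x, chi v x = 2 * (if v ⬝ᵥ x = 0 then (1 : ℝ) else 0) - 1 := by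
    intro x
    have : ∀ a : ZMod 2, a = 0 ∨ a = 1 := by decide
    rcases this (v ⬝ᵥ x) with h | h
    · rw [chi_eq_sgn, h, sgn_zero]; norm_num
    · rw [chi_eq_sgn, h, sgn_one]; norm_num
  simp only [h2, Finset.sum_sub_distrib, ← Finset.mul_sum, Finset.sum_boole, Finset.sum_const,
    nsmul_eq_mul, mul_one, Finset.card_univ] at h1
  rw [freq_eq]
  have h3 : (0 : ℝ) < Fintype.card (Vec n) := by exact_mod_cast Fintype.card_pos
  rw [div_eq_div_iff h3.ne' (by norm_num)]
  linarith

/-- Two distinct vectors collide with probability `2 ^ (-k)`. -/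
theorem freq_hash_eq {γ γ' : Vec n} (h : γ ≠ γ') :
    freq (fun Z : Fin k → Vec n => hash Z γ = hash Z γ') = (1 / 2) ^ k := by
  have hne : γ + γ' ≠ 0 := fun h0 => h (vec_add_eq_zero.1 h0)
  have h1 := freq_forall_mem (Finset.univ : Finset (Fin k)) fun z : Vec n => (γ + γ') ⬝ᵥ z = 0
  rw [freq_dotProduct_eq_zero hne, Finset.card_univ, Fintype.card_fin] at h1
  rw [← h1]
  congr 1
  funext Z
  rw [← vec_add_eq_zero, ← hash_add]
  simp [hash, funext_iff]

open Classical in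
/-- The mass of the pairs of distinct vectors that collide. -/
noncomputable def collisions (Z : Fin k → Vec n) : ℝ :=
  ∑ γ, ∑ γ', if γ ≠ γ' ∧ hash Z γ = hash Z γ' then fsq f γ * fsq f γ' else 0

/-- Markov's inequality for the mass of the colliding pairs, whose expectation is at most
`2 ^ (-k)`. -/
theorem freq_collisions (f : Vec n → ℤˣ) :
    freq (fun Z : Fin k → Vec n => 2 * (1 / 2) ^ k ≤ collisions f Z) ≤ 1 / 2 := by
  classical
  have hpos : (0 : ℝ) < Fintype.card (Fin k → Vec n) := by exact_mod_cast Fintype.card_pos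
  have h1 : ∑ Z : Fin k → Vec n, collisions f Z ≤
      Fintype.card (Fin k → Vec n) * (1 / 2) ^ k := by
    calc _ = ∑ γ, ∑ γ', ∑ Z : Fin k → Vec n,
          if γ ≠ γ' ∧ hash Z γ = hash Z γ' then fsq f γ * fsq f γ' else 0 := by
          simp only [collisions]
          rw [Finset.sum_comm]
          refine Finset.sum_congr rfl fun γ _ => Finset.sum_comm
      _ ≤ ∑ γ, ∑ γ', (Fintype.card (Fin k → Vec n) * (1 / 2) ^ k) * (fsq f γ * fsq f γ') := by
          refine Finset.sum_le_sum fun γ _ => Finset.sum_le_sum fun γ' _ => ?_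
          have h0 := mul_nonneg (fsq_nonneg f γ) (fsq_nonneg f γ')
          by_cases h : γ = γ'
          · simp only [h, ne_eq, not_true_eq_false, false_and, if_false, Finset.sum_const_zero]
            have := mul_nonneg (fsq_nonneg f γ') (fsq_nonneg f γ')
            positivity
          · have h2 := freq_hash_eq (k := k) h
            rw [freq_eq, div_eq_iff hpos.ne'] at h2
            simp only [ne_eq, h, not_false_eq_true, true_and]
            rw [← Finset.sum_filter, Finset.sum_const, nsmul_eq_mul, h2]
            exact le_of_eq (by ring)
      _ = _ := by
          simp only [← Finset.mul_sum, sum_fsq, mul_one]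
  rw [freq_eq, div_le_iff₀ hpos]
  have h3 : ((Finset.univ.filter fun Z : Fin k → Vec n => 2 * (1 / 2) ^ k ≤ collisions f Z).card :
      ℝ) * (2 * (1 / 2) ^ k) ≤ ∑ Z : Fin k → Vec n, collisions f Z := by
    rw [← nsmul_eq_mul]
    refine (Finset.card_nsmul_le_sum _ _ _ fun Z hZ => (Finset.mem_filter.1 hZ).2).trans ?_
    refine Finset.sum_le_sum_of_subset_of_nonneg (Finset.subset_univ _) fun Z _ _ => ?_
    refine Finset.sum_nonneg fun γ _ => Finset.sum_nonneg fun γ' _ => ?_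
    split_ifs
    · exact mul_nonneg (fsq_nonneg f γ) (fsq_nonneg f γ')
    · exact le_rfl
  have h4 : (0 : ℝ) < (1 / 2) ^ k := by positivity
  have h5 := h3.trans h1
  have h6 : (((Finset.univ.filter fun Z : Fin k → Vec n =>
      2 * (1 / 2) ^ k ≤ collisions f Z).card : ℝ) * 2) * (1 / 2) ^ k ≤
        Fintype.card (Fin k → Vec n) * (1 / 2) ^ k := by linarith
  have := le_of_mul_le_mul_right h6 h4
  linarith

open Classical in
/-- If few vectors collide, then the small coefficients in a bucket have little mass. -/
theorem residual_le {Z : Fin k → Vec n} {S : Vec n → Prop} {τ σ : ℝ} (b : Vec k)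
    (hS : ∀ γ, ¬ S γ → fsq f γ ≤ τ) (hτ : 0 ≤ τ) (hσ : 0 ≤ σ)
    (hZ : collisions f Z < σ ^ 2) :
    (∑ γ, if hash Z γ = b ∧ ¬ S γ then fsq f γ else 0) ≤ τ + σ := by
  set R := ∑ γ, if hash Z γ = b ∧ ¬ S γ then fsq f γ else 0 with hR
  have h0 : 0 ≤ R := Finset.sum_nonneg fun γ _ => by split_ifs <;> simp [fsq_nonneg]
  have h1 : R * R ≤ τ * R + collisions f Z := by
    rw [hR, Finset.sum_mul_sum, Finset.mul_sum, collisions, ← Finset.sum_add_distrib]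
    refine Finset.sum_le_sum fun γ _ => ?_
    have h2 : τ * (if hash Z γ = b ∧ ¬ S γ then fsq f γ else 0) =
        ∑ γ', if γ' = γ then τ * (if hash Z γ = b ∧ ¬ S γ then fsq f γ else 0) else 0 := by simp
    rw [h2, ← Finset.sum_add_distrib]
    refine Finset.sum_le_sum fun γ' _ => ?_
    have h3 := fsq_nonneg f γ
    have h4 := fsq_nonneg f γ'
    by_cases hγ : hash Z γ = b ∧ ¬ S γ
    · by_cases hγ' : hash Z γ' = b ∧ ¬ S γ'
      · simp only [hγ, hγ', not_false_eq_true, and_self, if_true]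
        by_cases h : γ' = γ
        · subst h
          simp only [ne_eq, not_true_eq_false, false_and, if_true, if_false, add_zero]
          exact mul_le_mul_of_nonneg_right (hS _ hγ.2) h3
        · simp [h, Ne.symm h]
      · rw [if_neg hγ', mul_zero]
        have := mul_nonneg h3 h4
        split_ifs <;> positivity
    · rw [if_neg hγ, zero_mul]
      have := mul_nonneg h3 h4
      split_ifs <;> simp [this]
  by_contra! h
  nlinarith

end Fourier

end FourierIP

namespace FourierIP

/-! ### From bits to vectors -/

section Bits

/-- A bit as an element of the field with two elements. -/
def bz (b : Bool) : ZMod 2 := if b then 1 else 0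

theorem bz_inj {a b : Bool} : bz a = bz b ↔ a = b := by revert a b; decide

theorem bz_xor (a b : Bool) : bz (a ^^ b) = bz a + bz b := by revert a b; decide

theorem bz_and (a b : Bool) : bz (a && b) = bz a * bz b := by revert a b; decide

theorem bz_decide (x : ZMod 2) : bz (decide (x = 1)) = x := by revert x; decide

theorem bz_parity (g : ℕ → Bool) (N : ℕ) : bz (parity g N) = ∑ i : Fin N, bz (g i) := by
  rw [← Finset.sum_range fun i => bz (g i)]
  have h1 : ∀ i, bz (g i) = ((if g i then 1 else 0 : ℕ) : ZMod 2) := fun i => by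
    cases g i <;> rfl
  simp only [h1, ← Nat.cast_sum, parity]
  generalize (∑ i ∈ Finset.range N, if g i then 1 else 0) = s
  rcases Nat.mod_two_eq_zero_or_one s with h | h
  · rw [h]
    exact ((ZMod.natCast_eq_zero_iff s 2).2 (Nat.dvd_of_mod_eq_zero h)).symm
  · rw [h]
    change (1 : ZMod 2) = _
    have := (ZMod.natCast_eq_natCast_iff s 1 2).2 h
    rw [this, Nat.cast_one]

variable {n : ℕ}

theorem decodeVec_apply (l : List Bool) (i : Fin n) : decodeVec n l i = bz (l.getD i false) := rfl

theorem bz_encodeVec (x : Vec n) (i : Fin n) : bz ((encodeVec x).getD i false) = x i := by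
  rw [encodeVec, List.getD_eq_getElem _ _ (by simp), List.getElem_ofFn, bz_decide]

theorem decode_encode (x : Vec n) : decodeVec n (encodeVec x) = x := by
  funext i
  rw [decodeVec_apply, bz_encodeVec]

theorem bz_dotB (u v : List Bool) : bz (dotB n u v) = decodeVec n u ⬝ᵥ decodeVec n v := by
  rw [dotB, bz_parity]
  exact Finset.sum_congr rfl fun i _ => bz_and _ _

theorem bz_dotRaw (u : List Bool) (x : Vec n) :
    bz (dotRaw n u ⟨encodeVec x⟩) = decodeVec n u ⬝ᵥ x := by
  rw [dotRaw, bz_parity]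
  refine Finset.sum_congr rfl fun i _ => ?_
  rw [bz_and, Raw.get, bz_encodeVec]
  rfl

theorem eqB_iff (u v : List Bool) : eqB n u v = true ↔ decodeVec n u = decodeVec n v := by
  have h : ∀ a b : Bool, (!(a ^^ b)) = true ↔ a = b := by decide
  rw [eqB, List.all_eq_true, funext_iff]
  simp only [List.mem_range, h, decodeVec_apply, bz_inj]
  exact ⟨fun h i => h i i.2, fun h i hi => h ⟨i, hi⟩⟩

theorem sgn_label (f : Vec n → ℤˣ) (x : Vec n) : sgn (bz (encodeLabel (f x))) = val f x := by
  rcases Int.units_eq_one_or (f x) with h | h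
  · have : encodeLabel (1 : ℤˣ) = false := by decide
    rw [h, this, val, h]
    simp [bz, sgn_zero]
  · have : encodeLabel (-1 : ℤˣ) = true := by decide
    rw [h, this, val, h]
    simp [bz, sgn_one]

theorem mapRange_getD {β : Type} (g : ℕ → β) (N i : ℕ) (d : β) (h : i < N) :
    ((List.range N).map g).getD i d = g i := by
  rw [List.getD_eq_getElem _ _ (by simpa using h)]
  simp

theorem ofFn_getD {β : Type} {N : ℕ} (g : Fin N → β) (i : Fin N) (d : β) :
    (List.ofFn g).getD i d = g i := by
  rw [List.getD_eq_getElem _ _ (by simp), List.getElem_ofFn]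

/-- A truncated difference of two counts is the positive part of a sum of signs. -/
theorem cast_count_sub (N : ℕ) (u b : ℕ → Bool) :
    (((∑ i ∈ Finset.range N, if u i && !b i then 1 else 0) -
      ∑ i ∈ Finset.range N, if u i && b i then 1 else 0 : ℕ) : ℝ) =
        max (∑ i : Fin N, if u i then sgn (bz (b i)) else 0) 0 := by
  have h1 : (∑ i : Fin N, if u i then sgn (bz (b i)) else 0) =
      ((∑ i ∈ Finset.range N, if u i && !b i then 1 else 0 : ℕ) : ℝ) -
        ((∑ i ∈ Finset.range N, if u i && b i then 1 else 0 : ℕ) : ℝ) := by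
    rw [← Finset.sum_range fun i => if u i then sgn (bz (b i)) else 0]
    push_cast
    rw [← Finset.sum_sub_distrib]
    refine Finset.sum_congr rfl fun i _ => ?_
    cases u i <;> cases b i <;> simp [bz, sgn_zero, sgn_one]
  rw [h1]
  generalize (∑ i ∈ Finset.range N, if u i && !b i then 1 else 0 : ℕ) = p
  generalize (∑ i ∈ Finset.range N, if u i && b i then 1 else 0 : ℕ) = q
  rcases le_total q p with h | h
  · rw [Nat.cast_sub h, max_eq_left]
    have : (q : ℝ) ≤ p := by exact_mod_cast h
    linarith
  · rw [Nat.sub_eq_zero_of_le h, Nat.cast_zero, max_eq_right]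
    have : (p : ℝ) ≤ q := by exact_mod_cast h
    linarith

theorem cast_two_mul_sub (N : ℕ) (b : ℕ → Bool) :
    ((2 * (∑ i ∈ Finset.range N, if !b i then 1 else 0) - N : ℕ) : ℝ) =
      max (∑ i : Fin N, sgn (bz (b i))) 0 := by
  have h := cast_count_sub N (fun _ => true) b
  simp only [Bool.true_and, if_true] at h
  rw [← h]
  congr 1
  have h2 : (∑ i ∈ Finset.range N, if !b i then 1 else 0) +
      (∑ i ∈ Finset.range N, if b i then 1 else 0) = N := by
    rw [← Finset.sum_add_distrib]
    rw [Finset.sum_congr rfl (g := fun _ => 1) fun i _ => by cases b i <;> rfl]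
    simp
  omega

end Bits

/-! ### The verifier's view -/

section Views

variable {n k m L : ℕ} (f : Vec n → ℤˣ)

/-- The list of blocks of the verifier's random choices. -/
def encBlocks (ω : Fin L → BlockΩ n k m) : List Block := List.ofFn fun i => encBlock f (ω i)

/-- The points that the verifier sends. -/
def sentPoint (ω : Fin L → BlockΩ n k m) (j : Fin L × Fin m) : Vec n :=
  ((ω j.1).2 j.2).1 +
    if ((ω j.1).2 j.2).2.1 then 0 else shift (ω j.1).1 ((ω j.1).2 j.2).2.2

theorem index_lt {ℓ i : ℕ} (hℓ : ℓ < L) (hi : i < m) : ℓ * m + i < L * m :=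
  calc ℓ * m + i < ℓ * m + m := by omega
    _ = (ℓ + 1) * m := by ring
    _ ≤ L * m := Nat.mul_le_mul_right _ hℓ

theorem index_div {ℓ i : ℕ} (hi : i < m) : (ℓ * m + i) / m = ℓ := by
  rw [mul_comm, Nat.mul_add_div (by omega), Nat.div_eq_of_lt hi, add_zero]

theorem index_mod {ℓ i : ℕ} (hi : i < m) : (ℓ * m + i) % m = i := by
  rw [mul_comm, Nat.mul_add_mod, Nat.mod_eq_of_lt hi]

theorem getItem_encBlocks (ω : Fin L → BlockΩ n k m) (j : Fin L × Fin m) :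
    getItem m (encBlocks f ω) (j.1 * m + j.2) = encItem f ((ω j.1).2 j.2) := by
  rw [getItem, index_div j.2.2, index_mod j.2.2, encBlocks, ofFn_getD, encBlock, ofFn_getD]

theorem bz_pointBit (ω : Fin L → BlockΩ n k m) (j : Fin L × Fin m) (c : Fin n) :
    bz (pointBit k m (encBlocks f ω) (j.1 * m + j.2) c) = sentPoint ω j c := by
  rw [pointBit, getItem_encBlocks, index_div j.2.2, encBlocks, ofFn_getD, bz_xor, bz_and, bz_parity,
    sentPoint, Pi.add_apply]
  congr 1
  · exact bz_encodeVec _ _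
  · change bz (!((ω j.1).2 j.2).2.1) * _ = _
    cases ((ω j.1).2 j.2).2.1
    · simp only [Bool.not_false, Bool.false_eq_true, if_false]
      rw [show bz true = 1 from rfl, one_mul, shift, Finset.sum_apply]
      refine Finset.sum_congr rfl fun r _ => ?_
      rw [bz_and, Pi.smul_apply, smul_eq_mul]
      congr 1
      · exact bz_encodeVec _ _
      · rw [encBlock, ofFn_getD, bz_encodeVec]
    · simp [bz]

/-- The verifier's message determines the points. -/
theorem decode_challengeMsg (ω : Fin L → BlockΩ n k m) (j : Fin L × Fin m) :
    decodeVec n (rawVec n (challengeMsg n k m L (encBlocks f ω)) (j.1 * m + j.2)) =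
      sentPoint ω j := by
  funext c
  rw [decodeVec_apply, rawVec, mapRange_getD _ _ _ _ c.2, ← bz_pointBit f, challengeMsg, Raw.get,
    mapRange_getD _ _ _ _ (index_lt (index_lt j.1.2 j.2.2) c.2), index_div c.2, index_mod c.2]

/-- The verifier's message depends only on the points. -/
theorem challengeMsg_eq (ω ω' : Fin L → BlockΩ n k m) (h : sentPoint ω = sentPoint ω') :
    challengeMsg n k m L (encBlocks f ω) = challengeMsg n k m L (encBlocks f ω') := by
  rw [challengeMsg, challengeMsg]
  congr 1
  refine List.map_congr_left fun q hq => ?_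
  have hq : q < L * m * n := List.mem_range.1 hq
  have hn : 0 < n := Nat.pos_of_ne_zero (by rintro rfl; simp at hq)
  have h1 : q / n < L * m := Nat.div_lt_of_lt_mul (by rwa [mul_comm])
  have hm : 0 < m := Nat.pos_of_ne_zero (by rintro rfl; simp at hq)
  have h2 : q / n / m < L := Nat.div_lt_of_lt_mul (by rwa [mul_comm])
  have h3 := fun ω => bz_pointBit (k := k) f ω (⟨q / n / m, h2⟩, ⟨q / n % m, Nat.mod_lt _ hm⟩)
    ⟨q % n, Nat.mod_lt _ hn⟩
  simp only [Nat.div_add_mod'] at h3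
  rw [← bz_inj, h3, h3, h]

/-- The estimates are the positive parts of sums of independent signs. -/
theorem cast_estimate (N : ℕ) (ex : Fin N → Vec n × Vec n) (u : List Bool) :
    (estimate n N (List.ofFn fun i => (encEx f (ex i).1, encEx f (ex i).2)) u : ℝ) =
      max (∑ j, val f (ex j).1 * val f (ex j).2 *
        (chi (decodeVec n u) (ex j).1 * chi (decodeVec n u) (ex j).2)) 0 := by
  rw [estimate, cast_two_mul_sub]
  congr 1
  refine Finset.sum_congr rfl fun j _ => ?_
  rw [ofFn_getD]
  simp only [encEx, bz_xor, sgn_add, sgn_label, bz_dotRaw, chi_eq_sgn]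
  ring

end Views

end FourierIP

namespace FourierIP

/-! ### The selection of the output -/

namespace View

variable (w : View)

/-- The eligible vectors. -/
def v (i : ℕ) : Vec w.dim := decodeVec w.dim (w.vec i)

/-- The vectors in the output. -/
def out : Finset (Vec w.dim) := ((w.verdict.2.map Raw.bits).map (decodeVec w.dim)).toFinset

variable {w}

theorem isFirst_iff {i : ℕ} : w.isFirst i = true ↔ ∀ j < i, w.v j ≠ w.v i := by
  rw [isFirst, List.all_eq_true]
  simp only [List.mem_range, Bool.not_eq_true', ← Bool.not_eq_true, eqB_iff]
  rfl

theorem exists_isFirst (i : ℕ) : ∃ j ≤ i, w.isFirst j = true ∧ w.v j = w.v i := by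
  induction i using Nat.strong_induction_on with
  | _ i ih =>
    by_cases h : w.isFirst i = true
    · exact ⟨i, le_rfl, h, rfl⟩
    · rw [isFirst_iff] at h
      push Not at h
      obtain ⟨j, hj, hji⟩ := h
      obtain ⟨j', hj', h1, h2⟩ := ih j hj
      exact ⟨j', by omega, h1, h2.trans hji⟩

theorem isFirst_inj {i j : ℕ} (hi : w.isFirst i = true) (hj : w.isFirst j = true)
    (h : w.v i = w.v j) : i = j := by
  rw [isFirst_iff] at hi hj
  rcases lt_trichotomy i j with hij | hij | hij
  · exact absurd h (hj i hij)
  · exact hij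
  · exact absurd h.symm (hi j hij)

theorem beats_iff {i j : ℕ} : w.beats j i = true ↔
    w.weight i < w.weight j ∨ (w.weight i = w.weight j ∧ j < i) := by
  simp [beats]

theorem rank_eq_card (i : ℕ) : w.rank i =
    ((Finset.range w.num).filter fun j => w.isFirst j = true ∧ w.beats j i = true).card := by
  simp only [rank, Bool.and_eq_true, Finset.card_filter]

theorem rank_lt_rank {i j : ℕ} (hj : j < w.num) (hjf : w.isFirst j = true)
    (h : w.beats j i = true) : w.rank j < w.rank i := by
  rw [rank_eq_card, rank_eq_card]
  refine Finset.card_lt_card (Finset.ssubset_iff_of_subset ?_ |>.2 ⟨j, ?_, ?_⟩)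
  · intro j' hj'
    simp only [Finset.mem_filter, beats_iff] at hj' h ⊢
    exact ⟨hj'.1, hj'.2.1, by omega⟩
  · simp [hj, hjf, h]
  · simp [beats_iff]

theorem mem_out {β : Vec w.dim} :
    β ∈ w.out ↔ ∃ i < w.num, w.selected i = true ∧ w.v i = β := by
  simp only [out, verdict, List.mem_toFinset, List.mem_map, mem_collect]
  constructor
  · rintro ⟨_, ⟨_, ⟨i, hi, hs, rfl⟩, rfl⟩, rfl⟩
    exact ⟨i, hi, hs, rfl⟩
  · rintro ⟨i, hi, hs, rfl⟩
    exact ⟨_, ⟨_, ⟨i, hi, hs, rfl⟩, rfl⟩, rfl⟩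

theorem count_eq_card : w.count = ((Finset.range w.num).filter fun i => w.selected i = true).card := by
  rw [count, Finset.card_filter]

theorem card_out : w.out.card = w.count := by
  classical
  have h : w.out = ((Finset.range w.num).filter fun i => w.selected i = true).image w.v := by
    ext β
    rw [mem_out]
    simp only [Finset.mem_image, Finset.mem_filter, Finset.mem_range, and_assoc]
  rw [h, count_eq_card, Finset.card_image_of_injOn]
  intro i hi j hj hij
  simp only [Finset.coe_filter, Set.mem_ofPred_eq, selected, Bool.and_eq_true] at hi hj
  exact isFirst_inj hi.2.1 hj.2.1 hij

/-- Every vector outside of the output that is eligible has at most the weight of any vector in the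
output. -/
theorem weight_le {i j : ℕ} (hi : w.selected i = true) (hj : j < w.num)
    (hjf : w.isFirst j = true) (hjs : w.v j ∉ w.out) : w.weight j ≤ w.weight i := by
  by_contra! h
  have h1 : w.beats j i = true := beats_iff.2 (Or.inl h)
  have h2 := rank_lt_rank hj hjf h1
  simp only [selected, Bool.and_eq_true, decide_eq_true_eq] at hi
  refine hjs (mem_out.2 ⟨j, hj, ?_, rfl⟩)
  simp only [selected, Bool.and_eq_true, decide_eq_true_eq]
  exact ⟨hjf, by omega⟩

/-- If there are at least `t` eligible vectors, then the output has `t` elements. -/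
theorem count_eq (h : w.size ≤ ((Finset.range w.num).filter fun i => w.isFirst i = true).card) :
    w.count = w.size := by
  classical
  set F := (Finset.range w.num).filter fun i => w.isFirst i = true with hF
  have hmem : ∀ i ∈ F, i < w.num ∧ w.isFirst i = true := by simp [hF]
  have hinj : Set.InjOn w.rank F := by
    intro i hi j hj hij
    obtain ⟨hi1, hi2⟩ := hmem i hi
    obtain ⟨hj1, hj2⟩ := hmem j hj
    by_contra hne
    have : w.beats i j = true ∨ w.beats j i = true := by
      rw [beats_iff, beats_iff]; omega
    rcases this with h1 | h1
    · have := rank_lt_rank hi1 hi2 h1; omega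
    · have := rank_lt_rank hj1 hj2 h1; omega
  have hlt : ∀ i ∈ F, w.rank i < F.card := by
    intro i hi
    rw [rank_eq_card]
    refine Finset.card_lt_card (Finset.ssubset_iff_of_subset ?_ |>.2 ⟨i, hi, ?_⟩)
    · intro j hj
      simp only [hF, Finset.mem_filter] at hj ⊢
      exact ⟨hj.1, hj.2.1⟩
    · simp [beats_iff]
  have himg : F.image w.rank = Finset.range F.card := by
    refine Finset.eq_of_subset_of_card_le ?_ ?_
    · intro r hr
      obtain ⟨i, hi, rfl⟩ := Finset.mem_image.1 hr
      exact Finset.mem_range.2 (hlt i hi)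
    · rw [Finset.card_image_of_injOn hinj, Finset.card_range]
  have h1 : ((Finset.range w.num).filter fun i => w.selected i = true) =
      F.filter fun i => w.rank i < w.size := by
    ext i
    simp only [hF, selected, Finset.mem_filter, Bool.and_eq_true, decide_eq_true_eq, and_assoc]
  have h2 : (F.filter fun i => w.rank i < w.size).image w.rank = Finset.range w.size := by
    ext r
    simp only [Finset.mem_image, Finset.mem_filter, Finset.mem_range]
    constructor
    · rintro ⟨i, ⟨_, hi⟩, rfl⟩
      exact hi
    · intro hr
      have : r ∈ F.image w.rank := by rw [himg, Finset.mem_range]; omega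
      obtain ⟨i, hi, rfl⟩ := Finset.mem_image.1 this
      exact ⟨i, ⟨hi, hr⟩, rfl⟩
  rw [count_eq_card, h1, ← Finset.card_image_of_injOn (f := w.rank)
    (hinj.mono (by exact_mod_cast Finset.filter_subset _ _)), h2, Finset.card_range]

/-- There is enough padding for an output with `t` elements. -/
theorem count_eq_of_le (h : w.size ≤ 2 ^ w.dim) : w.count = w.size := by
  classical
  refine count_eq ?_
  have h1 : ((Finset.range w.num).filter fun i => w.isFirst i = true).image w.v =
      (Finset.range w.num).image w.v := by
    ext β
    simp only [Finset.mem_image, Finset.mem_filter, Finset.mem_range]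
    constructor
    · rintro ⟨i, ⟨hi, _⟩, rfl⟩
      exact ⟨i, hi, rfl⟩
    · rintro ⟨i, hi, rfl⟩
      obtain ⟨j, hj, hf, he⟩ := exists_isFirst (w := w) i
      exact ⟨j, ⟨by omega, hf⟩, he⟩
  have h2 : Set.InjOn (fun j => w.v (numCand w.acc + j)) (Finset.range w.size : Set ℕ) := by
    intro i hi j hj hij
    simp only [Finset.coe_range, Set.mem_Iio] at hi hj
    simp only [v, vec, Nat.not_lt.2 (Nat.le_add_right _ _), decide_false, Bool.false_eq_true,
      if_false, Nat.add_sub_cancel_left] at hij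
    refine Nat.eq_of_testBit_eq fun r => ?_
    rcases lt_or_ge r w.dim with hr | hr
    · have h3 := congrFun hij ⟨r, hr⟩
      rw [decodeVec_apply, decodeVec_apply, bz_inj, natVec, natVec, mapRange_getD _ _ _ _ hr,
        mapRange_getD _ _ _ _ hr] at h3
      exact h3
    · have h3 : (2 : ℕ) ^ w.dim ≤ 2 ^ r := Nat.pow_le_pow_right (by norm_num) hr
      rw [Nat.testBit_lt_two_pow (by omega), Nat.testBit_lt_two_pow (by omega)]
  calc w.size = ((Finset.range w.size).image fun j => w.v (numCand w.acc + j)).card := by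
        rw [Finset.card_image_of_injOn h2, Finset.card_range]
    _ ≤ ((Finset.range w.num).image w.v).card := by
        refine Finset.card_le_card fun β hβ => ?_
        obtain ⟨j, hj, rfl⟩ := Finset.mem_image.1 hβ
        rw [Finset.mem_range] at hj
        exact Finset.mem_image.2 ⟨_, Finset.mem_range.2 (by rw [num]; omega), rfl⟩
    _ ≤ _ := by
        rw [← h1]
        exact Finset.card_image_le

/-- Sums over first occurrences are sums over the set of the candidates. -/
theorem sum_first_eq (g : Vec w.dim → ℝ) (q : Vec w.dim → Prop) [DecidablePred q]
    [DecidablePred fun γ => ∃ i < numCand w.acc, w.v i = γ] :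
    (∑ i ∈ Finset.range (numCand w.acc),
      if w.isFirst i = true ∧ q (w.v i) then g (w.v i) else 0) =
        ∑ γ, if q γ ∧ ∃ i < numCand w.acc, w.v i = γ then g γ else 0 := by
  classical
  rw [← Finset.sum_filter, ← Finset.sum_filter]
  have h : (Finset.univ.filter fun γ => q γ ∧ ∃ i < numCand w.acc, w.v i = γ) =
      ((Finset.range (numCand w.acc)).filter fun i => w.isFirst i = true ∧ q (w.v i)).image w.v := by
    ext γ
    simp only [Finset.mem_filter, Finset.mem_univ, true_and, Finset.mem_image, Finset.mem_range]
    constructor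
    · rintro ⟨hq, i, hi, rfl⟩
      obtain ⟨j, hj, hf, he⟩ := exists_isFirst (w := w) i
      exact ⟨j, ⟨by omega, hf, he ▸ hq⟩, he⟩
    · rintro ⟨i, ⟨hi, _, hq⟩, rfl⟩
      exact ⟨hq, i, hi, rfl⟩
  rw [h, Finset.sum_image]
  intro i hi j hj hij
  simp only [Finset.coe_filter, Set.mem_ofPred_eq] at hi hj
  exact isFirst_inj hi.2.1 hj.2.1 hij

end View

end FourierIP

namespace FourierIP

/-! ### Soundness and completeness of the verifier's decision -/

section Decision

variable {n : ℕ} (f : Vec n → ℤˣ) (t a l : ℕ)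

/-- The verifier's random choices before the message. -/
abbrev Choices (n a l : ℕ) : Type :=
  Fin (numBlocks l) → BlockΩ n (hashBits a) (numItems a l)

/-- The points of the fresh examples. -/
abbrev Fresh (n a l : ℕ) : Type := Fin (numItems a l) → Vec n × Vec n

variable (r1 r2 : Raw) (ω : Choices n a l) (ex : Fresh n a l)

/-- The view of the verifier that results from the random choices and the prover's messages. -/
def mkView : View :=
  ((((n, t, a, l), r1, encBlocks f ω), r2),
    List.ofFn fun i => (encEx f (ex i).1, encEx f (ex i).2))

/-- The `i`-th candidate of the prover. -/
def cand (n : ℕ) (r : Raw) (i : ℕ) : Vec n := decodeVec n (rawVec n r i)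

/-- The contribution of an item to the estimate of a bucket, if the prover's answer is right. -/
noncomputable def corr {k : ℕ} (Z : Fin k → Vec n) (b : Vec k) (w : ItemΩ n k) : ℝ :=
  if w.2.1 then 0 else val f w.1 * val f (w.1 + shift Z w.2.2) * chi b w.2.2

/-- The estimates of the buckets would be accurate with a truthful prover. -/
def BucketsOK : Prop := ∀ ℓ b, |∑ i, corr f (ω ℓ).1 b ((ω ℓ).2 i) -
  numItems a l * (bucketMass f (ω ℓ).1 b / 2)| < numItems a l * (1 / (16 * accInv a))

/-- The estimates of the coefficients of the candidates are accurate. -/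
def CandsOK : Prop := ∀ i < numCand a, |∑ j, val f (ex j).1 * val f (ex j).2 *
    (chi (cand n r1 i) (ex j).1 * chi (cand n r1 i) (ex j).2) -
  numItems a l * fsq f (cand n r1 i)| < numItems a l * (1 / (128 * accInv a ^ 2))

/-- The prover's answer for an item. -/
def answerAt (j : Fin (numBlocks l) × Fin (numItems a l)) : Bool :=
  r2.get (j.1 * numItems a l + j.2)

/-- The items for which the prover's answer is wrong. -/
def wrong : Finset (Fin (numBlocks l) × Fin (numItems a l)) :=
  Finset.univ.filter fun j => answerAt a l r2 j ≠ encodeLabel (f (sentPoint ω j))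

variable {t a l r1 r2 ω ex}

theorem item_mkView (j : Fin (numBlocks l) × Fin (numItems a l)) :
    (mkView f t a l r1 r2 ω ex).item (j.1 * numItems a l + j.2) = encItem f ((ω j.1).2 j.2) :=
  getItem_encBlocks f ω j

/-- The bucket with a given number. -/
def bucket (k b : ℕ) : Vec k := fun r => bz (b.testBit r)

theorem exists_bucket {k : ℕ} (b : Vec k) : ∃ b' < 2 ^ k, bucket k b' = b := by
  refine ⟨Nat.ofBits fun r => decide (b r = 1), Nat.ofBits_lt_two_pow _, ?_⟩
  funext r
  rw [bucket, Nat.testBit_ofBits_lt _ _ r.2, bz_decide]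

/-- The estimated mass of a bucket is the positive part of a sum of signs. -/
theorem cast_mass (ℓ : Fin (numBlocks l)) (b : ℕ) :
    ((mkView f t a l r1 r2 ω ex).mass ℓ b : ℝ) =
      max (∑ i, if ((ω ℓ).2 i).2.1 then 0 else
        val f ((ω ℓ).2 i).1 * sgn (bz (answerAt a l r2 (ℓ, i))) *
          chi (bucket (hashBits a) b) ((ω ℓ).2 i).2.2) 0 := by
  have h := cast_count_sub (numItems a l)
    (fun i => !((mkView f t a l r1 r2 ω ex).item (ℓ * numItems a l + i)).2.1)
    (fun i => (mkView f t a l r1 r2 ω ex).neg b (ℓ * numItems a l + i))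
  rw [View.mass]
  refine h.trans ?_
  congr 1
  refine Finset.sum_congr rfl fun i _ => ?_
  rw [View.neg, item_mkView f (ℓ, i)]
  cases hT : ((ω ℓ).2 i).2.1
  · simp only [encItem, hT, Bool.not_false, if_true, Bool.false_eq_true, if_false]
    rw [bz_xor, bz_xor, sgn_add, sgn_add, bz_parity, encEx]
    simp only [sgn_label]
    congr 1
    rw [chi_comm, chi_eq_sgn]
    congr 1
    refine Finset.sum_congr rfl fun r _ => ?_
    rw [bz_and]
    exact congrArg₂ (· * ·) (bz_encodeVec (n := hashBits a) _ r) rfl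
  · simp [encItem, hT]

/-- Each wrong answer changes the estimate of a bucket by at most `2`. -/
theorem abs_sum_sub_le (ℓ : Fin (numBlocks l)) (b : Vec (hashBits a)) :
    |(∑ i, if ((ω ℓ).2 i).2.1 then 0 else
        val f ((ω ℓ).2 i).1 * sgn (bz (answerAt a l r2 (ℓ, i))) * chi b ((ω ℓ).2 i).2.2) -
      ∑ i, corr f (ω ℓ).1 b ((ω ℓ).2 i)| ≤ 2 * (wrong f a l r2 ω).card := by
  classical
  rw [← Finset.sum_sub_distrib]
  refine (Finset.abs_sum_le_sum_abs _ _).trans ?_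
  have h1 : ∀ i : Fin (numItems a l), |(if ((ω ℓ).2 i).2.1 then 0 else
        val f ((ω ℓ).2 i).1 * sgn (bz (answerAt a l r2 (ℓ, i))) * chi b ((ω ℓ).2 i).2.2) -
      corr f (ω ℓ).1 b ((ω ℓ).2 i)| ≤ 2 * if (ℓ, i) ∈ wrong f a l r2 ω then 1 else 0 := by
    intro i
    rw [corr]
    cases hT : ((ω ℓ).2 i).2.1
    · simp only [Bool.false_eq_true, if_false]
      have h2 : sentPoint ω (ℓ, i) = ((ω ℓ).2 i).1 + shift (ω ℓ).1 ((ω ℓ).2 i).2.2 := by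
        simp [sentPoint, hT]
      split_ifs with hw
      · refine (abs_sub _ _).trans ?_
        simp only [abs_mul, abs_val, abs_sgn, abs_chi]
        norm_num
      · simp only [wrong, Finset.mem_filter, Finset.mem_univ, true_and, ne_eq, not_not] at hw
        rw [hw, sgn_label, h2]
        simp
    · simp only [if_true, sub_self, abs_zero]
      positivity
  refine (Finset.sum_le_sum fun i _ => h1 i).trans ?_
  rw [← Finset.mul_sum, Finset.sum_boole]
  gcongr
  refine Finset.card_le_card_of_injOn (fun i => (ℓ, i)) ?_ ?_
  · intro i hi
    simpa using hi
  · intro i _ j _ hij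
    exact (Prod.mk.inj hij).2

theorem accInv_pos (ha : 1 ≤ a) : (1 : ℝ) ≤ accInv a := by
  have : 1 ≤ a ^ 2 := Nat.one_le_pow _ _ ha
  have : 1 ≤ accInv a := by rw [accInv]; omega
  exact_mod_cast this

theorem cast_numItems : (numItems a l : ℝ) = 2 * accInv a * tol a l := by
  rw [numItems]; push_cast; ring

theorem cast_tol : (tol a l : ℝ) =
    131072 * (accInv a : ℝ) ^ 3 * (l + numBlocks l + numCand a + numBuckets a + 8) := by
  rw [tol]; push_cast; ring

/-- `numItems` is large enough for a small number of wrong answers to be harmless. -/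
theorem wrong_small (ha : 1 ≤ a) :
    4 * ((l : ℝ) + 3) ≤ numItems a l * (1 / (8 * accInv a)) := by
  have hA := accInv_pos ha
  rw [cast_numItems, cast_tol]
  have h1 : (1 : ℝ) ≤ (accInv a : ℝ) ^ 3 := one_le_pow₀ hA
  have h2 : 2 * (accInv a : ℝ) * (131072 * (accInv a : ℝ) ^ 3 *
      (l + numBlocks l + numCand a + numBuckets a + 8)) * (1 / (8 * accInv a)) =
        32768 * ((accInv a : ℝ) ^ 3 * (l + numBlocks l + numCand a + numBuckets a + 8)) := by
    field_simp
    ring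
  rw [h2]
  have h3 : (l : ℝ) + 3 ≤ l + numBlocks l + numCand a + numBuckets a + 8 := by
    have : (0 : ℝ) ≤ numBlocks l + numCand a + numBuckets a := by positivity
    linarith
  have h4 : (0 : ℝ) ≤ l := by positivity
  nlinarith

theorem numItems_pos (ha : 1 ≤ a) : (0 : ℝ) < numItems a l := by
  have hA := accInv_pos ha
  rw [cast_numItems, cast_tol]
  positivity

theorem vec_mkView {i : ℕ} (hi : i < numCand a) :
    (mkView f t a l r1 r2 ω ex).v i = cand n r1 i := by
  have : (mkView f t a l r1 r2 ω ex).vec i = rawVec n r1 i := by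
    rw [View.vec, if_pos]
    · rfl
    · exact decide_eq_true hi
  rw [View.v, this]
  rfl

theorem abs_max_sub_le {x y : ℝ} (hy : 0 ≤ y) : |max x 0 - y| ≤ |x - y| := by
  have h := abs_max_sub_max_le_abs x y 0
  rwa [max_eq_left hy] at h

/-- The weight of a candidate approximates its squared coefficient. -/
theorem abs_weight_sub (hex : CandsOK f a l r1 ex) {i : ℕ} (hi : i < numCand a) :
    |((mkView f t a l r1 r2 ω ex).weight i : ℝ) - numItems a l * fsq f (cand n r1 i)| <
      numItems a l * (1 / (128 * accInv a ^ 2)) := by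
  have h1 : (mkView f t a l r1 r2 ω ex).weight i =
      estimate n (numItems a l) (List.ofFn fun i => (encEx f (ex i).1, encEx f (ex i).2))
        ((mkView f t a l r1 r2 ω ex).vec i) := by
    rw [View.weight, if_pos]
    · rfl
    · exact decide_eq_true hi
  rw [h1, cast_estimate]
  refine (abs_max_sub_le (by have := fsq_nonneg f (cand n r1 i); positivity)).trans_lt ?_
  have h2 : decodeVec n ((mkView f t a l r1 r2 ω ex).vec i) = cand n r1 i := vec_mkView f hi
  rw [h2]
  exact hex i hi

theorem inBucket_iff {ℓ : Fin (numBlocks l)} {b i : ℕ} (hi : i < numCand a) :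
    (mkView f t a l r1 r2 ω ex).inBucket ℓ b i = true ↔
      hash (ω ℓ).1 (cand n r1 i) = bucket (hashBits a) b := by
  have h : ∀ x y : Bool, (!(x ^^ y)) = true ↔ x = y := by decide
  have h1 : ∀ r : Fin (hashBits a), (mkView f t a l r1 r2 ω ex).hashVec ℓ r =
      encodeVec ((ω ℓ).1 r) := by
    intro r
    change ((encBlocks f ω).getD ℓ ([], [])).1.getD r [] = _
    rw [encBlocks, ofFn_getD, encBlock, ofFn_getD]
  have h2 : ∀ r : Fin (hashBits a), dotB n ((mkView f t a l r1 r2 ω ex).vec i)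
      ((mkView f t a l r1 r2 ω ex).hashVec ℓ r) = b.testBit r ↔
        hash (ω ℓ).1 (cand n r1 i) r = bucket (hashBits a) b r := by
    intro r
    rw [← bz_inj, bz_dotB, h1, decode_encode]
    have : decodeVec n ((mkView f t a l r1 r2 ω ex).vec i) = cand n r1 i := vec_mkView f hi
    rw [this]
    rfl
  rw [View.inBucket, List.all_eq_true, funext_iff]
  simp only [List.mem_range, h]
  exact ⟨fun h3 r => (h2 r).1 (h3 r r.2), fun h3 r hr => (h2 ⟨r, hr⟩).2 (h3 ⟨r, hr⟩)⟩

/-- A variant of `if_congr` that leaves the decidability instances to unification. -/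
theorem ite_eq_ite {β : Type*} {p q : Prop} {_ : Decidable p} {_ : Decidable q} (h : p ↔ q)
    (x y : β) : ite p x y = ite q x y := if_congr h rfl rfl

/-- The set of the prover's candidates. -/
def IsCand (a : ℕ) (r1 : Raw) (γ : Vec n) : Prop := ∃ i < numCand a, cand n r1 i = γ

open Classical in
/-- The total weight of the candidates in a bucket approximates their mass. -/
theorem abs_sum_weightIn_sub (ha : 1 ≤ a) (hex : CandsOK f a l r1 ex) (ℓ : Fin (numBlocks l))
    (b : ℕ) :
    |((∑ i ∈ Finset.range (numCand a), (mkView f t a l r1 r2 ω ex).weightIn ℓ b i : ℕ) : ℝ) -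
      numItems a l * ∑ γ, (if hash (ω ℓ).1 γ = bucket (hashBits a) b ∧ IsCand a r1 γ
        then fsq f γ else 0)| ≤ numItems a l * (1 / (8 * accInv a)) := by
  have hA := accInv_pos ha
  have h1 := View.sum_first_eq (w := mkView f t a l r1 r2 ω ex) (fsq f)
    (fun γ => hash (ω ℓ).1 γ = bucket (hashBits a) b)
  have h2 : ∀ γ : Vec n, (∃ i < numCand a, (mkView f t a l r1 r2 ω ex).v i = γ) ↔
      IsCand a r1 γ := by
    intro γ
    refine exists_congr fun i => and_congr_right fun hi => ?_
    rw [vec_mkView f hi]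
    exact Iff.rfl
  have h3 : (∑ γ, (if hash (ω ℓ).1 γ = bucket (hashBits a) b ∧ IsCand a r1 γ
        then fsq f γ else 0)) = ∑ i ∈ Finset.range (numCand a),
      if (mkView f t a l r1 r2 ω ex).isFirst i = true ∧
        hash (ω ℓ).1 (cand n r1 i) = bucket (hashBits a) b then fsq f (cand n r1 i) else 0 := by
    refine Eq.trans (Finset.sum_congr rfl fun γ _ => ?_) (h1.symm.trans
      (Finset.sum_congr rfl fun i hi => ?_))
    · exact ite_eq_ite (and_congr_right fun _ => (h2 γ).symm) _ _
    · have h5 : (mkView f t a l r1 r2 ω ex).v i = cand n r1 i :=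
        vec_mkView f (Finset.mem_range.1 hi)
      have h6 := congrArg (fun γ : Vec n => if (mkView f t a l r1 r2 ω ex).isFirst i = true ∧
        hash (ω ℓ).1 γ = bucket (hashBits a) b then fsq f γ else 0) h5
      refine Eq.trans ?_ (h6.trans ?_)
      · exact ite_eq_ite Iff.rfl _ _
      · exact ite_eq_ite Iff.rfl _ _
  rw [h3, Finset.mul_sum]
  push_cast
  rw [← Finset.sum_sub_distrib]
  refine (Finset.abs_sum_le_sum_abs _ _).trans ?_
  have h4 : ∀ i ∈ Finset.range (numCand a),
      |((mkView f t a l r1 r2 ω ex).weightIn ℓ b i : ℝ) - numItems a l *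
        (if (mkView f t a l r1 r2 ω ex).isFirst i = true ∧
          hash (ω ℓ).1 (cand n r1 i) = bucket (hashBits a) b then fsq f (cand n r1 i) else 0)| ≤
        numItems a l * (1 / (128 * accInv a ^ 2)) := by
    intro i hi
    have hi := Finset.mem_range.1 hi
    have h5 : (mkView f t a l r1 r2 ω ex).weightIn ℓ b i =
        if (mkView f t a l r1 r2 ω ex).isFirst i = true ∧
          hash (ω ℓ).1 (cand n r1 i) = bucket (hashBits a) b then
            (mkView f t a l r1 r2 ω ex).weight i else 0 := by
      rw [View.weightIn]
      simp only [Bool.and_eq_true, inBucket_iff f hi]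
    rw [h5]
    split_ifs
    · exact (abs_weight_sub f hex hi).le
    · simp only [Nat.cast_zero, mul_zero, sub_zero, abs_zero]
      positivity
  refine (Finset.sum_le_sum h4).trans ?_
  rw [Finset.sum_const, Finset.card_range, nsmul_eq_mul, numCand]
  push_cast
  refine le_of_eq ?_
  field_simp
  ring

theorem two_pow_hashBits (ha : 1 ≤ a) :
    2 ^ hashBits a ≤ numBuckets a ∧ numBuckets a < 2 ^ (hashBits a + 1) := by
  have : numBuckets a ≠ 0 := by
    have : 1 ≤ a ^ 2 := Nat.one_le_pow _ _ ha
    rw [numBuckets, accInv]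
    positivity
  exact ⟨Nat.pow_log_le_self 2 this, Nat.lt_pow_succ_log_self (by norm_num) _⟩

theorem blockOK_iff {ℓ : ℕ} : (mkView f t a l r1 r2 ω ex).blockOK ℓ = true ↔
    ∀ b < numBuckets a, 2 * (mkView f t a l r1 r2 ω ex).mass ℓ b ≤
      (∑ i ∈ Finset.range (numCand a), (mkView f t a l r1 r2 ω ex).weightIn ℓ b i) + tol a l := by
  rw [View.blockOK, List.all_eq_true]
  simp only [List.mem_range, decide_eq_true_eq]
  rfl

/-- If a block passes the test, then all large coefficients are among the candidates. -/
theorem fsq_le_of_blockOK (ha : 1 ≤ a) (hω : BucketsOK f a l ω) (hex : CandsOK f a l r1 ex)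
    (hwrong : (wrong f a l r2 ω).card < l + 3) {ℓ : Fin (numBlocks l)}
    (hok : (mkView f t a l r1 r2 ω ex).blockOK ℓ = true) {α : Vec n} (hα : ¬ IsCand a r1 α) :
    fsq f α ≤ 1 / accInv a := by
  classical
  have hA := accInv_pos ha
  have hm := numItems_pos (l := l) ha
  obtain ⟨b, hb, hbα⟩ := exists_bucket (hash (ω ℓ).1 α)
  have h1 := (blockOK_iff f).1 hok b (hb.trans_le (two_pow_hashBits ha).1)
  have h1 : 2 * ((mkView f t a l r1 r2 ω ex).mass ℓ b : ℝ) ≤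
      ((∑ i ∈ Finset.range (numCand a), (mkView f t a l r1 r2 ω ex).weightIn ℓ b i : ℕ) : ℝ) +
        tol a l := by exact_mod_cast h1
  have h2 := (abs_le.1 (abs_sum_weightIn_sub (t := t) (r2 := r2) (ω := ω) f ha hex ℓ b)).2
  rw [cast_mass] at h1
  have h3 := le_max_left (∑ i, if ((ω ℓ).2 i).2.1 then 0 else
        val f ((ω ℓ).2 i).1 * sgn (bz (answerAt a l r2 (ℓ, i))) *
          chi (bucket (hashBits a) b) ((ω ℓ).2 i).2.2) 0
  have h4 := (abs_le.1 (abs_sum_sub_le (r2 := r2) (ω := ω) f ℓ (bucket (hashBits a) b))).1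
  have h5 := (abs_lt.1 (hω ℓ (bucket (hashBits a) b))).1
  have h6 : fsq f α + ∑ γ, (if hash (ω ℓ).1 γ = bucket (hashBits a) b ∧ IsCand a r1 γ
        then fsq f γ else 0) ≤ bucketMass f (ω ℓ).1 (bucket (hashBits a) b) := by
    have h7 : fsq f α = ∑ γ, if γ = α then fsq f α else 0 := by simp
    rw [bucketMass, h7, ← Finset.sum_add_distrib]
    refine Finset.sum_le_sum fun γ _ => ?_
    have := fsq_nonneg f γ
    by_cases hγ : γ = α
    · subst hγ
      simp [hα, hbα]
    · rw [if_neg hγ, zero_add]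
      split_ifs <;> simp_all
  have h7 := wrong_small (l := l) ha
  have h8 : ((wrong f a l r2 ω).card : ℝ) ≤ l + 3 := by exact_mod_cast hwrong.le
  have h9 : (tol a l : ℝ) = numItems a l * (1 / (2 * accInv a)) := by
    rw [cast_numItems]; field_simp
  have h10 : numItems a l * fsq f α ≤ numItems a l * (1 / accInv a : ℝ) := by
    -- In units of `numItems / (8 * accInv a)`, twice the estimated mass is off by at most `2` (`1`
    -- from sampling, `1` from wrong answers), the weights by `1`, and the tolerance is `4`.
    have e1 : (1 / (2 * accInv a) : ℝ) = 4 * (1 / (8 * accInv a)) := by field_simp; norm_num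
    have e2 : (1 / (16 * accInv a) : ℝ) = 1 / 2 * (1 / (8 * accInv a)) := by field_simp; norm_num
    have e3 : (1 / accInv a : ℝ) = 8 * (1 / (8 * accInv a)) := by field_simp
    have hu : (0 : ℝ) < 1 / (8 * accInv a) := by positivity
    rw [h9, e1] at h1
    rw [e2] at h5
    rw [e3]
    have := mul_le_mul_of_nonneg_left h6 hm.le
    have := mul_pos hm hu
    linarith
  exact le_of_mul_le_mul_left h10 hm

theorem accepts_iff : (mkView f t a l r1 r2 ω ex).accepts = true ↔
    (∀ j : Fin (numBlocks l) × Fin (numItems a l), ((ω j.1).2 j.2).2.1 = true →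
      answerAt a l r2 j = encodeLabel (f ((ω j.1).2 j.2).1)) ∧
    (∃ ℓ : Fin (numBlocks l), (mkView f t a l r1 r2 ω ex).blockOK ℓ = true) ∧
      (mkView f t a l r1 r2 ω ex).count = t := by
  have h : ∀ x y z : Bool, (!(x && (y ^^ z))) = true ↔ (x = true → y = z) := by decide
  rw [View.accepts, Bool.and_eq_true, Bool.and_eq_true, decide_eq_true_eq, View.testsOK,
    List.all_eq_true, List.any_eq_true]
  simp only [List.mem_range, h]
  refine and_congr ⟨fun h1 j hT => ?_, fun h1 q hq hT => ?_⟩ (and_congr ⟨?_, ?_⟩ Iff.rfl)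
  · have h2 := h1 _ (index_lt j.1.2 j.2.2)
    change ((mkView f t a l r1 r2 ω ex).item (j.1 * numItems a l + j.2)).2.1 = true →
      (mkView f t a l r1 r2 ω ex).answer (j.1 * numItems a l + j.2) =
        ((mkView f t a l r1 r2 ω ex).item (j.1 * numItems a l + j.2)).1.2 at h2
    rw [item_mkView] at h2
    exact h2 hT
  · change q < numBlocks l * numItems a l at hq
    have hm : 0 < numItems a l := Nat.pos_of_ne_zero (by intro h0; rw [h0] at hq; simp at hq)
    have h2 : q / numItems a l < numBlocks l := Nat.div_lt_of_lt_mul (by rwa [mul_comm])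
    have h3 := h1 (⟨_, h2⟩, ⟨_, Nat.mod_lt q hm⟩)
    have h4 := item_mkView (t := t) (r1 := r1) (r2 := r2) (ω := ω) (ex := ex) f
      (⟨_, h2⟩, ⟨_, Nat.mod_lt q hm⟩)
    simp only [answerAt, Nat.div_add_mod'] at h3 h4
    rw [h4] at hT ⊢
    exact h3 hT
  · rintro ⟨ℓ, hℓ, h1⟩
    exact ⟨⟨ℓ, hℓ⟩, h1⟩
  · rintro ⟨ℓ, h1⟩
    exact ⟨ℓ, ℓ.2, h1⟩

/-- `1 / accInv a ≤ (ε / 3) ^ 2`, and square roots are subadditive. -/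
theorem isTop_of_fsq {ε : ℝ} (ha : 1 ≤ a) (hε : 1 / (a : ℝ) ≤ ε) {Λ : Finset (Vec n)}
    (h : ∀ α, α ∉ Λ → ∀ β ∈ Λ, fsq f α ≤ fsq f β + 1 / accInv a) : IsTop f (ε / 3) Λ := by
  intro α hα β hβ
  have ha' : (1 : ℝ) ≤ a := by exact_mod_cast ha
  have h1 := h α hα β hβ
  have h2 : (1 / accInv a : ℝ) = (1 / (3 * a)) ^ 2 := by
    rw [accInv]; push_cast; field_simp; norm_num
  have h3 : (1 / (3 * a) : ℝ) ≤ ε / 3 := by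
    have : (1 / (3 * a) : ℝ) = 1 / a / 3 := by field_simp
    rw [this]
    linarith
  have h4 : (0 : ℝ) < 1 / (3 * a) := by positivity
  rw [fsq, fsq, h2, ← sq_abs, ← sq_abs (fourierCoefficient f β)] at h1
  have h5 := abs_nonneg (fourierCoefficient f β)
  refine (abs_le_of_sq_le_sq' (a := |fourierCoefficient f α|)
    (b := |fourierCoefficient f β| + 1 / (3 * a)) ?_ (by positivity)).2.trans (by linarith)
  nlinarith

/-- If the estimates are accurate and the prover's answers are almost all right, then the output is
good. -/
theorem isTop_out {ε : ℝ} (ha : 1 ≤ a) (hε : 1 / (a : ℝ) ≤ ε) (hω : BucketsOK f a l ω)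
    (hex : CandsOK f a l r1 ex) (hwrong : (wrong f a l r2 ω).card < l + 3)
    (hacc : (mkView f t a l r1 r2 ω ex).accepts = true) :
    IsTop f (ε / 3) (mkView f t a l r1 r2 ω ex).out := by
  obtain ⟨-, ⟨ℓ, hℓ⟩, -⟩ := (accepts_iff f).1 hacc
  have hA := accInv_pos ha
  have hm := numItems_pos (l := l) ha
  refine isTop_of_fsq f ha hε fun α hα β hβ => ?_
  by_cases hc : IsCand a r1 α
  · obtain ⟨j0, hj0, hj0α⟩ := hc
    obtain ⟨j, hj, hjf, hjα⟩ := View.exists_isFirst (w := mkView f t a l r1 r2 ω ex) j0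
    have hj : j < numCand a := hj.trans_lt hj0
    rw [vec_mkView f hj0, hj0α, vec_mkView f hj] at hjα
    obtain ⟨i, hi, his, hiβ⟩ := View.mem_out.1 hβ
    have h1 := View.weight_le his (j := j)
      (show j < numCand a + t from hj.trans_le (Nat.le_add_right _ _)) hjf (by
        rw [vec_mkView f hj, hjα]; exact hα)
    have h1 : ((mkView f t a l r1 r2 ω ex).weight j : ℝ) ≤
      (mkView f t a l r1 r2 ω ex).weight i := by exact_mod_cast h1
    have h2 := (abs_lt.1 (abs_weight_sub (t := t) (r2 := r2) (ω := ω) f hex hj)).1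
    rw [hjα] at h2
    have h3 : ((mkView f t a l r1 r2 ω ex).weight i : ℝ) ≤ numItems a l * fsq f β +
        numItems a l * (1 / (128 * accInv a ^ 2)) := by
      by_cases hi' : i < numCand a
      · have h4 := (abs_lt.1 (abs_weight_sub (t := t) (r2 := r2) (ω := ω) f hex hi')).2
        rw [vec_mkView f hi'] at hiβ
        rw [hiβ] at h4
        linarith
      · have h4 : (mkView f t a l r1 r2 ω ex).weight i = 0 := by
          rw [View.weight, if_neg]
          exact fun h => hi' (of_decide_eq_true h)
        rw [h4, Nat.cast_zero]
        have := fsq_nonneg f β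
        positivity
    have h5 : (2 : ℝ) * (1 / (128 * accInv a ^ 2)) ≤ 1 / accInv a := by
      rw [mul_one_div, div_le_div_iff₀ (by positivity) (by positivity)]
      nlinarith
    have h6 := mul_le_mul_of_nonneg_left h5 hm.le
    have h7 : numItems a l * fsq f α ≤ numItems a l * (fsq f β + 1 / accInv a) := by linarith
    exact le_of_mul_le_mul_left h7 hm
  · have h1 := fsq_le_of_blockOK f ha hω hex hwrong hℓ hc
    have := fsq_nonneg f β
    linarith

/-- The verifier accepts truthful answers if the estimates are accurate, some hash function has few
collisions, and the prover's candidates comprise all large coefficients. -/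
theorem accepts_of_honest (ha : 1 ≤ a) (ht : t ≤ 2 ^ n) (hω : BucketsOK f a l ω)
    (hex : CandsOK f a l r1 ex)
    (hans : ∀ j, answerAt a l r2 j = encodeLabel (f (sentPoint ω j)))
    (hr1 : ∀ γ, ¬ IsCand a r1 γ → fsq f γ ≤ 1 / (8 * accInv a))
    (hZ : ∃ ℓ, collisions f (ω ℓ).1 < 2 * (1 / 2) ^ hashBits a) :
    (mkView f t a l r1 r2 ω ex).accepts = true := by
  classical
  have hA := accInv_pos ha
  have hm := numItems_pos (l := l) ha
  rw [accepts_iff]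
  refine ⟨fun j hT => ?_, ?_, View.count_eq_of_le ht⟩
  · rw [hans, sentPoint, if_pos hT, add_zero]
  obtain ⟨ℓ, hℓ⟩ := hZ
  refine ⟨ℓ, (blockOK_iff f).2 fun b _ => ?_⟩
  have hwrong : (wrong f a l r2 ω).card = 0 := by
    rw [Finset.card_eq_zero, wrong, Finset.filter_eq_empty_iff]
    exact fun j _ => by simp [hans]
  have h2 := (abs_le.1 (abs_sum_weightIn_sub (t := t) (r2 := r2) (ω := ω) f ha hex ℓ b)).1
  have h4 := (abs_le.1 (abs_sum_sub_le (r2 := r2) (ω := ω) f ℓ (bucket (hashBits a) b))).2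
  have h5 := (abs_lt.1 (hω ℓ (bucket (hashBits a) b))).2
  rw [hwrong, Nat.cast_zero, mul_zero] at h4
  have h6 : collisions f (ω ℓ).1 < (1 / (8 * accInv a) : ℝ) ^ 2 := by
    refine hℓ.trans_le ?_
    have h7 := (two_pow_hashBits ha).2
    rw [numBuckets, pow_succ] at h7
    have h8 : (128 : ℝ) * (accInv a : ℝ) ^ 2 ≤ 2 ^ hashBits a := by
      have : (256 : ℝ) * (accInv a : ℝ) ^ 2 ≤ 2 ^ hashBits a * 2 := by exact_mod_cast h7.le
      linarith
    rw [div_pow, one_pow, div_pow, one_pow, mul_one_div,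
      div_le_div_iff₀ (by positivity) (by positivity)]
    nlinarith
  have h7 := residual_le f (b := bucket (hashBits a) b) hr1 (by positivity) (by positivity) h6
  have h8 : bucketMass f (ω ℓ).1 (bucket (hashBits a) b) =
      (∑ γ, (if hash (ω ℓ).1 γ = bucket (hashBits a) b ∧ IsCand a r1 γ then fsq f γ else 0)) +
      ∑ γ, if hash (ω ℓ).1 γ = bucket (hashBits a) b ∧ ¬ IsCand a r1 γ then fsq f γ else 0 := by
    rw [bucketMass, ← Finset.sum_add_distrib]
    refine Finset.sum_congr rfl fun γ _ => ?_
    by_cases h9 : IsCand a r1 γ <;> simp [h9]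
  have h9 : (tol a l : ℝ) = numItems a l * (1 / (2 * accInv a)) := by
    rw [cast_numItems]; field_simp
  have h10 : 2 * ((mkView f t a l r1 r2 ω ex).mass ℓ b : ℝ) ≤
      ((∑ i ∈ Finset.range (numCand a), (mkView f t a l r1 r2 ω ex).weightIn ℓ b i : ℕ) : ℝ) +
        tol a l := by
    -- In units of `numItems / (8 * accInv a)`, the unexplained mass is at most `2`, twice the
    -- estimated mass is off by at most `1`, the weights by `1`, and the tolerance is `4`.
    have e1 : (1 / (2 * accInv a) : ℝ) = 4 * (1 / (8 * accInv a)) := by field_simp; norm_num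
    have e2 : (1 / (16 * accInv a) : ℝ) = 1 / 2 * (1 / (8 * accInv a)) := by field_simp; norm_num
    have hu : (0 : ℝ) < 1 / (8 * accInv a) := by positivity
    have := mul_pos hm hu
    rw [h9, e1, cast_mass]
    rw [e2, h8] at h5
    have h11 := mul_le_mul_of_nonneg_left h7 hm.le
    rcases max_cases (∑ i, if ((ω ℓ).2 i).2.1 then 0 else
        val f ((ω ℓ).2 i).1 * sgn (bz (answerAt a l r2 (ℓ, i))) *
          chi (bucket (hashBits a) b) ((ω ℓ).2 i).2.2) 0 with ⟨h12, -⟩ | ⟨h12, -⟩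
    · rw [h12]
      linarith
    · rw [h12]
      have : (0 : ℝ) ≤ ((∑ i ∈ Finset.range (numCand a),
        (mkView f t a l r1 r2 ω ex).weightIn ℓ b i : ℕ) : ℝ) := by positivity
      linarith
  exact_mod_cast h10

end Decision

end FourierIP

namespace FourierIP

/-! ### The search for the large coefficients -/

section Search

variable {n : ℕ} (f : Vec n → ℤˣ)

/-- The unit vectors of the last `i` coordinates, and zero in place of the others: the hash function
that keeps the last `i` coordinates. -/
def suffixHash (n i : ℕ) (r : Fin n) : Vec n := if n ≤ r + i then Pi.single r 1 else 0

/-- The vector with the list `w` in the last `i` coordinates and zeros elsewhere. -/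
def suffixVec (n i : ℕ) (w : List Bool) : Vec n :=
  fun c => if n ≤ c + i then bz (w.getD (c + i - n) false) else 0

theorem hash_suffixHash (i : ℕ) (γ : Vec n) :
    hash (suffixHash n i) γ = fun c : Fin n => if n ≤ c + i then γ c else 0 := by
  funext c
  rw [hash, suffixHash]
  split_ifs <;> simp

theorem shift_suffixHash (i : ℕ) (γ : Vec n) :
    shift (suffixHash n i) γ = fun c : Fin n => if n ≤ c + i then γ c else 0 := by
  funext c
  rw [shift, Finset.sum_apply, Finset.sum_eq_single c]
  · rw [Pi.smul_apply, suffixHash]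
    split_ifs <;> simp
  · intro b _ hb
    rw [Pi.smul_apply, suffixHash]
    split_ifs
    · rw [Pi.single_eq_of_ne hb.symm, smul_zero]
    · simp
  · simp

/-- The list of the last `i` coordinates. -/
def suffix (γ : Vec n) (i : ℕ) : List Bool := (encodeVec γ).drop (n - i)

theorem hash_eq_suffixVec {i : ℕ} (hi : i ≤ n) (γ : Vec n) :
    hash (suffixHash n i) γ = suffixVec n i (suffix γ i) := by
  rw [hash_suffixHash]
  funext c
  rw [suffixVec]
  split_ifs with h
  · have : (suffix γ i).getD (c + i - n) false = (encodeVec γ).getD c false := by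
      rw [suffix, List.getD_eq_getElem?_getD, List.getElem?_drop, List.getD_eq_getElem?_getD]
      congr 2
      omega
    rw [this, bz_encodeVec]
  · rfl

theorem suffixVec_injOn {i : ℕ} (hi : i ≤ n) {w w' : List Bool} (hw : w.length = i)
    (hw' : w'.length = i) (h : suffixVec n i w = suffixVec n i w') : w = w' := by
  refine List.ext_getElem (hw.trans hw'.symm) fun r hr hr' => ?_
  have h1 := congrFun h ⟨n - i + r, by omega⟩
  have h2 : n - i + r + i - n = r := by omega
  simp only [suffixVec, h2] at h1
  rw [if_pos (by omega), if_pos (by omega), bz_inj, List.getD_eq_getElem _ _ hr,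
    List.getD_eq_getElem _ _ hr'] at h1
  exact h1

/-- The prover's samples as lists of bits. -/
def encPairs {N : ℕ} (w : Fin N → Vec n × Vec n) : List (List Bool × List Bool) :=
  List.ofFn fun i => (encodeVec (w i).1, encodeVec (w i).2)

/-- The answers to the prover's queries. -/
def queryAns {N : ℕ} (w : Fin N → Vec n × Vec n) : List Bool :=
  (List.range (N * (n + 1))).map fun q =>
    encodeLabel (f (decodeVec n (queryPoint n (encPairs w) q).bits))

theorem decode_queryPoint {N i : ℕ} (hi : i ≤ n) (w : Fin N → Vec n × Vec n) (j : Fin N) :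
    decodeVec n (queryPoint n (encPairs w) (j * (n + 1) + i)).bits =
      (w j).1 + shift (suffixHash n i) ((w j).1 + (w j).2) := by
  rw [shift_suffixHash]
  funext c
  rw [decodeVec_apply, queryPoint, mapRange_getD _ _ _ _ c.2, index_mod (by omega),
    index_div (by omega), encPairs, ofFn_getD]
  simp only [decide_eq_true_eq, Pi.add_apply]
  by_cases h : c + i < n
  · rw [if_pos h, if_neg (by omega), bz_encodeVec, add_zero]
  · rw [if_neg h, if_pos (by omega), bz_encodeVec, ← add_assoc, CharTwo.add_self_eq_zero, zero_add]

theorem queryAns_getD {N i : ℕ} (hi : i ≤ n) (w : Fin N → Vec n × Vec n) (j : Fin N) :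
    (queryAns f w).getD (j * (n + 1) + i) false =
      encodeLabel (f ((w j).1 + shift (suffixHash n i) ((w j).1 + (w j).2))) := by
  rw [queryAns, mapRange_getD _ _ _ _ (index_lt j.2 (by omega)), decode_queryPoint hi]

/-- The contribution of a sample to the estimate of the mass of the vectors with a given suffix. -/
noncomputable def suffixCorr (i : ℕ) (b : Vec n) (p : Vec n × Vec n) : ℝ :=
  val f p.1 * val f (p.1 + shift (suffixHash n i) (p.1 + p.2)) * chi b (p.1 + p.2)

theorem shift_suffixHash_zero (γ : Vec n) : shift (suffixHash n 0) γ = 0 := by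
  rw [shift_suffixHash]
  funext c
  rw [if_neg (by omega)]
  rfl

theorem sum_fin_suffix {M : Type*} [AddCommMonoid M] {i : ℕ} (hi : i ≤ n) (g : ℕ → M) :
    ∑ r : Fin i, g (n - i + r) = ∑ c : Fin n, if n ≤ c + i then g c else 0 := by
  rw [← Finset.sum_range fun r => g (n - i + r),
    ← Finset.sum_range fun c => if n ≤ c + i then g c else 0]
  obtain ⟨k, rfl⟩ := Nat.exists_eq_add_of_le' hi
  have h1 : ∑ c ∈ Finset.range k, (if k + i ≤ c + i then g c else 0) = 0 := by
    refine Finset.sum_eq_zero fun c hc => ?_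
    have := Finset.mem_range.1 hc
    rw [if_neg (by omega)]
  rw [Finset.sum_range_add, h1, zero_add]
  refine Finset.sum_congr rfl fun r _ => ?_
  rw [if_pos (by omega), Nat.add_sub_cancel]

/-- The estimates of the search are the positive parts of sums of independent signs. -/
theorem cast_agrees {N i : ℕ} (hi : i ≤ n) (w : Fin N → Vec n × Vec n) (s : List Bool) :
    ((2 * (∑ j ∈ Finset.range N, if agrees n (encPairs w) (queryAns f w) i s j then 1 else 0) -
      N : ℕ) : ℝ) = max (∑ j, suffixCorr f i (suffixVec n i s) (w j)) 0 := by
  unfold agrees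
  rw [cast_two_mul_sub]
  congr 1
  refine Finset.sum_congr rfl fun j _ => ?_
  have h0 := queryAns_getD f (Nat.zero_le n) w j
  rw [add_zero, shift_suffixHash_zero, add_zero] at h0
  rw [h0, queryAns_getD f hi, bz_xor, bz_xor, sgn_add, sgn_add, sgn_label, sgn_label, bz_parity,
    suffixCorr, mul_assoc, mul_assoc, chi_eq_sgn]
  congr 3
  have h1 := sum_fin_suffix (M := ZMod 2) hi fun c => bz (s.getD (c + i - n) false) *
    (bz ((encodeVec (w j).1).getD c false) + bz ((encodeVec (w j).2).getD c false))
  have h2 : ∀ r, n - i + r + i - n = r := fun r => by omega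
  simp only [h2] at h1
  rw [encPairs, ofFn_getD]
  simp only [bz_and, bz_xor]
  rw [h1]
  refine Finset.sum_congr rfl fun c _ => ?_
  rw [suffixVec, bz_encodeVec, bz_encodeVec]
  split_ifs <;> simp

/-- The mass of the vectors with a given suffix. -/
noncomputable def suffixMass (i : ℕ) (s : List Bool) : ℝ :=
  bucketMass f (suffixHash n i) (suffixVec n i s)

/-- The substitution `c = u + v` turns the two independent vectors of a sample into the point and the
coefficients in `sum_corr`. -/
theorem sum_suffixCorr (i : ℕ) (s : List Bool) :
    ∑ p, suffixCorr f i (suffixVec n i s) p =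
      Fintype.card (Vec n × Vec n) * suffixMass f i s := by
  rw [Fintype.card_prod, card_vec, Fintype.sum_prod_type, suffixMass]
  push_cast
  rw [← sum_corr]
  refine Finset.sum_congr rfl fun u _ => ?_
  rw [← Equiv.sum_comp (Equiv.addLeft u) fun c => val f u *
    val f (u + shift (suffixHash n i) c) * chi (suffixVec n i s) c]
  rfl

theorem abs_suffixCorr (i : ℕ) (b : Vec n) (p : Vec n × Vec n) : |suffixCorr f i b p| ≤ 1 := by
  rw [suffixCorr, abs_mul, abs_mul, abs_val, abs_val, abs_chi]
  norm_num

/-- The estimates for all suffixes are accurate. -/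
def SuffixesOK (a : ℕ) {N : ℕ} (w : Fin N → Vec n × Vec n) : Prop :=
  ∀ i ≤ n, ∀ s : Vec i, |∑ j, suffixCorr f i (suffixVec n i (encodeVec s)) (w j) -
    N * suffixMass f i (encodeVec s)| < N * (1 / (32 * accInv a))

theorem encode_decode {i : ℕ} {s : List Bool} (hs : s.length = i) :
    encodeVec (decodeVec i s) = s := by
  refine List.ext_getElem (by simp [encodeVec, hs]) fun r hr hr' => ?_
  have h1 := bz_encodeVec (decodeVec i s) ⟨r, by omega⟩
  rw [decodeVec_apply, bz_inj, List.getD_eq_getElem _ _ hr, List.getD_eq_getElem _ _ hr'] at h1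
  exact h1

variable {f} {a N : ℕ} {w : Fin N → Vec n × Vec n}

theorem isHeavy_iff {i : ℕ} (hi : i ≤ n) (s : List Bool) (ha : 1 ≤ a) :
    isHeavy n a N (encPairs w) (queryAns f w) i s = true ↔
      N * (3 / (32 * accInv a)) ≤ max (∑ j, suffixCorr f i (suffixVec n i s) (w j)) 0 := by
  have hA := accInv_pos ha
  rw [isHeavy, decide_eq_true_eq, ← cast_agrees f hi w s, mul_div_assoc',
    div_le_iff₀ (by positivity)]
  generalize 2 * (∑ j ∈ Finset.range N, if agrees n (encPairs w) (queryAns f w) i s j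
    then 1 else 0) - N = X
  rw [← Nat.cast_le (α := ℝ)]
  push_cast
  constructor <;> intro h <;> linarith

theorem isHeavy_of_le {i : ℕ} (hi : i ≤ n) {s : List Bool} (hs : s.length = i) (ha : 1 ≤ a)
    (hw : SuffixesOK f a w) (h : 1 / (8 * accInv a) ≤ suffixMass f i s) :
    isHeavy n a N (encPairs w) (queryAns f w) i s = true := by
  have hA := accInv_pos ha
  rw [isHeavy_iff hi s ha]
  have h1 := hw i hi (decodeVec i s)
  rw [encode_decode hs] at h1
  have h2 := (abs_lt.1 h1).1
  refine le_max_of_le_left ?_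
  have e1 : (1 / (8 * accInv a) : ℝ) = 4 * (1 / (32 * accInv a)) := by field_simp; norm_num
  have e2 : (3 / (32 * accInv a) : ℝ) = 3 * (1 / (32 * accInv a)) := by field_simp
  have hN : (0 : ℝ) ≤ N := by positivity
  have h3 := mul_le_mul_of_nonneg_left h hN
  rw [e1] at h3
  rw [e2]
  linarith

theorem le_of_isHeavy {i : ℕ} (hi : i ≤ n) {s : List Bool} (hs : s.length = i) (ha : 1 ≤ a)
    (hN : 0 < N) (hw : SuffixesOK f a w)
    (h : isHeavy n a N (encPairs w) (queryAns f w) i s = true) :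
    1 / (16 * accInv a) ≤ suffixMass f i s := by
  have hA := accInv_pos ha
  rw [isHeavy_iff hi s ha] at h
  have h1 := hw i hi (decodeVec i s)
  rw [encode_decode hs] at h1
  have h2 := (abs_lt.1 h1).2
  have hN : (0 : ℝ) < N := by exact_mod_cast hN
  have e1 : (1 / (16 * accInv a) : ℝ) = 2 * (1 / (32 * accInv a)) := by field_simp; norm_num
  have e2 : (3 / (32 * accInv a) : ℝ) = 3 * (1 / (32 * accInv a)) := by field_simp
  have hu : (0 : ℝ) < 1 / (32 * accInv a) := by positivity
  have := mul_pos hN hu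
  rw [e2] at h
  rw [e1]
  rcases max_cases (∑ j, suffixCorr f i (suffixVec n i s) (w j)) 0 with ⟨h3, -⟩ | ⟨h3, -⟩
  · rw [h3] at h
    refine le_of_mul_le_mul_left (a := (N : ℝ)) ?_ hN
    linarith
  · rw [h3] at h
    linarith

theorem nodup_collect {β : Type} {p : ℕ → Bool} {v : ℕ → β} {M : ℕ}
    (h : ∀ i j, p i → p j → v i = v j → i = j) : (collect p v M).Nodup := by
  induction M with
  | zero => simp [collect]
  | succ M ih =>
    rw [collect]
    split_ifs with hp
    · refine List.nodup_cons.2 ⟨fun h1 => ?_, ih⟩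
      obtain ⟨i, hi, hpi, hv⟩ := mem_collect.1 h1
      exact hi.ne (h i M hpi hp hv)
    · exact ih

theorem heavy_succ (U : List (List Bool × List Bool)) (ans : List Bool) (i : ℕ) :
    heavy n a N U ans (i + 1) = extend n a N U ans i (heavy n a N U ans i) := rfl

theorem nodup_heavy (U : List (List Bool × List Bool)) (ans : List Bool) (i : ℕ) :
    (heavy n a N U ans i).Nodup := by
  induction i with
  | zero => simp [heavy]
  | succ i ih =>
    rw [heavy_succ]
    refine nodup_collect fun j j' hj hj' h => ?_
    simp only [Bool.and_eq_true, decide_eq_true_eq] at hj hj'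
    obtain ⟨h1, h2⟩ := List.cons.inj h
    change (heavy n a N U ans i).getD (j / 2) [] = (heavy n a N U ans i).getD (j' / 2) [] at h2
    rw [List.getD_eq_getElem _ _ hj.1, List.getD_eq_getElem _ _ hj'.1] at h2
    have h3 := (List.Nodup.getElem_inj_iff ih).1 h2
    rw [decide_eq_decide] at h1
    omega

/-- Distinct suffixes of the same length belong to disjoint sets of vectors. -/
theorem sum_suffixMass_le {i : ℕ} (hi : i ≤ n) (S : Finset (List Bool))
    (hS : ∀ s ∈ S, s.length = i) : ∑ s ∈ S, suffixMass f i s ≤ 1 := by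
  classical
  simp only [suffixMass, bucketMass]
  rw [Finset.sum_comm, ← sum_fsq f]
  refine Finset.sum_le_sum fun γ _ => ?_
  rw [← Finset.sum_filter, Finset.sum_const, nsmul_eq_mul]
  have h1 : (S.filter fun s => hash (suffixHash n i) γ = suffixVec n i s).card ≤ 1 := by
    rw [Finset.card_le_one]
    intro s hs s' hs'
    obtain ⟨h1, h2⟩ := Finset.mem_filter.1 hs
    obtain ⟨h3, h4⟩ := Finset.mem_filter.1 hs'
    exact suffixVec_injOn hi (hS s h1) (hS s' h3) (h2.symm.trans h4)
  have h2 : ((S.filter fun s => hash (suffixHash n i) γ = suffixVec n i s).card : ℝ) ≤ 1 := by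
    exact_mod_cast h1
  have := fsq_nonneg f γ
  nlinarith

theorem suffixMass_nil : suffixMass f 0 [] = 1 := by
  rw [suffixMass, bucketMass, ← sum_fsq f]
  refine Finset.sum_congr rfl fun γ _ => if_pos ?_
  rw [hash_suffixHash]
  funext c
  rw [suffixVec, if_neg (by omega), if_neg (by omega)]

theorem le_of_mem_heavy (ha : 1 ≤ a) (hN : 0 < N) (hw : SuffixesOK f a w) {i : ℕ} (hi : i ≤ n)
    {s : List Bool} (hs : s ∈ heavy n a N (encPairs w) (queryAns f w) i) :
    1 / (16 * accInv a) ≤ suffixMass f i s := by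
  cases i with
  | zero =>
    have hA := accInv_pos ha
    have : s = [] := by simpa [heavy] using hs
    rw [this, suffixMass_nil, div_le_one (by positivity)]
    linarith
  | succ i =>
    have hlen := length_of_mem_heavy hs
    obtain ⟨j, -, hp, rfl⟩ := mem_collect.1 (show s ∈ extend n a N (encPairs w) (queryAns f w) i
      (heavy n a N (encPairs w) (queryAns f w) i) from hs)
    rw [Bool.and_eq_true] at hp
    exact le_of_isHeavy hi hlen ha hN hw hp.2

/-- There are few heavy suffixes, because their masses add up to at most `1`. -/
theorem length_heavy (ha : 1 ≤ a) (hN : 0 < N) (hw : SuffixesOK f a w) {i : ℕ} (hi : i ≤ n) :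
    (heavy n a N (encPairs w) (queryAns f w) i).length ≤ numCand a := by
  classical
  have hA := accInv_pos ha
  have h1 := sum_suffixMass_le (f := f) hi
    (heavy n a N (encPairs w) (queryAns f w) i).toFinset
    fun s hs => length_of_mem_heavy (List.mem_toFinset.1 hs)
  have h2 := Finset.card_nsmul_le_sum (heavy n a N (encPairs w) (queryAns f w) i).toFinset
    (suffixMass f i) (1 / (16 * accInv a))
    fun s hs => le_of_mem_heavy ha hN hw hi (List.mem_toFinset.1 hs)
  rw [List.toFinset_card_of_nodup (nodup_heavy _ _ _), nsmul_eq_mul] at h2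
  have h3 := h2.trans h1
  rw [mul_one_div, div_le_one (by positivity)] at h3
  rw [numCand]
  exact_mod_cast h3

/-- The search finds all large coefficients. -/
theorem suffix_mem_heavy (ha : 1 ≤ a) (hN : 0 < N) (hw : SuffixesOK f a w) {γ : Vec n}
    (hγ : 1 / (8 * accInv a) ≤ fsq f γ) {i : ℕ} (hi : i ≤ n) :
    suffix γ i ∈ heavy n a N (encPairs w) (queryAns f w) i := by
  induction i with
  | zero => simp [heavy, suffix, encodeVec]
  | succ i ih =>
    have ih := ih (by omega)
    obtain ⟨p, hp, hpγ⟩ := List.getElem_of_mem ih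
    have hp2 := hp.trans_le (length_heavy ha hN hw (by omega))
    have h1 : suffix γ (i + 1) = (encodeVec γ)[n - (i + 1)]'(by simp [encodeVec]; omega) ::
        suffix γ i := by
      rw [suffix, List.drop_eq_getElem_cons (by simp [encodeVec]; omega), suffix]
      congr 2
      omega
    generalize (encodeVec γ)[n - (i + 1)]'(by simp [encodeVec]; omega) = b at h1
    have hlen : (suffix γ (i + 1)).length = i + 1 := by simp [suffix, encodeVec]; omega
    have hh : isHeavy n a N (encPairs w) (queryAns f w) (i + 1) (suffix γ (i + 1)) = true := by
      refine isHeavy_of_le hi hlen ha hw (hγ.trans ?_)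
      rw [suffixMass, bucketMass]
      refine le_trans ?_ (Finset.single_le_sum (f := fun γ => if hash (suffixHash n (i + 1)) γ =
        _ then fsq f γ else 0) (fun γ _ => ?_) (Finset.mem_univ γ))
      · rw [if_pos (hash_eq_suffixVec hi γ)]
      · split_ifs <;> simp [fsq_nonneg]
    rw [heavy_succ]
    refine mem_collect.2 ⟨2 * p + if b then 1 else 0, ?_, ?_, ?_⟩
    · split_ifs <;> omega
    all_goals
      have hdiv : (2 * p + if b then 1 else 0) / 2 = p := by split_ifs <;> omega
      have hext : extension (heavy n a N (encPairs w) (queryAns f w) i)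
          (2 * p + if b then 1 else 0) = suffix γ (i + 1) := by
        rw [extension, hdiv, List.getD_eq_getElem _ _ hp, hpγ, h1]
        congr 1
        cases b <;> simp
    · rw [Bool.and_eq_true, decide_eq_true_eq, hdiv]
      rw [hext]
      exact ⟨hp, hh⟩
    · exact hext

theorem cand_firstMsg {n : ℕ} {p : Params} (hp : p.1 = n) (U : List (List Bool × List Bool))
    (ans : List Bool) {i : ℕ} (hi : i < numCand p.2.2.1) :
    cand n (firstMsg p U ans) i = decodeVec n
      ((heavy p.1 p.2.2.1 (numProver p.1 p.2.2.1 p.2.2.2) U ans p.1).getD i []) := by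
  subst hp
  funext c
  rw [cand, decodeVec_apply, rawVec, mapRange_getD _ _ _ _ c.2, firstMsg, Raw.get,
    mapRange_getD _ _ _ _ (index_lt hi c.2), index_div c.2, index_mod c.2]
  rfl

theorem numProver_pos (n l : ℕ) (ha : 1 ≤ a) : 0 < numProver n a l := by
  have : 0 < accInv a := by exact_mod_cast (zero_lt_one.trans_le (accInv_pos ha))
  rw [numProver]
  positivity

/-- All large coefficients are among the honest prover's candidates. -/
theorem fsq_le_of_not_isCand {t a l : ℕ} (ha : 1 ≤ a)
    {w : Fin (numProver n a l) → Vec n × Vec n} (hw : SuffixesOK f a w) {γ : Vec n}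
    (hγ : ¬ IsCand a (firstMsg (n, t, a, l) (encPairs w) (queryAns f w)) γ) :
    fsq f γ ≤ 1 / (8 * accInv a) := by
  by_contra h0
  refine hγ ?_
  have h1 := suffix_mem_heavy ha (numProver_pos n l ha) hw (not_le.1 h0).le le_rfl
  obtain ⟨p, hp, hpγ⟩ := List.getElem_of_mem h1
  have hp2 := hp.trans_le (length_heavy ha (numProver_pos n l ha) hw le_rfl)
  refine ⟨p, hp2, ?_⟩
  rw [cand_firstMsg (p := (n, t, a, l)) rfl _ _ hp2]
  change decodeVec n ((heavy n a (numProver n a l) (encPairs w) (queryAns f w) n).getD p []) = γ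
  rw [List.getD_eq_getElem _ _ hp, hpγ, suffix, Nat.sub_self, List.drop_zero, decode_encode]

theorem freq_not_suffixesOK (f : Vec n → ℤˣ) {a : ℕ} (l : ℕ) (ha : 1 ≤ a) :
    freq (fun w : Fin (numProver n a l) → Vec n × Vec n => ¬ SuffixesOK f a w) ≤
      (1 / 2) ^ (l + 3) := by
  have hA := accInv_pos ha
  have h1 : ∀ i (s : List Bool), freq (fun w : Fin (numProver n a l) → Vec n × Vec n =>
      numProver n a l * (1 / (32 * accInv a)) ≤
        |∑ j, suffixCorr f i (suffixVec n i s) (w j) -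
          numProver n a l * suffixMass f i s|) ≤ 2 * (1 / 2) ^ (n + l + 8) := by
    intro i s
    refine freq_abs_sum_ge _ _ _ _ _ (abs_suffixCorr f i _) (sum_suffixCorr f i s) (by positivity)
      ?_ (le_of_eq ?_)
    · rw [div_le_one (by positivity)]
      linarith
    · rw [numProver]
      push_cast
      field_simp
      ring
  have h2 := fun i => freq_exists_le_of_le (Finset.univ : Finset (Vec i)) _ _
    fun s _ => h1 i (encodeVec s)
  have h3 := freq_exists_le (Finset.range (n + 1)) fun i (w : Fin (numProver n a l) → _) =>
    ∃ s ∈ (Finset.univ : Finset (Vec i)), numProver n a l * (1 / (32 * accInv a)) ≤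
        |∑ j, suffixCorr f i (suffixVec n i (encodeVec s)) (w j) -
          numProver n a l * suffixMass f i (encodeVec s)|
  refine (freq_mono fun w hw => ?_).trans (h3.trans ((Finset.sum_le_sum fun i _ => h2 i).trans ?_))
  · by_contra h4
    push Not at h4
    exact hw fun i hi s => h4 i (Finset.mem_range.2 (by omega)) s (Finset.mem_univ _)
  · simp only [Finset.card_univ, card_vec]
    rw [← Finset.sum_mul]
    push_cast
    have h5 : (∑ i ∈ Finset.range (n + 1), (2 : ℝ) ^ i) ≤ 2 ^ (n + 1) := by
      rw [geom_sum_eq (by norm_num)]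
      norm_num
    refine (mul_le_mul_of_nonneg_right h5 (by positivity)).trans ?_
    have h6 : (2 : ℝ) ^ (n + 1) * (2 * (1 / 2) ^ (n + l + 8)) = (1 / 2) ^ (l + 3) * (1 / 8) := by
      rw [show n + l + 8 = n + (l + 3) + 5 by ring, pow_add _ n 1, pow_add _ _ 5,
        pow_add _ n (l + 3)]
      have : (2 : ℝ) ^ n * (1 / 2) ^ n = 1 := by rw [← mul_pow]; norm_num
      linear_combination (1 / 8 : ℝ) * (1 / 2) ^ (l + 3) * this
    rw [h6]
    have : (0 : ℝ) ≤ (1 / 2) ^ (l + 3) := by positivity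
    linarith

end Search

end FourierIP

namespace FourierIP

open scoped ENNReal

/-! ### The probabilities of the exceptional events -/

section Events

variable {n : ℕ} (f : Vec n → ℤˣ)

theorem abs_corr_le {k : ℕ} (Z : Fin k → Vec n) (b : Vec k) (w : ItemΩ n k) :
    |corr f Z b w| ≤ 1 := by
  rw [corr]
  split_ifs
  · simp
  · rw [abs_mul, abs_mul, abs_val, abs_val, abs_chi]
    norm_num

/-- Half of the items are tests and contribute nothing. -/
theorem sum_corr_item {k : ℕ} (Z : Fin k → Vec n) (b : Vec k) :
    ∑ w, corr f Z b w = Fintype.card (ItemΩ n k) * (bucketMass f Z b / 2) := by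
  have h1 := sum_corr f Z b
  simp only [corr]
  rw [Fintype.sum_prod_type]
  simp only [Fintype.sum_prod_type, Fintype.sum_bool, if_true, Finset.sum_const_zero,
    Bool.false_eq_true, if_false, zero_add]
  rw [h1, Fintype.card_prod, Fintype.card_prod, Fintype.card_bool, card_vec, card_vec]
  push_cast
  ring

/-- The exponent of the error probability of a single estimate. -/
def estimateExp (a l : ℕ) : ℕ := l + numBlocks l + numCand a + numBuckets a + 8

theorem numItems_eq (a l : ℕ) : (numItems a l : ℝ) =
    262144 * (accInv a : ℝ) ^ 4 * estimateExp a l := by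
  rw [numItems, tol, estimateExp]
  push_cast
  ring

theorem freq_not_bucketsOK {a : ℕ} (l : ℕ) (ha : 1 ≤ a) :
    freq (fun ω : Choices n a l => ¬ BucketsOK f a l ω) ≤ (1 / 2) ^ (l + 3) := by
  have hA := accInv_pos ha
  have h1 : ∀ (Z : Fin (hashBits a) → Vec n) (b : Vec (hashBits a)),
      freq (fun w : Fin (numItems a l) → ItemΩ n (hashBits a) =>
        numItems a l * (1 / (16 * accInv a)) ≤
          |∑ i, corr f Z b (w i) - numItems a l * (bucketMass f Z b / 2)|) ≤
        2 * (1 / 2) ^ estimateExp a l := by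
    intro Z b
    refine freq_abs_sum_ge _ _ _ _ _ (abs_corr_le f Z b) (sum_corr_item f Z b) (by positivity)
      ?_ ?_
    · rw [div_le_one (by positivity)]
      linarith
    · rw [numItems_eq]
      have h2 : 262144 * (accInv a : ℝ) ^ 4 * estimateExp a l * (1 / (16 * accInv a)) ^ 2 =
          16 * ((64 * (accInv a : ℝ) ^ 2) * estimateExp a l) := by
        field_simp
        ring
      rw [h2]
      have h3 : (1 : ℝ) ≤ 64 * (accInv a : ℝ) ^ 2 := by nlinarith
      have h4 : (0 : ℝ) ≤ estimateExp a l := by positivity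
      nlinarith
  have h2 : freq (fun w : BlockΩ n (hashBits a) (numItems a l) =>
      ∃ b ∈ (Finset.univ : Finset (Vec (hashBits a))), numItems a l * (1 / (16 * accInv a)) ≤
        |∑ i, corr f w.1 b (w.2 i) - numItems a l * (bucketMass f w.1 b / 2)|) ≤
      2 ^ hashBits a * (2 * (1 / 2) ^ estimateExp a l) := by
    refine freq_prod_le (by positivity) fun Z => ?_
    have h3 := freq_exists_le_of_le (Finset.univ : Finset (Vec (hashBits a))) _ _ fun b _ => h1 Z b
    rw [Finset.card_univ, card_vec, Nat.cast_pow, Nat.cast_ofNat] at h3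
    exact h3
  have h3 := freq_exists_le_of_le (Finset.univ : Finset (Fin (numBlocks l)))
    (fun ℓ (ω : Choices n a l) => ∃ b ∈ (Finset.univ : Finset (Vec (hashBits a))), numItems a l * (1 / (16 * accInv a)) ≤
        |∑ i, corr f (ω ℓ).1 b ((ω ℓ).2 i) - numItems a l * (bucketMass f (ω ℓ).1 b / 2)|) _
    fun ℓ _ => (freq_eval_le ℓ fun w : BlockΩ n (hashBits a) (numItems a l) =>
      ∃ b ∈ (Finset.univ : Finset (Vec (hashBits a))), numItems a l * (1 / (16 * accInv a)) ≤
        |∑ i, corr f w.1 b (w.2 i) - numItems a l * (bucketMass f w.1 b / 2)|).trans h2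
  refine (freq_mono fun ω hω => ?_).trans (h3.trans ?_)
  · by_contra h4
    push Not at h4
    exact hω fun ℓ b => h4 ℓ (Finset.mem_univ _) b (Finset.mem_univ _)
  · rw [Finset.card_univ, Fintype.card_fin]
    have h4 : (numBlocks l : ℝ) ≤ 2 ^ numBlocks l := by
      exact_mod_cast (Nat.lt_two_pow_self (n := numBlocks l)).le
    have h5 : (2 : ℝ) ^ hashBits a ≤ 2 ^ numBuckets a := by
      have h6 := (two_pow_hashBits ha).1.trans (Nat.lt_two_pow_self (n := numBuckets a)).le
      exact_mod_cast h6
    have h7 : (1 / 2 : ℝ) ^ estimateExp a l =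
        (1 / 2) ^ (l + 3) * (1 / 2) ^ numBlocks l * (1 / 2) ^ numBuckets a *
          (1 / 2) ^ numCand a * (1 / 32) := by
      rw [estimateExp, show (1 / 32 : ℝ) = (1 / 2) ^ 5 by norm_num, ← pow_add, ← pow_add,
        ← pow_add, ← pow_add]
      congr 1
      ring
    have h8 : ∀ i : ℕ, (2 : ℝ) ^ i * (1 / 2) ^ i = 1 := fun i => by
      rw [← mul_pow]; norm_num
    have h9 : (1 / 2 : ℝ) ^ numCand a ≤ 1 := pow_le_one₀ (by norm_num) (by norm_num)
    calc (numBlocks l : ℝ) * (2 ^ hashBits a * (2 * (1 / 2) ^ estimateExp a l))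
        ≤ 2 ^ numBlocks l * (2 ^ numBuckets a * (2 * (1 / 2) ^ estimateExp a l)) := by gcongr
      _ = (2 ^ numBlocks l * (1 / 2) ^ numBlocks l) * (2 ^ numBuckets a * (1 / 2) ^ numBuckets a) *
          ((1 / 2) ^ (l + 3) * (1 / 2) ^ numCand a * (1 / 16)) := by rw [h7]; ring
      _ = (1 / 2) ^ (l + 3) * (1 / 2) ^ numCand a * (1 / 16) := by rw [h8, h8]; ring
      _ ≤ (1 / 2) ^ (l + 3) * 1 * 1 := by gcongr; norm_num
      _ = _ := by ring

theorem freq_not_candsOK {a : ℕ} (l : ℕ) (r1 : Raw) (ha : 1 ≤ a) :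
    freq (fun ex : Fresh n a l => ¬ CandsOK f a l r1 ex) ≤ (1 / 2) ^ (l + 3) := by
  have hA := accInv_pos ha
  have h1 : ∀ γ : Vec n, freq (fun ex : Fresh n a l =>
        numItems a l * (1 / (128 * accInv a ^ 2)) ≤
          |∑ j, val f (ex j).1 * val f (ex j).2 * (chi γ (ex j).1 * chi γ (ex j).2) -
            numItems a l * fsq f γ|) ≤ 2 * (1 / 2) ^ estimateExp a l := by
    intro γ
    refine freq_abs_sum_ge (numItems a l)
      (fun w : Vec n × Vec n => val f w.1 * val f w.2 * (chi γ w.1 * chi γ w.2)) _ _ _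
      (fun w => ?_) (sum_pair_chi f γ) (by positivity) ?_ ?_
    · rw [abs_mul, abs_mul, abs_mul, abs_val, abs_val, abs_chi, abs_chi]
      norm_num
    · rw [div_le_one (by positivity)]
      nlinarith
    · rw [numItems_eq]
      refine le_of_eq ?_
      field_simp
      ring
  have h2 := freq_exists_le_of_le (Finset.range (numCand a)) _ _ fun i _ => h1 (cand n r1 i)
  refine (freq_mono fun ex hex => ?_).trans (h2.trans ?_)
  · by_contra h3
    push Not at h3
    exact hex fun i hi => h3 i (Finset.mem_range.2 hi)
  · rw [Finset.card_range]
    have h4 : (numCand a : ℝ) ≤ 2 ^ numCand a := by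
      exact_mod_cast (Nat.lt_two_pow_self (n := numCand a)).le
    have h7 : (1 / 2 : ℝ) ^ estimateExp a l =
        (1 / 2) ^ (l + 3) * (1 / 2) ^ numCand a * (1 / 2) ^ (numBlocks l + numBuckets a) *
          (1 / 32) := by
      rw [estimateExp, show (1 / 32 : ℝ) = (1 / 2) ^ 5 by norm_num, ← pow_add, ← pow_add, ← pow_add]
      congr 1
      ring
    have h8 : (2 : ℝ) ^ numCand a * (1 / 2) ^ numCand a = 1 := by rw [← mul_pow]; norm_num
    have h9 : (1 / 2 : ℝ) ^ (numBlocks l + numBuckets a) ≤ 1 :=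
      pow_le_one₀ (by norm_num) (by norm_num)
    calc (numCand a : ℝ) * (2 * (1 / 2) ^ estimateExp a l)
        ≤ 2 ^ numCand a * (2 * (1 / 2) ^ estimateExp a l) := by gcongr
      _ = (2 ^ numCand a * (1 / 2) ^ numCand a) *
          ((1 / 2) ^ (l + 3) * (1 / 2) ^ (numBlocks l + numBuckets a) * (1 / 16)) := by
        rw [h7]; ring
      _ ≤ 1 * ((1 / 2) ^ (l + 3) * 1 * 1) := by rw [h8]; gcongr; norm_num
      _ = _ := by ring

/-- All hash functions have many collisions only with small probability. -/
theorem freq_collisions_all (a l : ℕ) :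
    freq (fun ω : Choices n a l => ∀ ℓ, 2 * (1 / 2) ^ hashBits a ≤ collisions f (ω ℓ).1) ≤
      (1 / 2) ^ (l + 3) := by
  have h1 := freq_forall_mem (Finset.univ : Finset (Fin (numBlocks l)))
    fun w : BlockΩ n (hashBits a) (numItems a l) =>
      2 * (1 / 2) ^ hashBits a ≤ collisions f w.1
  have h2 : freq (fun w : BlockΩ n (hashBits a) (numItems a l) =>
      2 * (1 / 2) ^ hashBits a ≤ collisions f w.1) ≤ 1 / 2 :=
    (freq_fst_le (Ω := Fin (hashBits a) → Vec n) (fun Z => 2 * (1 / 2) ^ hashBits a ≤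
      collisions f Z)).trans (freq_collisions f)
  rw [Finset.card_univ, Fintype.card_fin, numBlocks] at h1
  refine (freq_mono fun ω hω ℓ _ => hω ℓ).trans (h1.trans_le ?_)
  refine (pow_le_pow_left₀ (freq_nonneg _) h2 _).trans ?_
  exact pow_le_pow_of_le_one (by norm_num) (by norm_num) (by omega)

/-! ### Cheating at the points that the verifier does not know -/

variable {k m L : ℕ}

/-- What remains of the verifier's random choices when the points that it sends are known: the hash
functions, and for each item the test bit and the coefficients of the shift. -/
abbrev Hidden (n k m L : ℕ) : Type :=
  (Fin L → Fin k → Vec n) × (Fin L × Fin m → Bool × Vec k)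

/-- The points that the verifier sends are uniformly distributed and independent of the hidden
choices. -/
def choicesEquiv (n k m L : ℕ) :
    (Fin L → BlockΩ n k m) ≃ (Fin L × Fin m → Vec n) × Hidden n k m L where
  toFun ω := (sentPoint ω, fun ℓ => (ω ℓ).1, fun j => ((ω j.1).2 j.2).2)
  invFun p := fun ℓ => (p.2.1 ℓ, fun i =>
    (p.1 (ℓ, i) + (if (p.2.2 (ℓ, i)).1 then 0 else shift (p.2.1 ℓ) (p.2.2 (ℓ, i)).2),
      p.2.2 (ℓ, i)))
  left_inv ω := by
    funext ℓ
    refine Prod.ext rfl (funext fun i => Prod.ext ?_ rfl)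
    simp only [sentPoint]
    rw [add_assoc, vec_add_self, add_zero]
  right_inv p := by
    refine Prod.ext (funext fun j => ?_) rfl
    simp only [sentPoint]
    rw [add_assoc, vec_add_self, add_zero]

theorem sentPoint_symm (y : Fin L × Fin m → Vec n) (h : Hidden n k m L) :
    sentPoint ((choicesEquiv n k m L).symm (y, h)) = y :=
  congrArg Prod.fst ((choicesEquiv n k m L).apply_symm_apply (y, h))

theorem freq_bool : freq (fun b : Bool => b = false) = 1 / 2 := by
  rw [freq_eq]
  have : (Finset.univ.filter fun b : Bool => b = false) = {false} := by decide
  rw [this]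
  simp

theorem freq_bool_prod : freq (fun w : Bool × Vec k => w.1 = false) ≤ 1 / 2 :=
  (freq_fst_le (Ω := Bool) (Ω' := Vec k) (fun b => b = false)).trans_eq freq_bool
/-- A prover that gives many wrong answers passes all tests only with small probability. -/
theorem freq_hidden_le (r : ℕ) (B : Finset (Fin L × Fin m)) :
    freq (fun h : Hidden n k m L => r ≤ B.card ∧ ∀ j ∈ B, (h.2 j).1 = false) ≤ (1 / 2) ^ r := by
  by_cases hr : r ≤ B.card
  · have h1 := freq_forall_mem B fun w : Bool × Vec k => w.1 = false
    refine (freq_mono fun w hw => hw.2).trans ((freq_snd_le (Ω := Fin L → Fin k → Vec n)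
      (fun h : Fin L × Fin m → Bool × Vec k => ∀ j ∈ B, (h j).1 = false)).trans (h1.trans_le ?_))
    exact (pow_le_pow_left₀ (freq_nonneg _) freq_bool_prod _).trans
      (pow_le_pow_of_le_one (by norm_num) (by norm_num) hr)
  · simp only [hr, false_and]
    simp [freq]

/-- If an event implies an event of the first stage of an experiment, then its probability is at most
the probability of the latter. -/
theorem pr_bind_le_pr {α β : Type*} (p : PMF α) (g : α → PMF β) {E : β → Prop} {E' : α → Prop}
    (h : ∀ x, ∀ y ∈ (g x).support, E y → E' x) : pr (p.bind g) E ≤ pr p E' := by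
  classical
  have h1 : pr (p.bind fun x => (g x).map fun y => (x, y)) (fun z => E z.2) = pr (p.bind g) E := by
    rw [← pr_map _ Prod.snd, PMF.map_bind]
    congr 2
    funext x
    rw [PMF.map_comp]
    exact PMF.map_id _
  have h2 : pr (p.bind fun x => (g x).map fun y => (x, y)) (fun z => E' z.1) = pr p E' := by
    rw [← pr_map _ Prod.fst, PMF.map_bind]
    have : ∀ x, ((g x).map fun y => (x, y)).map Prod.fst = PMF.pure x := fun x => by
      rw [PMF.map_comp]
      exact PMF.map_const _ _
    simp only [this, PMF.bind_pure]
  rw [← h1, ← h2]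
  refine pr_mono _ fun z hz hE => ?_
  rw [PMF.mem_support_bind_iff] at hz
  obtain ⟨x, -, hz⟩ := hz
  rw [PMF.support_map] at hz
  obtain ⟨y, hy, rfl⟩ := hz
  exact h x y hy hE

/-- Answers that depend only on the verifier's message contain many wrong ones and pass all tests
only with small probability. -/
theorem pr_wrong_le (a l : ℕ) (s : Raw → PMF Raw) :
    pr ((PMF.uniformOfFintype (Choices n a l)).bind fun ω =>
      (s (challengeMsg n (hashBits a) (numItems a l) (numBlocks l) (encBlocks f ω))).map
        fun r2 => (ω, r2))
      (fun z => l + 3 ≤ (wrong f a l z.2 z.1).card ∧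
        ∀ j : Fin (numBlocks l) × Fin (numItems a l), ((z.1 j.1).2 j.2).2.1 = true →
          answerAt a l z.2 j = encodeLabel (f ((z.1 j.1).2 j.2).1)) ≤
      ENNReal.ofReal ((1 / 2) ^ (l + 3)) := by
  classical
  rw [← uniform_map_equiv (choicesEquiv n (hashBits a) (numItems a l) (numBlocks l)).symm,
    PMF.bind_map, ← uniform_prod, PMF.bind_bind]
  refine pr_bind_le _ _ _ _ fun y _ => ?_
  simp only [PMF.bind_bind, PMF.pure_bind, Function.comp_def]
  -- Given the points, the message and hence the answers do not depend on the hidden choices.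
  have h1 : ∀ h : Hidden n (hashBits a) (numItems a l) (numBlocks l),
      challengeMsg n (hashBits a) (numItems a l) (numBlocks l)
        (encBlocks f ((choicesEquiv n (hashBits a) (numItems a l) (numBlocks l)).symm (y, h))) =
      challengeMsg n (hashBits a) (numItems a l) (numBlocks l)
        (encBlocks f ((choicesEquiv n (hashBits a) (numItems a l) (numBlocks l)).symm
          (y, Classical.arbitrary _))) := fun h => by
    refine challengeMsg_eq f _ _ ?_
    rw [sentPoint_symm, sentPoint_symm]
  simp only [h1, ← PMF.bind_pure_comp, Function.comp_def]
  rw [PMF.bind_comm]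
  refine pr_bind_le _ _ _ _ fun r2 _ => ?_
  change pr ((PMF.uniformOfFintype (Hidden n (hashBits a) (numItems a l) (numBlocks l))).bind
    (PMF.pure ∘ fun h => ((choicesEquiv n (hashBits a) (numItems a l) (numBlocks l)).symm (y, h),
      r2))) _ ≤ _
  rw [PMF.bind_pure_comp, pr_map, pr_uniform]
  refine ENNReal.ofReal_le_ofReal (le_trans (freq_mono fun h hh => ?_) (freq_hidden_le (l + 3)
    (Finset.univ.filter fun j => answerAt a l r2 j ≠ encodeLabel (f (y j)))))
  obtain ⟨h2, h3⟩ := hh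
  rw [wrong, sentPoint_symm] at h2
  refine ⟨h2, fun j hj => ?_⟩
  by_contra h4
  rw [Bool.not_eq_false] at h4
  have h5 := h3 j h4
  have h6 := congrFun (sentPoint_symm y h) j
  rw [sentPoint, if_pos (show (((choicesEquiv n (hashBits a) (numItems a l) (numBlocks l)).symm
    (y, h) j.1).2 j.2).2.1 = true from h4), add_zero] at h6
  rw [h6] at h5
  exact (Finset.mem_filter.1 hj).2 h5

end Events

end FourierIP

namespace FourierIP

open Coded
open scoped ENNReal

/-! ### The protocol -/

section Protocol

variable {n : ℕ} (f : Vec n → ℤˣ) (t a l : ℕ)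

theorem challengeD_eq (r1 : Raw) : challengeD (exampleOracle f) ((n, t, a, l), r1) =
    (PMF.uniformOfFintype (Choices n a l)).map fun ω =>
      (challengeMsg n (hashBits a) (numItems a l) (numBlocks l) (encBlocks f ω),
        (n, t, a, l), r1, encBlocks f ω) := by
  rw [challengeD, blocksD_eq, PMF.bind_map, ← PMF.bind_pure_comp]
  rfl

theorem concludeD_eq (r1 r2 : Raw) (ω : Choices n a l) :
    concludeD (exampleOracle f) (((n, t, a, l), r1, encBlocks f ω), r2) =
      (PMF.uniformOfFintype (Fresh n a l)).map fun ex => (mkView f t a l r1 r2 ω ex).verdict := by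
  rw [concludeD, exPairsD_eq, PMF.bind_map, ← PMF.bind_pure_comp]
  rfl

theorem proverFirstD_eq : proverFirstD (queryOracle f) (n, t, a, l) =
    (PMF.uniformOfFintype (Fin (numProver n a l) → Vec n × Vec n)).map fun w =>
      (firstMsg (n, t, a, l) (encPairs w) (queryAns f w), (n, t, a, l)) := by
  rw [proverFirstD, vecPairsD_eq, PMF.bind_map, ← PMF.bind_pure_comp]
  congr 1
  funext w
  simp only [Function.comp_def, queryOracle, tabD_pure, PMF.pure_bind, List.append_nil]
  rfl

theorem proverSecondD_eq (msg : Raw) : proverSecondD (queryOracle f) ((n, t, a, l), msg) =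
    PMF.pure ⟨(List.range (numBlocks l * numItems a l)).map fun q =>
      encodeLabel (f (decodeVec n (rawVec n msg q)))⟩ := by
  simp only [proverSecondD, queryOracle, tabD_pure, PMF.pure_bind, List.append_nil]

/-- The verifier that consists of two given programs. -/
def mkVerifier (c₁ : Code .unit .example (ty (Params × Raw)) (ty (Raw × Params × Raw × List Block)))
    (c₂ : Code .unit .example (ty ((Params × Raw × List Block) × Raw)) (ty (Bool × List Raw))) :
    Verifier := ⟨ty (Params × Raw × List Block), c₁, c₂⟩

/-- The prover that consists of two given programs. -/
def mkProver (c₁ : Code .bits .bool (ty Params) (ty (Raw × Params)))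
    (c₂ : Code .bits .bool (ty (Params × Raw)) (ty Raw)) : ProverProgram := ⟨ty Params, c₁, c₂⟩

/-- The joint distribution of the prover's messages and the verifier's random choices in an
interaction. -/
noncomputable def transcript (Q : Prover) :
    PMF (Raw × Choices n a l × Raw × Fresh n a l) :=
  Q.first.bind fun x => (PMF.uniformOfFintype (Choices n a l)).bind fun ω =>
    (Q.second x.val.2 (challengeMsg n (hashBits a) (numItems a l) (numBlocks l)
      (encBlocks f ω)).bits).bind fun y =>
        (PMF.uniformOfFintype (Fresh n a l)).map fun ex => (⟨x.val.1⟩, ω, ⟨y.val⟩, ex)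

/-- The output of the verifier. -/
def outcome (z : Raw × Choices n a l × Raw × Fresh n a l) : Option (Finset (Vec n)) :=
  if (mkView f t a l z.1 z.2.2.1 z.2.1 z.2.2.2).accepts then
    some (mkView f t a l z.1 z.2.2.1 z.2.1 z.2.2.2).out else none

theorem decodeOutput_enc (w : View) :
    decodeOutput w.dim (enc w.verdict) = if w.accepts then some w.out else none := by
  have h : (enc w.verdict : Bool × List (List Bool)) =
    (w.accepts, w.verdict.2.map Raw.bits) := rfl
  rw [h, decodeOutput, View.out]

variable {c₁ : Code .unit .example (ty (Params × Raw)) (ty (Raw × Params × Raw × List Block))}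
  {c₂ : Code .unit .example (ty ((Params × Raw × List Block) × Raw)) (ty (Bool × List Raw))}
  {T₁ : Params × Raw → ℕ} {T₂ : (Params × Raw × List Block) × Raw → ℕ}

/-- A continuation that uses only the value of a computation. -/
theorem bind_val {α β : Type} {γ : Type*} {p : PMF (Run β)} {q : PMF α} {e : α → β}
    (h : p.map Run.val = q.map e) (g : β → PMF γ) :
    (p.bind fun r => g r.val) = q.bind fun y => g (e y) := by
  have h1 : (p.map Run.val).bind g = (q.map e).bind g := by rw [h]
  rwa [PMF.bind_map, PMF.bind_map] at h1

/-- In the interaction with any prover, the verifier's output is the outcome of the transcript. -/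
theorem map_output (h₁ : ∀ o x, Samples (c₁.eval o (enc x)) (challengeD o x) enc (T₁ x)
      (numBlocks x.1.2.2.2 * numItems x.1.2.2.1 x.1.2.2.2))
    (h₂ : ∀ o x, Samples (c₂.eval o (enc x)) (concludeD o x) enc (T₂ x)
      (2 * numItems x.1.1.2.2.1 x.1.1.2.2.2)) (Q : Prover) :
    (interact Q (mkVerifier c₁ c₂) f (n, t, a, l)).map Outcome.output =
      (transcript f a l Q).map (outcome f t a l) := by
  rw [interact, transcript]
  simp only [PMF.map_bind, PMF.map_comp, Function.comp_def]
  congr 1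
  funext x
  have h3 := bind_val (h₁ (exampleOracle f) ((n, t, a, l), ⟨x.val.1⟩)).1
    fun v : (ty (Raw × Params × Raw × List Block)).interp => (Q.second x.val.2 v.1).bind fun y =>
      ((mkVerifier c₁ c₂).conclude.eval (exampleOracle f) (v.2, y.val)).map fun d =>
        decodeOutput n d.val
  refine h3.trans ?_
  rw [challengeD_eq, PMF.bind_map]
  congr 1
  funext ω
  change (PMF.bind (Q.second x.val.2 _) _) = _
  refine congrArg (PMF.bind _) (funext fun y => ?_)
  have h4 := bind_val (h₂ (exampleOracle f) (((n, t, a, l), ⟨x.val.1⟩, encBlocks f ω), ⟨y.val⟩)).1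
    fun v => PMF.pure (decodeOutput n v)
  refine Eq.trans (PMF.bind_pure_comp _ _).symm (h4.trans ?_)
  rw [concludeD_eq, PMF.bind_map, ← PMF.bind_pure_comp]
  refine congrArg (PMF.bind _) (funext fun ex => ?_)
  exact congrArg PMF.pure (decodeOutput_enc (mkView f t a l ⟨x.val.1⟩ ⟨y.val⟩ ω ex))

variable {a l}

theorem pr_not_bucketsOK (ha : 1 ≤ a) (Q : Prover) :
    pr (transcript f a l Q) (fun z => ¬ BucketsOK f a l z.2.1) ≤
      ENNReal.ofReal ((1 / 2) ^ (l + 3)) := by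
  refine pr_bind_le _ _ _ _ fun x _ => ?_
  refine (pr_bind_le_pr (E' := fun ω => ¬ BucketsOK f a l ω) _ _ fun ω z hz hE => ?_).trans
    ((pr_uniform _).trans_le (ENNReal.ofReal_le_ofReal (freq_not_bucketsOK f l ha)))
  simp only [PMF.mem_support_bind_iff, PMF.support_map] at hz
  obtain ⟨y, -, ex, -, rfl⟩ := hz
  exact hE

theorem pr_collisions_all (Q : Prover) :
    pr (transcript f a l Q)
      (fun z => ∀ ℓ, 2 * (1 / 2) ^ hashBits a ≤ collisions f (z.2.1 ℓ).1) ≤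
      ENNReal.ofReal ((1 / 2) ^ (l + 3)) := by
  refine pr_bind_le _ _ _ _ fun x _ => ?_
  refine (pr_bind_le_pr (E' := fun ω : Choices n a l =>
    ∀ ℓ, 2 * (1 / 2) ^ hashBits a ≤ collisions f (ω ℓ).1) _ _ fun ω z hz hE => ?_).trans
    ((pr_uniform _).trans_le (ENNReal.ofReal_le_ofReal (freq_collisions_all f a l)))
  simp only [PMF.mem_support_bind_iff, PMF.support_map] at hz
  obtain ⟨y, -, ex, -, rfl⟩ := hz
  exact hE

theorem pr_not_candsOK (ha : 1 ≤ a) (Q : Prover) :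
    pr (transcript f a l Q) (fun z => ¬ CandsOK f a l z.1 z.2.2.2) ≤
      ENNReal.ofReal ((1 / 2) ^ (l + 3)) := by
  refine pr_bind_le _ _ _ _ fun x _ => pr_bind_le _ _ _ _ fun ω _ => pr_bind_le _ _ _ _
    fun y _ => ?_
  rw [pr_map, pr_uniform]
  exact ENNReal.ofReal_le_ofReal (freq_not_candsOK f l _ ha)

theorem pr_cheating (Q : Prover) :
    pr (transcript f a l Q) (fun z => l + 3 ≤ (wrong f a l z.2.2.1 z.2.1).card ∧
      (mkView f t a l z.1 z.2.2.1 z.2.1 z.2.2.2).accepts = true) ≤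
      ENNReal.ofReal ((1 / 2) ^ (l + 3)) := by
  refine pr_bind_le _ _ _ _ fun x _ => ?_
  refine le_trans (le_of_eq ?_) ((pr_bind_le_pr _ (fun z : Choices n a l × Raw =>
    (PMF.uniformOfFintype (Fresh n a l)).map fun ex =>
      ((⟨x.val.1⟩, z.1, z.2, ex) : Raw × Choices n a l × Raw × Fresh n a l)) (E := fun z =>
      l + 3 ≤ (wrong f a l z.2.2.1 z.2.1).card ∧
      (mkView f t a l z.1 z.2.2.1 z.2.1 z.2.2.2).accepts = true) fun z y hy hE => ?_).trans
        (pr_wrong_le f a l fun r => (Q.second x.val.2 r.bits).map fun y => ⟨y.val⟩))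
  · congr 1
    rw [PMF.bind_bind]
    congr 1
    funext ω
    rw [PMF.bind_map, PMF.bind_map]
    rfl
  · rw [PMF.support_map] at hy
    obtain ⟨ex, -, rfl⟩ := hy
    exact ⟨hE.1, ((accepts_iff f).1 hE.2).1⟩

theorem IsTop.mono {ε ε' : ℝ} {Λ : Finset (Vec n)} (h : IsTop f ε Λ) (hε : ε ≤ ε') :
    IsTop f ε' Λ := fun α hα β hβ => (h α hα β hβ).trans (by linarith)

/-- The output is bad only if some estimate is inaccurate or the prover cheats undetected. -/
theorem soundness (ha : 1 ≤ a) {ε : ℝ} (hε : 1 / (a : ℝ) ≤ ε) (Q : Prover) :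
    pr (transcript f a l Q) (fun z => ∃ Λ, outcome f t a l z = some Λ ∧ ¬ IsTop f ε Λ) ≤
      3 * ENNReal.ofReal ((1 / 2) ^ (l + 3)) := by
  have hε0 : 0 ≤ ε := le_trans (by positivity) hε
  have h1 := pr_mono (transcript f a l Q)
    (E := fun z => ∃ Λ, outcome f t a l z = some Λ ∧ ¬ IsTop f ε Λ)
    (E' := fun z => (¬ BucketsOK f a l z.2.1 ∨ ¬ CandsOK f a l z.1 z.2.2.2) ∨
      (l + 3 ≤ (wrong f a l z.2.2.1 z.2.1).card ∧
      (mkView f t a l z.1 z.2.2.1 z.2.1 z.2.2.2).accepts = true)) (by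
    rintro z - ⟨Λ, hΛ, hT⟩
    rw [outcome] at hΛ
    split_ifs at hΛ with hacc
    by_contra! h2
    obtain ⟨⟨h2, h3⟩, h4⟩ := h2
    have h5 : ¬ l + 3 ≤ (wrong f a l z.2.2.1 z.2.1).card := fun h => by simpa [hacc] using h4 h
    have h6 := isTop_out f ha hε h2 h3 (not_le.1 h5) hacc
    exact hT (Option.some.inj hΛ ▸ h6.mono f (by linarith)))
  refine h1.trans ((pr_or_le _ _ _).trans ((add_le_add ((pr_or_le _ _ _).trans (add_le_add
    (pr_not_bucketsOK f ha Q) (pr_not_candsOK f ha Q))) (pr_cheating f t Q)).trans (le_of_eq ?_)))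
  ring

/-! ### The honest prover -/

variable {p₁ : Code .bits .bool (ty Params) (ty (Raw × Params))}
  {p₂ : Code .bits .bool (ty (Params × Raw)) (ty Raw)}
  {S₁ : Params → ℕ} {S₂ : Params × Raw → ℕ} {K₁ : Params → ℕ} {K₂ : Params × Raw → ℕ}

theorem answerAt_truth (ω : Choices n a l) (j : Fin (numBlocks l) × Fin (numItems a l)) :
    answerAt a l ⟨(List.range (numBlocks l * numItems a l)).map fun q =>
      encodeLabel (f (decodeVec n (rawVec n (challengeMsg n (hashBits a) (numItems a l)
        (numBlocks l) (encBlocks f ω)) q)))⟩ j = encodeLabel (f (sentPoint ω j)) := by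
  rw [answerAt, Raw.get, mapRange_getD _ _ _ _ (index_lt j.1.2 j.2.2), decode_challengeMsg]

/-- The messages and the running time of the honest prover. -/
theorem honest_support (h₁ : ∀ o x, Samples (p₁.eval o (enc x)) (proverFirstD o x) enc (S₁ x) (K₁ x))
    (h₂ : ∀ o x, Samples (p₂.eval o (enc x)) (proverSecondD o x) enc (S₂ x) (K₂ x))
    {x : Run (List Bool × (ty Params).interp)}
    (hx : x ∈ (p₁.eval (queryOracle f) (enc ((n, t, a, l) : Params))).support) {m : List Bool}
    {y : Run (List Bool)} (hy : y ∈ (p₂.eval (queryOracle f) (x.val.2, m)).support) :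
    x.val.2 = enc ((n, t, a, l) : Params) ∧ x.val.1.length = numCand a * n ∧
      y.steps ≤ S₂ ((n, t, a, l), ⟨m⟩) ∧
      y.val = (List.range (numBlocks l * numItems a l)).map fun q =>
        encodeLabel (f (decodeVec n (rawVec n ⟨m⟩ q))) := by
  obtain ⟨v, hv, hvx⟩ := (h₁ (queryOracle f) (n, t, a, l)).exists_val hx
  rw [proverFirstD_eq, PMF.support_map] at hv
  obtain ⟨w, -, rfl⟩ := hv
  have e1 : x.val.2 = enc ((n, t, a, l) : Params) := by rw [← hvx]; rfl
  rw [e1] at hy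
  have h3 := h₂ (queryOracle f) ((n, t, a, l), ⟨m⟩)
  obtain ⟨u, hu, huy⟩ := h3.exists_val hy
  rw [proverSecondD_eq, PMF.support_pure, Set.mem_singleton_iff] at hu
  refine ⟨e1, ?_, (h3.2.1 y hy).1, ?_⟩
  · rw [← hvx]
    change (firstMsg (n, t, a, l) (encPairs w) (queryAns f w)).bits.length = _
    rw [firstMsg, List.length_map, List.length_range]
  · rw [← huy, hu]
    rfl

/-- The honest prover misses a large coefficient only with small probability. -/
theorem pr_not_found (h₁ : ∀ o x, Samples (p₁.eval o (enc x)) (proverFirstD o x) enc (S₁ x) (K₁ x))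
    (ha : 1 ≤ a) :
    pr (transcript f a l ((mkProver p₁ p₂).toProver f (n, t, a, l)))
      (fun z => ∃ γ, ¬ IsCand a z.1 γ ∧ 1 / (8 * accInv a) < fsq f γ) ≤
      ENNReal.ofReal ((1 / 2) ^ (l + 3)) := by
  refine (pr_bind_le_pr (E' := fun x => ∃ γ, ¬ IsCand a ⟨x.val.1⟩ γ ∧
    1 / (8 * accInv a) < fsq f γ) _ _ fun x z hz hE => ?_).trans ?_
  · simp only [PMF.mem_support_bind_iff, PMF.support_map] at hz
    obtain ⟨ω, -, y, -, ex, -, rfl⟩ := hz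
    exact hE
  · have h3 := (h₁ (queryOracle f) (n, t, a, l)).1
    have h4 := pr_map (p₁.eval (queryOracle f) (enc ((n, t, a, l) : Params))) Run.val
      (fun v => ∃ γ, ¬ IsCand a ⟨v.1⟩ γ ∧ 1 / (8 * accInv a) < fsq f γ)
    refine h4.symm.trans_le ?_
    rw [h3, proverFirstD_eq, PMF.map_comp, pr_map, pr_uniform]
    refine ENNReal.ofReal_le_ofReal ((freq_mono fun w hw hok => ?_).trans
      (freq_not_suffixesOK f l ha))
    obtain ⟨γ, hγ, hlt⟩ := hw
    exact absurd (fsq_le_of_not_isCand ha hok hγ) (not_le.2 hlt)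

/-- With the honest prover, the output is good unless some estimate of either party is inaccurate or
every hash function has many collisions. -/
theorem completeness
    (h₁ : ∀ o x, Samples (p₁.eval o (enc x)) (proverFirstD o x) enc (S₁ x) (K₁ x))
    (h₂ : ∀ o x, Samples (p₂.eval o (enc x)) (proverSecondD o x) enc (S₂ x) (K₂ x))
    (ha : 1 ≤ a) (ht : t ≤ 2 ^ n) {ε : ℝ} (hε : 1 / (a : ℝ) ≤ ε) :
    pr (transcript f a l ((mkProver p₁ p₂).toProver f (n, t, a, l)))
      (fun z => ¬ ∃ Λ, outcome f t a l z = some Λ ∧ IsTop f (ε / 3) Λ) ≤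
      4 * ENNReal.ofReal ((1 / 2) ^ (l + 3)) := by
  set Q := (mkProver p₁ p₂).toProver f (n, t, a, l) with hQ
  have h3 := pr_mono (transcript f a l Q)
    (E := fun z => ¬ ∃ Λ, outcome f t a l z = some Λ ∧ IsTop f (ε / 3) Λ)
    (E' := fun z => (¬ BucketsOK f a l z.2.1 ∨ ¬ CandsOK f a l z.1 z.2.2.2) ∨
      ((∀ ℓ, 2 * (1 / 2) ^ hashBits a ≤ collisions f (z.2.1 ℓ).1) ∨
        ∃ γ, ¬ IsCand a z.1 γ ∧ 1 / (8 * accInv a) < fsq f γ)) (by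
    rintro z hz hE
    by_contra! h4
    obtain ⟨⟨h4, h5⟩, ⟨ℓ, h6⟩, h7⟩ := h4
    rw [transcript] at hz
    simp only [PMF.mem_support_bind_iff, PMF.support_map] at hz
    obtain ⟨x, hx, ω, -, y, hy, ex, -, rfl⟩ := hz
    have h8 := (honest_support f t h₁ h₂ hx hy).2.2.2
    have h9 : ∀ j, answerAt a l ⟨y.val⟩ j = encodeLabel (f (sentPoint ω j)) := fun j => by
      rw [h8]
      exact answerAt_truth f ω j
    have hacc := accepts_of_honest (t := t) f ha ht h4 h5 h9 h7 ⟨ℓ, h6⟩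
    have hwrong : (wrong f a l ⟨y.val⟩ ω).card < l + 3 := by
      have : wrong f a l ⟨y.val⟩ ω = ∅ := by
        rw [wrong, Finset.filter_eq_empty_iff]
        exact fun j _ => by simp [h9]
      rw [this]
      exact Nat.succ_pos _
    exact hE ⟨_, if_pos hacc, isTop_out f ha hε h4 h5 hwrong hacc⟩)
  refine h3.trans ((pr_or_le _ _ _).trans ((add_le_add ((pr_or_le _ _ _).trans (add_le_add
    (pr_not_bucketsOK f ha Q) (pr_not_candsOK f ha Q))) ((pr_or_le _ _ _).trans (add_le_add
      (pr_collisions_all f Q) (pr_not_found f t h₁ ha)))).trans (le_of_eq ?_)))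
  ring

/-! ### Resources -/

/-- The verifier's resources, and the size of its output, in every execution. -/
theorem resources (h₁ : ∀ o x, Samples (c₁.eval o (enc x)) (challengeD o x) enc (T₁ x)
      (numBlocks x.1.2.2.2 * numItems x.1.2.2.1 x.1.2.2.2))
    (h₂ : ∀ o x, Samples (c₂.eval o (enc x)) (concludeD o x) enc (T₂ x)
      (2 * numItems x.1.1.2.2.1 x.1.1.2.2.2)) {C₁ C₂ : ℕ} (hC₁ : ∀ x, T₁ x ≤ (sz x + 2) ^ C₁)
    (hC₂ : ∀ x, T₂ x ≤ (sz x + 2) ^ C₂) (Q : Prover) {ω : Outcome n}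
    (hω : ω ∈ (interact Q (mkVerifier c₁ c₂) f (n, t, a, l)).support) :
    ω.samples ≤ numBlocks l * numItems a l + 2 * numItems a l ∧
    ω.verifierSteps ≤ (n + t + a + l + 2) ^ C₁ + ((n + t + a + l + 2) ^ C₁ + 2) ^ C₂ ∧
    ω.verifierMsg.length = numBlocks l * numItems a l * n ∧
    ∀ Λ, ω.output = some Λ → Λ.card = t := by
  simp only [interact, PMF.mem_support_bind_iff, PMF.support_map] at hω
  obtain ⟨x, -, b, hb, c, -, d, hd, rfl⟩ := hω
  have h3 := h₁ (exampleOracle f) ((n, t, a, l), ⟨x.val.1⟩)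
  have hT : T₁ ((n, t, a, l), ⟨x.val.1⟩) ≤ (n + t + a + l + 2) ^ C₁ := by
    refine (hC₁ _).trans (Nat.pow_le_pow_left ?_ _)
    change n + (t + (a + l)) + 0 + 2 ≤ _
    omega
  obtain ⟨v, hv, hvb⟩ := h3.exists_val hb
  have hsz := h3.2.2 v hv
  rw [challengeD_eq, PMF.support_map] at hv
  obtain ⟨w, -, rfl⟩ := hv
  have h4 := h₂ (exampleOracle f) (((n, t, a, l), ⟨x.val.1⟩, encBlocks f w), ⟨c.val⟩)
  have hd' : d ∈ (c₂.eval (exampleOracle f)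
      (enc ((((n, t, a, l), ⟨x.val.1⟩, encBlocks f w), ⟨c.val⟩) :
        (Params × Raw × List Block) × Raw))).support := by
    rw [← hvb] at hd
    exact hd
  obtain ⟨u, hu, hud⟩ := h4.exists_val hd'
  have h5 := h3.2.1 b hb
  have h6 := h4.2.1 d hd'
  refine ⟨Nat.add_le_add h5.2 h6.2, Nat.add_le_add (h5.1.trans hT) (h6.1.trans ((hC₂ _).trans
    (Nat.pow_le_pow_left ?_ _))), ?_, fun Λ hΛ => ?_⟩
  · refine Nat.add_le_add_right (le_trans ?_ hT) 2
    refine le_trans ?_ hsz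
    change _ + 0 ≤ 0 + _
    rw [Nat.add_zero, Nat.zero_add]
  · change (b.val.1 : List Bool).length = _
    rw [← hvb]
    change (challengeMsg n (hashBits a) (numItems a l) (numBlocks l) (encBlocks f w)).bits.length = _
    rw [challengeMsg, List.length_map, List.length_range]
  · rw [concludeD_eq, PMF.support_map] at hu
    obtain ⟨ex, -, rfl⟩ := hu
    change decodeOutput n d.val = some Λ at hΛ
    rw [← hud] at hΛ
    have h7 := (decodeOutput_enc (mkView f t a l ⟨x.val.1⟩ ⟨c.val⟩ w ex)).symm.trans hΛ
    split_ifs at h7 with hacc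
    rw [← Option.some.inj h7]
    exact View.card_out.trans ((accepts_iff f).1 hacc).2.2

/-- The total communication and the running time of the honest prover. -/
theorem honest_resources (h₁ : ∀ o x, Samples (c₁.eval o (enc x)) (challengeD o x) enc (T₁ x)
      (numBlocks x.1.2.2.2 * numItems x.1.2.2.1 x.1.2.2.2))
    (h₂ : ∀ o x, Samples (c₂.eval o (enc x)) (concludeD o x) enc (T₂ x)
      (2 * numItems x.1.1.2.2.1 x.1.1.2.2.2)) {C₁ C₂ C₃ C₄ : ℕ}
    (hC₁ : ∀ x, T₁ x ≤ (sz x + 2) ^ C₁) (hC₂ : ∀ x, T₂ x ≤ (sz x + 2) ^ C₂)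
    (h₃ : ∀ o x, Samples (p₁.eval o (enc x)) (proverFirstD o x) enc (S₁ x) (K₁ x))
    (h₄ : ∀ o x, Samples (p₂.eval o (enc x)) (proverSecondD o x) enc (S₂ x) (K₂ x))
    (hC₃ : ∀ x, S₁ x ≤ (sz x + 2) ^ C₃) (hC₄ : ∀ x, S₂ x ≤ (sz x + 2) ^ C₄) {ω : Outcome n}
    (hω : ω ∈ (interact ((mkProver p₁ p₂).toProver f (n, t, a, l)) (mkVerifier c₁ c₂) f
      (n, t, a, l)).support) :
    ω.communication ≤ numCand a * n + numBlocks l * numItems a l * n +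
      numBlocks l * numItems a l ∧
    ω.proverSteps ≤ (n + t + a + l + 2) ^ C₃ + (n + t + a + l + 2) ^ C₄ := by
  have h5 := (resources f t h₁ h₂ hC₁ hC₂ _ hω).2.2.1
  simp only [interact, PMF.mem_support_bind_iff, PMF.support_map] at hω
  obtain ⟨x, hx, b, hb, c, hc, d, hd, rfl⟩ := hω
  obtain ⟨-, h6, h7, h8⟩ := honest_support f t h₃ h₄ hx hc
  refine ⟨?_, Nat.add_le_add ((((h₃ (queryOracle f) (n, t, a, l)).2.1 x hx).1.trans (hC₃ _)).trans
    (Nat.pow_le_pow_left ?_ _)) ((h7.trans (hC₄ _)).trans (Nat.pow_le_pow_left ?_ _))⟩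
  · refine Nat.add_le_add (Nat.add_le_add h6.le h5.le) (le_of_eq ?_)
    change (c.val : List Bool).length = _
    rw [h8, List.length_map, List.length_range]
  · change n + (t + (a + l)) + 2 ≤ _
    omega
  · change n + (t + (a + l)) + 0 + 2 ≤ _
    omega

end Protocol

end FourierIP

namespace FourierIP

open Coded
open scoped ENNReal

/-! ### The explicit form of the bounds -/

section Bounds

theorem le_polyBound {s C K : ℕ} {x : ℝ} (hC : C ≤ K) (hx : 0 ≤ x) (hs : (s : ℝ) ≤ 2 * x + 2) :
    (((s + 2) ^ C : ℕ) : ℝ) ≤ polyBound (4 ^ K) K x := by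
  have h1 : (s : ℝ) + 2 ≤ 4 * (1 + x) := by linarith
  have h2 : (1 : ℝ) ≤ s + 2 := by
    have : (0 : ℝ) ≤ s := by positivity
    linarith
  push_cast
  rw [polyBound]
  push_cast
  rw [← mul_pow]
  exact (pow_le_pow_right₀ h2 hC).trans (pow_le_pow_left₀ (by positivity) h1 K)

theorem add_one_le_polyBound {K : ℕ} (hK : 1 ≤ K) {x : ℝ} (hx : 0 ≤ x) :
    1 + x ≤ polyBound (4 ^ K) K x := by
  rw [polyBound]
  push_cast
  have h1 : 1 + x ≤ (1 + x) ^ K := le_self_pow₀ (by linarith) (by omega)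
  have h2 : (1 : ℝ) ≤ 4 ^ K := one_le_pow₀ (by norm_num)
  nlinarith

theorem polyBound_nonneg (C k : ℕ) {x : ℝ} (hx : 0 ≤ x) : 0 ≤ polyBound C k x := by
  rw [polyBound]
  positivity

theorem ceil_logb_le {y : ℝ} (hy : 1 ≤ y) : (⌈Real.logb 2 y⌉₊ : ℝ) ≤ 2 * Real.log y + 1 := by
  have h1 := Real.log_nonneg hy
  have h2 : Real.logb 2 y ≤ 2 * Real.log y := by
    rw [Real.logb, div_le_iff₀ (Real.log_pos (by norm_num))]
    have := Real.log_two_gt_d9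
    nlinarith
  exact (Nat.ceil_lt_add_one (Real.logb_nonneg (by norm_num) hy)).le.trans (by linarith)

theorem half_pow_ceil_logb_le {δ : ℝ} (hδ : 0 < δ) :
    (1 / 2 : ℝ) ^ ⌈Real.logb 2 (1 / δ)⌉₊ ≤ δ := by
  have h1 : 1 / δ ≤ (2 : ℝ) ^ ⌈Real.logb 2 (1 / δ)⌉₊ := by
    rw [← Real.rpow_natCast, ← Real.logb_le_iff_le_rpow (by norm_num) (by positivity)]
    exact Nat.le_ceil _
  rw [div_pow, one_pow, one_div_le (by positivity) hδ]
  exact h1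

end Bounds

end FourierIP

open FourierIP in
theorem theorem4p1 :
    ∃ (V : FourierIP.Verifier) (P : FourierIP.ProverProgram) (C k : ℕ),
      ∀ (n t : ℕ) (ε δ : ℝ), 1 ≤ n → 0 < ε → 0 < δ → δ < 1 →
      ∀ f : FourierIP.Vec n → ℤˣ,
        -- sample complexity, verifier's running time and message length, and form of the output,
        -- in every execution with every prover
        (∀ Q : FourierIP.Prover,
          ∀ ω ∈ (FourierIP.interact Q V f (FourierIP.params n t ε δ)).support,
            (ω.samples : ℝ) ≤ FourierIP.polyBound C k (t + 1 / ε + Real.log (1 / δ)) ∧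
            (ω.verifierSteps : ℝ) ≤
              FourierIP.polyBound C k (n + t + 1 / ε + Real.log (1 / δ)) ∧
            (ω.verifierMsg.length : ℝ) ≤
              n * FourierIP.polyBound C k (t + 1 / ε + Real.log (1 / δ)) ∧
            ∀ Λ, ω.output = some Λ → Λ.card = t) ∧
        -- communication complexity and the honest prover's running time
        (∀ ω ∈ (FourierIP.interact (P.toProver f (FourierIP.params n t ε δ)) V f
            (FourierIP.params n t ε δ)).support,
            (ω.communication : ℝ) ≤
              n * FourierIP.polyBound C k (t + 1 / ε + Real.log (1 / δ)) ∧
            (ω.proverSteps : ℝ) ≤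
              FourierIP.polyBound C k (n + t + 1 / ε + Real.log (1 / δ))) ∧
        -- completeness; the `o(1)` term is `poly(t, 1/ε, 1/δ) / 2^n`
        1 - δ - FourierIP.polyBound C k (t + 1 / ε + 1 / δ) / 2 ^ n ≤
          FourierIP.prob (FourierIP.interact (P.toProver f (FourierIP.params n t ε δ)) V f
              (FourierIP.params n t ε δ))
            (fun ω => ∃ Λ, ω.output = some Λ ∧ FourierIP.IsTop f (ε / 3) Λ) ∧
        -- soundness
        ∀ Q : FourierIP.Prover,
          FourierIP.prob (FourierIP.interact Q V f (FourierIP.params n t ε δ))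
            (fun ω => ∃ Λ, ω.output = some Λ ∧ ¬ FourierIP.IsTop f ε Λ) ≤
              δ + FourierIP.polyBound C k (t + 1 / ε + 1 / δ) / 2 ^ n := by
  obtain ⟨c₁, T₁, ⟨C₁, hC₁⟩, h₁⟩ := Eff.challenge
  obtain ⟨c₂, T₂, ⟨C₂, hC₂⟩, h₂⟩ := Eff.conclude
  obtain ⟨K₁, p₁, S₁, ⟨C₃, hC₃⟩, h₃⟩ := Eff.proverFirst
  obtain ⟨K₂, p₂, S₂, ⟨C₄, hC₄⟩, h₄⟩ := Eff.proverSecond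
  -- The bound on the verifier's steps as a power of the size of the inputs.
  obtain ⟨D₁, hD₁⟩ : ∃ D, ∀ s : ℕ, (s + 2) ^ C₁ + ((s + 2) ^ C₁ + 2) ^ C₂ ≤ (s + 2) ^ D := by
    have h : PB (fun s : ℕ => (s + 2) ^ C₁) := ⟨C₁, fun s => le_rfl⟩
    exact h.add (h.comp C₂)
  obtain ⟨D₂, hD₂⟩ : ∃ D, ∀ s : ℕ, (s + 2) ^ C₃ + (s + 2) ^ C₄ ≤ (s + 2) ^ D := by
    have h : ∀ C, PB (fun s : ℕ => (s + 2) ^ C) := fun C => ⟨C, fun s => le_rfl⟩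
    exact (h C₃).add (h C₄)
  obtain ⟨D₃, hD₃⟩ : ∃ D, ∀ a l : ℕ, numCand a + 2 * (numBlocks l * numItems a l) +
      2 * numItems a l ≤ (a + l + 2) ^ D := by
    have h : PT .unit .unit (fun x : ℕ × ℕ => numCand x.1 + 2 * (numBlocks x.2 *
      numItems x.1 x.2) + 2 * numItems x.1 x.2) := by fun_prop
    obtain ⟨D, hD⟩ := h.sz_le
    exact ⟨D, fun a l => hD (a, l)⟩
  obtain ⟨K, hK⟩ : ∃ K, K = D₁ + D₂ + D₃ + 1 := ⟨_, rfl⟩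
  refine ⟨mkVerifier c₁ c₂, mkProver p₁ p₂, 4 ^ K, K, fun n t ε δ hn hε hδ hδ1 f => ?_⟩
  set a := ⌈1 / ε⌉₊
  set l := ⌈Real.logb 2 (1 / δ)⌉₊
  have hp : params n t ε δ = (n, t, a, l) := rfl
  rw [hp]
  have hε' : 0 < 1 / ε := by positivity
  have hδ' : 1 ≤ 1 / δ := by rw [le_div_iff₀ hδ]; linarith
  have hlog := Real.log_nonneg hδ'
  have ha : 1 ≤ a := Nat.one_le_ceil_iff.2 hε'
  have hae : 1 / (a : ℝ) ≤ ε := by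
    have ha0 : (0 : ℝ) < a := by exact_mod_cast ha
    rw [div_le_comm₀ ha0 hε]
    exact Nat.le_ceil _
  have ha' : (a : ℝ) ≤ 1 / ε + 1 := (Nat.ceil_lt_add_one hε'.le).le
  have hl' : (l : ℝ) ≤ 2 * Real.log (1 / δ) + 1 := ceil_logb_le hδ'
  have ht0 : (0 : ℝ) ≤ t := by positivity
  have hn0 : (0 : ℝ) ≤ n := by positivity
  have hlδ : (1 / 2 : ℝ) ^ l ≤ δ := half_pow_ceil_logb_le hδ
  have hpow : ∀ c : ℕ, c ≤ 8 → (c : ENNReal) * ENNReal.ofReal ((1 / 2) ^ (l + 3)) ≤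
      ENNReal.ofReal δ := by
    intro c hc
    rw [← ENNReal.ofReal_natCast, ← ENNReal.ofReal_mul (by positivity)]
    refine ENNReal.ofReal_le_ofReal (le_trans ?_ hlδ)
    have hc' : (c : ℝ) ≤ 8 := by exact_mod_cast hc
    have h0 : (0 : ℝ) ≤ (1 / 2) ^ l := by positivity
    rw [pow_add]
    nlinarith
  have hcom : ((numCand a + 2 * (numBlocks l * numItems a l) + 2 * numItems a l : ℕ) : ℝ) ≤
      polyBound (4 ^ K) K (t + 1 / ε + Real.log (1 / δ)) :=
    (Nat.cast_le.2 (hD₃ a l)).trans (le_polyBound (by omega) (by linarith)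
      (by push_cast; linarith))
  have hsize : ∀ D ≤ K, (((n + t + a + l + 2) ^ D : ℕ) : ℝ) ≤
      polyBound (4 ^ K) K (n + t + 1 / ε + Real.log (1 / δ)) := fun D hD =>
    le_polyBound hD (by linarith) (by push_cast; linarith)
  have hpoly := polyBound_nonneg (4 ^ K) K (x := t + 1 / ε + 1 / δ) (by linarith)
  refine ⟨fun Q ω hω => ?_, fun ω hω => ?_, ?_, fun Q => ?_⟩
  · obtain ⟨h5, h6, h7, h8⟩ := resources f t h₁ h₂ hC₁ hC₂ Q hω
    refine ⟨(Nat.cast_le.2 (h5.trans (by omega))).trans hcom,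
      (Nat.cast_le.2 (h6.trans (hD₁ _))).trans (hsize _ (by omega)), ?_, h8⟩
    rw [h7, Nat.cast_mul, mul_comm]
    exact mul_le_mul_of_nonneg_left ((Nat.cast_le.2 (by omega)).trans hcom) hn0
  · obtain ⟨h5, h6⟩ := honest_resources f t h₁ h₂ hC₁ hC₂ h₃ h₄ hC₃ hC₄ hω
    refine ⟨?_, (Nat.cast_le.2 (h6.trans (hD₂ _))).trans (hsize _ (by omega))⟩
    have h7 : ω.communication ≤
        n * (numCand a + 2 * (numBlocks l * numItems a l) + 2 * numItems a l) := by
      refine h5.trans ?_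
      have h8 : numBlocks l * numItems a l ≤ n * (numBlocks l * numItems a l) :=
        Nat.le_mul_of_pos_left _ hn
      nlinarith [Nat.zero_le (n * numItems a l)]
    refine (Nat.cast_le.2 h7).trans ?_
    rw [Nat.cast_mul]
    exact mul_le_mul_of_nonneg_left hcom hn0
  · rw [prob_eq]
    set Q := (mkProver p₁ p₂).toProver f (n, t, a, l)
    have hnonneg : 0 ≤ (pr (interact Q (mkVerifier c₁ c₂) f (n, t, a, l)) fun ω =>
      ∃ Λ, ω.output = some Λ ∧ IsTop f (ε / 3) Λ).toReal := ENNReal.toReal_nonneg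
    rcases Nat.lt_or_ge (2 ^ n) t with ht | ht
    · -- No set of `t` vectors exists; the additional error term exceeds `1`.
      have h5 := add_one_le_polyBound (K := K) (by omega) (x := t + 1 / ε + 1 / δ) (by linarith)
      have h6 : (2 : ℝ) ^ n ≤ t := by exact_mod_cast ht.le
      have h7 : 1 ≤ polyBound (4 ^ K) K (t + 1 / ε + 1 / δ) / 2 ^ n := by
        rw [le_div_iff₀ (by positivity)]
        linarith
      linarith
    · have h5 := map_output f t a l h₁ h₂ Q
      have h6 := pr_map (interact Q (mkVerifier c₁ c₂) f (n, t, a, l)) Outcome.output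
        fun o => ∃ Λ, o = some Λ ∧ IsTop f (ε / 3) Λ
      rw [h5, pr_map] at h6
      rw [← h6]
      have h7 := one_le_pr_add (transcript f a l Q)
        fun z => ∃ Λ, outcome f t a l z = some Λ ∧ IsTop f (ε / 3) Λ
      have h8 := (completeness f t h₃ h₄ ha ht hae).trans (hpow 4 (by norm_num))
      have h9 := h7.trans (add_le_add_right h8 _)
      have h10 := ENNReal.toReal_mono (by
        exact ENNReal.add_ne_top.2 ⟨ne_top_of_le_ne_top ENNReal.one_ne_top (pr_le_one _ _),
          ENNReal.ofReal_ne_top⟩) h9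
      rw [ENNReal.toReal_one, ENNReal.toReal_add (ne_top_of_le_ne_top ENNReal.one_ne_top
        (pr_le_one _ _)) ENNReal.ofReal_ne_top, ENNReal.toReal_ofReal hδ.le] at h10
      have h11 : 0 ≤ polyBound (4 ^ K) K (t + 1 / ε + 1 / δ) / 2 ^ n := by positivity
      linarith
  · have h5 := map_output f t a l h₁ h₂ Q
    have h6 := pr_map (interact Q (mkVerifier c₁ c₂) f (n, t, a, l)) Outcome.output
      fun o => ∃ Λ, o = some Λ ∧ ¬ IsTop f ε Λ
    rw [h5, pr_map] at h6
    have h7 : prob (interact Q (mkVerifier c₁ c₂) f (n, t, a, l))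
        (fun ω => ∃ Λ, ω.output = some Λ ∧ ¬ IsTop f ε Λ) ≤ δ :=
      prob_le_of_pr_le _ _ hδ.le (h6.symm.trans_le ((soundness f t ha hae Q).trans
        (hpow 3 (by norm_num))))
    have h8 : 0 ≤ polyBound (4 ^ K) K (t + 1 / ε + 1 / δ) / 2 ^ n := by positivity
    linarith
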